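/- Let $K$ be a field of characteristic zero and let $(A,\cdot,\{-,-\})$ be a (not necessarily commutative) Poisson algebra over $K$: $(A,\cdot)$ is an associative unital $K$-algebra, $(A,\{-,-\})$ is a Lie algebra over $K$, and $\{a,bc\}=\{a,b\}c+b\{a,c\}$ for all $a,b,c\in A$. Let $U(A)$ be the universal enveloping algebra of the Lie algebra $(A,\{-,-\})$, with its coproduct $\Delta(u)=\sum u_1\otimes u_2$ for which the elements of $A$ are primitive; it acts on $A$, on $A^{\mathrm{op}}$ and diagonally on $A^e=A\otimes A^{\mathrm{op}}$ through $x\cdot a=\{x,a\}$. Let $\mathcal Q(A)=A^e\# U(A)$ be the smash product, i.e. $A^e\otimes U(A)$ with $(b\# u)(c\# v)=\sum b\,u_1(c)\# u_2v$. The algebra $A$ is a $\mathcal Q(A)$-module by $(a\otimes b'\# u)m=a\,u(m)\,b$, and the quasi-Poisson cohomology of $A$ is $\mathrm{HQ}^n(A)=\mathrm{Ext}^n_{\mathcal Q(A)}(A,A)$. Let $\mathrm{HH}^n(A)$ be the Hochschild cohomology of the associative algebra $A$ with coefficients in $A$. Write $C^{i,j}=\mathrm{Hom}_K(A^{\otimes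 i}\otimes\wedge^jA,A)$, and let $$\sigma^n\colon\prod_{i+j=n}C^{i,j}\to\prod_{i+j=n+1}C^{i,j}$$ be the differential that is $\sigma_V+(-1)^i\sigma_H$ on $C^{i,j}$, where $\sigma_V\colon C^{i,j}\to C^{i+1,j}$ is the Hochschild differential $$\begin{aligned}(\sigma_Vf)(a_1\otimes\cdots\otimes a_{i+1}\otimes\omega)={}&a_1f(a_2\otimes\cdots\otimes a_{i+1}\otimes\omega)+\sum_{t=1}^{i}(-1)^tf(a_1\otimes\cdots\otimes a_ta_{t+1}\otimes\cdots\otimes a_{i+1}\otimes\omega)\\&+(-1)^{i+1}f(a_1\otimes\cdots\otimes a_i\otimes\omega)a_{i+1}\end{aligned}$$ and $\sigma_H\colon C^{i,j}\to C^{i,j+1}$ is the Chevalley–Eilenberg differential: with $\underline a=a_1\otimes\cdots\otimes a_i$, $$\begin{aligned}(\sigma_Hf)(\underline a\otimes x_1\wedge\cdots\wedge x_{j+1})={}&\sum_{l}(-1)^{l+1}\Big[\{x_l,f(\underline a\otimes x_1\wedge\cdots\widehat{x}_l\cdots\wedge x_{j+1})\}\\&\qquad-\sum_{t=1}^if(a_1\otimes\cdots\otimes\{x_l,a_t\}\otimes\cdots\otimes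 a_i\otimes x_1\wedge\cdots\widehat{x}_l\cdots\wedge x_{j+1})\Big]\\&+\sum_{p<q}(-1)^{p+q}f(\underline a\otimes\{x_p,x_q\}\wedge x_1\wedge\cdots\widehat{x}_p\cdots\widehat{x}_q\cdots\wedge x_{j+1}).\end{aligned}$$ Put $\mathrm{Im}\,\sigma^{-1}=0$. Let $k$ be a positive integer such that $\mathrm{HH}^n(A)=0$ for all $n>k$, and let $\Omega_n^k=\mathrm{Hom}_K\big(\bigoplus_{i+j=n,\ i\le k}A^{\otimes i}\otimes\wedge^jA,\,A\big)$ be the space of those $n$-cochains that are supported on the components with $i\le k$. Then for every $n\ge0$ there is an isomorphism of $K$-vector spaces $$\mathrm{HQ}^n(A)\;\cong\;\frac{\mathrm{Ker}\,\sigma^n\cap\Omega_n^k}{\mathrm{Im}\,\sigma^{n-1}\cap\Omega_n^k},$$ and the map from the right-hand side to $\mathrm{Ker}\,\sigma^n/\mathrm{Im}\,\sigma^{n-1}$ induced by the inclusion $\mathrm{Ker}\,\sigma^n\cap\Omega_n^k\subseteq\mathrm{Ker}\,\sigma^n$ is bijective. -/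

import Mathlib

open scoped TensorProduct

universe u

noncomputable section

/-! ### Noncommutative Poisson algebras -/

/-- A (not necessarily commutative) Poisson algebra structure on the associative unital
`K`-algebra `A`: a Lie bracket satisfying the Leibniz rule `{a, bc} = {a, b} c + b {a, c}`. -/
structure PoissonBracket (K A : Type u) [Field K] [Ring A] [Algebra K A] where
  /-- the bilinear bracket `a ↦ b ↦ {a, b}` -/
  br : A →ₗ[K] A →ₗ[K] A
  br_self : ∀ a, br a a = 0
  jacobi : ∀ a b c, br a (br b c) = br (br a b) c + br b (br a c)
  leibniz : ∀ a b c, br a (b * c) = br a b * c + b * br a c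

namespace PoissonBracket

variable {K A : Type u} [Field K] [Ring A] [Algebra K A]

/-- The underlying vector space of `A`, regarded as a Lie algebra under the Poisson bracket. -/
def LieAlg (_P : PoissonBracket K A) : Type u := A

variable (P : PoissonBracket K A)

instance : AddCommGroup P.LieAlg := inferInstanceAs (AddCommGroup A)
instance : Module K P.LieAlg := inferInstanceAs (Module K A)

instance : LieRing P.LieAlg where
  bracket x y := P.br (x : A) (y : A)
  add_lie x y z := LinearMap.congr_fun (map_add P.br (x : A) (y : A)) (z : A)
  lie_add x _ _ := map_add (P.br (x : A)) _ _
  lie_self x := P.br_self x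
  leibniz_lie x y z := P.jacobi x y z

instance : LieAlgebra K P.LieAlg where
  lie_smul c x _ := map_smul (P.br (x : A)) c _

/-! ### The universal enveloping algebra and its coproduct -/

/-- The universal enveloping algebra `U(A)` of the Lie algebra `(A, {-,-})`. -/
abbrev U : Type u := UniversalEnvelopingAlgebra K P.LieAlg

section Actions

attribute [local instance] LieRing.ofAssociativeRing

/-- The canonical map `A → U(A)`. -/
def toU : A →ₗ[K] P.U := (UniversalEnvelopingAlgebra.ι K (L := P.LieAlg)).toLinearMap

/-- Construction of an algebra map out of `U(A)`. -/
def liftU {B : Type u} [Ring B] [Algebra K B] (f : A →ₗ[K] B)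
    (hf : ∀ x y, f (P.br x y) = f x * f y - f y * f x) : P.U →ₐ[K] B :=
  UniversalEnvelopingAlgebra.lift K (L := P.LieAlg)
    { toLinearMap := (f : P.LieAlg →ₗ[K] B)
      map_lie' := hf _ _ }

lemma liftU_toU {B : Type u} [Ring B] [Algebra K B] (f : A →ₗ[K] B)
    (hf : ∀ x y, f (P.br x y) = f x * f y - f y * f x) (x : A) :
    P.liftU f hf (P.toU x) = f x :=
  UniversalEnvelopingAlgebra.lift_ι_apply K (L := P.LieAlg) _ x

lemma toU_br (x y : A) :
    P.toU (P.br x y) = P.toU x * P.toU y - P.toU y * P.toU x :=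
  LieHom.map_lie (UniversalEnvelopingAlgebra.ι K (L := P.LieAlg)) x y

/-- `U(A)` is generated by `A`. -/
lemma U_induction {p : P.U → Prop} (h1 : ∀ c : K, p (algebraMap K _ c))
    (hx : ∀ x, p (P.toU x)) (hadd : ∀ u v, p u → p v → p (u + v))
    (hmul : ∀ u v, p u → p v → p (u * v)) (u : P.U) : p u := by
  let S : Subalgebra K P.U :=
    { carrier := {u | p u}
      mul_mem' := fun {a b} ha hb => hmul a b ha hb
      add_mem' := fun {a b} ha hb => hadd a b ha hb
      algebraMap_mem' := h1 }
  let f : P.LieAlg →ₗ⁅K⁆ S :=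
    { toFun := fun x => ⟨P.toU x, hx x⟩
      map_add' := fun x y => Subtype.ext (map_add P.toU _ _)
      map_smul' := fun c x => Subtype.ext (map_smul P.toU c _)
      map_lie' := fun {x y} => Subtype.ext (P.toU_br x y) }
  have h : S.val.comp (UniversalEnvelopingAlgebra.lift K f) = AlgHom.id K P.U := by
    refine UniversalEnvelopingAlgebra.hom_ext (R := K) (LieHom.ext fun x => ?_)
    change ((UniversalEnvelopingAlgebra.lift K f (UniversalEnvelopingAlgebra.ι K x) : S) : P.U) = _
    rw [UniversalEnvelopingAlgebra.lift_ι_apply]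
    rfl
  have h' := DFunLike.congr_fun h u
  rw [← show _ = u from h']
  exact (UniversalEnvelopingAlgebra.lift K f u).2

end Actions

/-- The coproduct `Δ : U(A) → U(A) ⊗ U(A)` of the Hopf algebra `U(A)`: the algebra map with
`Δ(x) = x ⊗ 1 + 1 ⊗ x` for `x ∈ A`. -/
def comulU : P.U →ₐ[K] P.U ⊗[K] P.U :=
  P.liftU (((TensorProduct.mk K P.U P.U).flip 1 + TensorProduct.mk K P.U P.U 1) ∘ₗ P.toU) <| by
    intro x y
    simp [toU_br, add_mul, mul_add, TensorProduct.tmul_sub]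
    abel

/-- The diagonal action of `U(A)` on the tensor product of two `U(A)`-modules: if
`Δ(u) = ∑ u₁ ⊗ u₂` then `u · (m ⊗ n) = ∑ u₁ m ⊗ u₂ n`. -/
def diag {M N : Type u} [AddCommGroup M] [Module K M] [AddCommGroup N] [Module K N]
    (φ : P.U →ₐ[K] Module.End K M) (ψ : P.U →ₐ[K] Module.End K N) :
    P.U →ₐ[K] Module.End K (M ⊗[K] N) :=
  (Module.endTensorEndAlgHom (R := K) (S := K) (A := K) (M := M) (N := N)).comp
    ((Algebra.TensorProduct.map φ ψ).comp P.comulU)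

lemma diag_toU {M N : Type u} [AddCommGroup M] [Module K M] [AddCommGroup N] [Module K N]
    (φ : P.U →ₐ[K] Module.End K M) (ψ : P.U →ₐ[K] Module.End K N) (x : A) (m : M) (n : N) :
    P.diag φ ψ (P.toU x) (m ⊗ₜ n) = φ (P.toU x) m ⊗ₜ n + m ⊗ₜ ψ (P.toU x) n := by
  simp [diag, comulU, liftU_toU, Module.endTensorEndAlgHom_apply]

/-- The action of `U(A)` on `A` with `x · a = {x, a}`. -/
def adU : P.U →ₐ[K] Module.End K A :=
  P.liftU P.br <| by
    intro x y
    ext z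
    simp [P.jacobi x y z]

lemma adU_toU (x : A) : P.adU (P.toU x) = P.br x := P.liftU_toU _ _ x

/-- The action of `U(A)` on `Aᵒᵖ`: the same as that on `A`. -/
def adUop : P.U →ₐ[K] Module.End K Aᵐᵒᵖ :=
  (((MulOpposite.opLinearEquiv K : A ≃ₗ[K] Aᵐᵒᵖ).conjAlgEquiv K).toAlgHom).comp P.adU

/-- The action of `U(A)` on `Aᵉ = A ⊗ Aᵒᵖ`. -/
def envAct : P.U →ₐ[K] Module.End K (A ⊗[K] Aᵐᵒᵖ) := P.diag P.adU P.adUop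

lemma envAct_toU (x : A) (a : A) (b : Aᵐᵒᵖ) :
    P.envAct (P.toU x) (a ⊗ₜ b) =
      P.br x a ⊗ₜ b + a ⊗ₜ MulOpposite.op (P.br x b.unop) := by
  rw [envAct, diag_toU, adU_toU]
  simp [adUop, adU_toU]

lemma envAct_toU_one (x : A) : P.envAct (P.toU x) 1 = 0 := by
  have h : P.br x 1 = 0 := by simpa using P.leibniz x 1 1
  rw [Algebra.TensorProduct.one_def, envAct_toU]
  simp [h]

lemma envAct_toU_mul (x : A) (b c : A ⊗[K] Aᵐᵒᵖ) :
    P.envAct (P.toU x) (b * c) = P.envAct (P.toU x) b * c + b * P.envAct (P.toU x) c := by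
  induction b with
  | zero => simp
  | add b b' hb hb' => rw [add_mul, map_add, hb, hb', map_add]; noncomm_ring
  | tmul a a' =>
    induction c with
    | zero => simp
    | add b b' hb hb' => rw [mul_add, map_add, hb, hb', map_add]; noncomm_ring
    | tmul d d' =>
      simp only [Algebra.TensorProduct.tmul_mul_tmul, envAct_toU, P.leibniz, add_mul, mul_add,
        TensorProduct.add_tmul, TensorProduct.tmul_add, MulOpposite.unop_mul, MulOpposite.op_add,
        MulOpposite.op_mul, MulOpposite.op_unop]
      abel

/-! ### The quasi-Poisson enveloping algebra `Q(A) = Aᵉ # U(A)` -/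

/-- The quasi-Poisson enveloping algebra: the smash product `Aᵉ # U(A)`, whose underlying vector
space is `(A ⊗ Aᵒᵖ) ⊗ U(A)`. -/
def Q : Type u := (A ⊗[K] Aᵐᵒᵖ) ⊗[K] P.U

instance : AddCommGroup P.Q := inferInstanceAs (AddCommGroup ((A ⊗[K] Aᵐᵒᵖ) ⊗[K] P.U))
instance : Module K P.Q := inferInstanceAs (Module K ((A ⊗[K] Aᵐᵒᵖ) ⊗[K] P.U))

/-- The element `b # u` of `Aᵉ # U(A)`. -/
def smash (b : A ⊗[K] Aᵐᵒᵖ) (u : P.U) : P.Q := b ⊗ₜ[K] u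

/-- Left multiplication by `c ∈ Aᵉ` on `Aᵉ # U(A)`: `c · (b # u) = cb # u`. -/
def envMul : A ⊗[K] Aᵐᵒᵖ →ₐ[K] Module.End K P.Q :=
  (Module.endTensorEndAlgHom (R := K) (S := K) (A := K) (M := A ⊗[K] Aᵐᵒᵖ) (N := P.U)).comp
    (Algebra.TensorProduct.includeLeft.comp (Algebra.lmul K (A ⊗[K] Aᵐᵒᵖ)))

/-- The diagonal action of `U(A)` on `Aᵉ # U(A)`, with `U(A)` acting on itself by left
multiplication: `w · (b # u) = ∑ w₁(b) # w₂ u`. -/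
def diagMul : P.U →ₐ[K] Module.End K P.Q := P.diag P.envAct (Algebra.lmul K P.U)

/-- The multiplication of the smash product: `(b # u)(c # v) = ∑ b u₁(c) # u₂ v`. -/
def mulQ : P.Q →ₗ[K] P.Q →ₗ[K] P.Q :=
  TensorProduct.lift
    ((LinearMap.mul K (Module.End K P.Q)).compl₁₂ P.envMul.toLinearMap P.diagMul.toLinearMap)

lemma Q_induction {p : P.Q → Prop} (h0 : p 0) (ht : ∀ b u, p (P.smash b u))
    (ha : ∀ x y, p x → p y → p (x + y)) (x : P.Q) : p x :=
  TensorProduct.induction_on x h0 ht ha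

lemma smash_add (b : A ⊗[K] Aᵐᵒᵖ) (u v : P.U) :
    P.smash b (u + v) = P.smash b u + P.smash b v := TensorProduct.tmul_add _ _ _

lemma smash_smul (b : A ⊗[K] Aᵐᵒᵖ) (c : K) (v : P.U) :
    P.smash b (c • v) = c • P.smash b v := TensorProduct.tmul_smul _ _ _

lemma zero_smash (u : P.U) : P.smash 0 u = 0 := TensorProduct.zero_tmul _ _

lemma mulQ_smash (b : A ⊗[K] Aᵐᵒᵖ) (u : P.U) :
    P.mulQ (P.smash b u) = P.envMul b * P.diagMul u := rfl

lemma envMul_smash (c b : A ⊗[K] Aᵐᵒᵖ) (u : P.U) :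
    P.envMul c (P.smash b u) = P.smash (c * b) u := by
  rfl

lemma diagMul_toU_smash (x : A) (b : A ⊗[K] Aᵐᵒᵖ) (u : P.U) :
    P.diagMul (P.toU x) (P.smash b u) =
      P.smash (P.envAct (P.toU x) b) u + P.smash b (P.toU x * u) :=
  P.diag_toU _ _ _ _ _

lemma diagMul_toU_mul_envMul (x : A) (c : A ⊗[K] Aᵐᵒᵖ) :
    P.diagMul (P.toU x) * P.envMul c =
      P.envMul (P.envAct (P.toU x) c) + P.envMul c * P.diagMul (P.toU x) := by
  refine LinearMap.ext fun z => ?_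
  induction z using P.Q_induction with
  | h0 => simp
  | ha y z hy hz => rw [map_add, hy, hz, map_add]
  | ht b u =>
    simp only [Module.End.mul_apply, LinearMap.add_apply, envMul_smash, diagMul_toU_smash, map_add,
      envAct_toU_mul]
    simp only [smash, TensorProduct.add_tmul]
    exact add_assoc _ _ _

lemma envMul_mul_mulQ (c : A ⊗[K] Aᵐᵒᵖ) (z : P.Q) :
    P.envMul c * P.mulQ z = P.mulQ (P.envMul c z) := by
  induction z using P.Q_induction with
  | h0 => simp
  | ha y z hy hz => rw [map_add, mul_add, hy, hz, map_add, map_add]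
  | ht b u => rw [envMul_smash, mulQ_smash, mulQ_smash, map_mul, mul_assoc]

lemma diagMul_mul_mulQ (u : P.U) (z : P.Q) :
    P.diagMul u * P.mulQ z = P.mulQ (P.diagMul u z) := by
  induction u using P.U_induction generalizing z with
  | h1 c => simp [Algebra.algebraMap_eq_smul_one]
  | hadd u v hu hv => simp only [map_add, add_mul, LinearMap.add_apply, hu, hv]
  | hmul u v hu hv => simp only [map_mul, mul_assoc, hu, hv, Module.End.mul_apply]
  | hx x =>
    induction z using P.Q_induction with
    | h0 => simp
    | ha y z hy hz => rw [map_add, mul_add, hy, hz, map_add, map_add]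
    | ht b v =>
      rw [diagMul_toU_smash, map_add, mulQ_smash, mulQ_smash, mulQ_smash, ← mul_assoc,
        diagMul_toU_mul_envMul, map_mul, add_mul, mul_assoc]

lemma mulQ_assoc (x y : P.Q) : P.mulQ x * P.mulQ y = P.mulQ (P.mulQ x y) := by
  induction x using P.Q_induction with
  | h0 => simp
  | ha x z hy hz => rw [map_add, add_mul, hy, hz, LinearMap.add_apply, map_add]
  | ht b u => rw [mulQ_smash, mul_assoc, diagMul_mul_mulQ, envMul_mul_mulQ]; rfl

lemma diagMul_one (u v : P.U) : P.diagMul u (P.smash 1 v) = P.smash 1 (u * v) := by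
  induction u using P.U_induction generalizing v with
  | h1 c =>
    rw [Algebra.algebraMap_eq_smul_one, map_smul, map_one, LinearMap.smul_apply,
      Module.End.one_apply, smul_mul_assoc, one_mul, smash_smul]
  | hadd u w hu hw => rw [map_add, LinearMap.add_apply, hu, hw, add_mul, smash_add]
  | hmul u w hu hw => simp only [map_mul, mul_assoc, hu, hw, Module.End.mul_apply]
  | hx x => rw [diagMul_toU_smash, envAct_toU_one, zero_smash, zero_add]

lemma mulQ_one_left : P.mulQ (P.smash 1 1) = 1 := by
  rw [mulQ_smash, map_one, map_one, mul_one]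

lemma mulQ_one_right (x : P.Q) : P.mulQ x (P.smash 1 1) = x := by
  induction x using P.Q_induction with
  | h0 => simp
  | ha x y hx hy => rw [map_add, LinearMap.add_apply, hx, hy]
  | ht b u => rw [mulQ_smash, Module.End.mul_apply, diagMul_one, envMul_smash, mul_one, mul_one]

instance : Ring P.Q :=
  { (inferInstance : AddCommGroup P.Q) with
    mul := fun x y => P.mulQ x y
    one := P.smash 1 1
    mul_assoc := fun x y z => (DFunLike.congr_fun (P.mulQ_assoc x y) z).symm
    one_mul := fun x => DFunLike.congr_fun P.mulQ_one_left x
    mul_one := P.mulQ_one_right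
    left_distrib := fun x y z => map_add (P.mulQ x) y z
    right_distrib := fun x y z => by
      change P.mulQ (x + y) z = P.mulQ x z + P.mulQ y z
      rw [map_add, LinearMap.add_apply]
    zero_mul := fun x => by
      change P.mulQ 0 x = 0
      rw [map_zero, LinearMap.zero_apply]
    mul_zero := fun x => map_zero (P.mulQ x) }

instance : Algebra K P.Q :=
  Algebra.ofModule
    (fun r x y => by
      change P.mulQ (r • x) y = r • P.mulQ x y
      rw [map_smul, LinearMap.smul_apply])
    (fun r x y => map_smul (P.mulQ x) r y)

/-! ### The regular quasi-Poisson module `A` -/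

/-- The action of `Q(A)` on `A`: `(a ⊗ b' # u) m = a u(m) b`. -/
def regLin : P.Q →ₗ[K] Module.End K A :=
  TensorProduct.lift
    ((LinearMap.mul K (Module.End K A)).compl₁₂ (AlgHom.mulLeftRight K A).toLinearMap
      P.adU.toLinearMap)

lemma regLin_smash (b : A ⊗[K] Aᵐᵒᵖ) (u : P.U) :
    P.regLin (P.smash b u) = AlgHom.mulLeftRight K A b * P.adU u := rfl

lemma regLin_smash_tmul (a b : A) (u : P.U) (m : A) :
    P.regLin (P.smash (a ⊗ₜ MulOpposite.op b) u) m = a * P.adU u m * b := by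
  simp [regLin_smash]

lemma br_mul_mulLeftRight (x : A) (c : A ⊗[K] Aᵐᵒᵖ) :
    P.br x * AlgHom.mulLeftRight K A c =
      AlgHom.mulLeftRight K A (P.envAct (P.toU x) c) + AlgHom.mulLeftRight K A c * P.br x := by
  induction c with
  | zero => simp
  | add b b' hb hb' => simp only [map_add, mul_add, add_mul, hb, hb']; abel
  | tmul a b =>
    ext m
    simp only [envAct_toU, map_add, Module.End.mul_apply, LinearMap.add_apply,
      AlgHom.mulLeftRight_apply, P.leibniz, MulOpposite.unop_op]
    noncomm_ring

lemma adU_mul_regLin (u : P.U) (z : P.Q) :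
    P.adU u * P.regLin z = P.regLin (P.diagMul u z) := by
  induction u using P.U_induction generalizing z with
  | h1 c => simp [Algebra.algebraMap_eq_smul_one]
  | hadd u v hu hv => simp only [map_add, add_mul, LinearMap.add_apply, hu, hv]
  | hmul u v hu hv => simp only [map_mul, mul_assoc, hu, hv, Module.End.mul_apply]
  | hx x =>
    induction z using P.Q_induction with
    | h0 => simp
    | ha y z hy hz => rw [map_add, mul_add, hy, hz, map_add, map_add]
    | ht b v =>
      rw [diagMul_toU_smash, map_add, regLin_smash, regLin_smash, regLin_smash, ← mul_assoc,
        adU_toU, br_mul_mulLeftRight, map_mul, adU_toU, add_mul, mul_assoc]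

lemma regLin_mul (x y : P.Q) : P.regLin (x * y) = P.regLin x * P.regLin y := by
  change P.regLin (P.mulQ x y) = _
  induction x using P.Q_induction with
  | h0 => simp
  | ha x z hx hz => rw [map_add, map_add, add_mul, ← hx, ← hz, LinearMap.add_apply, map_add]
  | ht b u =>
    rw [mulQ_smash, regLin_smash, mul_assoc, adU_mul_regLin, Module.End.mul_apply]
    generalize P.diagMul u y = z
    induction z using P.Q_induction with
    | h0 => simp
    | ha x z hx hz => simp only [map_add, mul_add, hx, hz]
    | ht c v => rw [envMul_smash, regLin_smash, regLin_smash, map_mul, mul_assoc]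

/-- `A` as a representation of `Q(A)`. -/
def reg : P.Q →ₐ[K] Module.End K A :=
  AlgHom.ofLinearMap P.regLin
    (by change P.regLin (P.smash 1 1) = 1; rw [regLin_smash, map_one, map_one, mul_one])
    P.regLin_mul

instance : Module P.Q A := Module.compHom A P.reg.toRingHom

/-- The quasi-Poisson cohomology group `HQⁿ(A) = Extⁿ_{Q(A)}(A, A)`. -/
abbrev HQ (n : ℕ) : Type u :=
  CategoryTheory.Abelian.Ext (ModuleCat.of P.Q A) (ModuleCat.of P.Q A) n

end PoissonBracket

/-- The quotient `Z / B` for subspaces `B ⊆ Z` of a vector space (in general `Z / (B ∩ Z)`). -/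
abbrev SubQuot (K V : Type u) [Field K] [AddCommGroup V] [Module K V] (Z B : Submodule K V) :
    Type u := ↥Z ⧸ B.submoduleOf Z

/-- The map `Z / B → Z' / B'` induced by the inclusions `Z ⊆ Z'` and `B ⊆ B'`. -/
def SubQuot.map {K V : Type u} [Field K] [AddCommGroup V] [Module K V] {Z B Z' B' : Submodule K V}
    (hZ : Z ≤ Z') (hB : B ≤ B') : SubQuot K V Z B →ₗ[K] SubQuot K V Z' B' :=
  Submodule.mapQ _ _ (Submodule.inclusion hZ) (fun _ h => hB h)

/-! ### Hochschild cohomology -/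

/-- `Hom(A^{⊗ i}, A)`, as multilinear maps. -/
abbrev HCochain (K A : Type u) [Field K] [Ring A] [Algebra K A] (i : ℕ) : Type u :=
  MultilinearMap K (fun _ : Fin i => A) A

namespace HCochain

variable {K A : Type u} [Field K] [Ring A] [Algebra K A] {i : ℕ}

/-- The map `(a₁, …, aᵢ₊₁) ↦ a₁ f(a₂, …, aᵢ₊₁)`. -/
def mulFirst (f : HCochain K A i) : HCochain K A (i + 1) :=
  MultilinearMap.mk' (fun a => a 0 * f (Fin.tail a))
    (fun m i x y => by cases i using Fin.cases <;> simp [Ne.symm, add_mul, mul_add])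
    (fun m i c x => by cases i using Fin.cases <;> simp [Ne.symm])

/-- The map `(a₁, …, aᵢ₊₁) ↦ f(a₁, …, aᵢ) aᵢ₊₁`. -/
def mulLast (f : HCochain K A i) : HCochain K A (i + 1) :=
  MultilinearMap.mk' (fun a => f (Fin.init a) * a (Fin.last i))
    (fun m i x y => by cases i using Fin.lastCases <;> simp [Ne.symm, add_mul, mul_add])
    (fun m i c x => by cases i using Fin.lastCases <;> simp [Ne.symm])

/-- Updating one entry of a tuple updates one entry of its contraction, linearly. -/
lemma contractNth_update (k : Fin i) (a : Fin (i + 1) → A) (m : Fin (i + 1)) :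
    ∃ (m' : Fin i) (L : A →ₗ[K] A), ∀ x,
      Fin.contractNth k.castSucc (· * ·) (Function.update a m x) =
        Function.update (Fin.contractNth k.castSucc (· * ·) a) m' (L x) := by
  rcases lt_trichotomy m k.castSucc with h | h | h
  · refine ⟨⟨m, by have := Fin.lt_def.1 h; simp at this; omega⟩, LinearMap.id, fun x => ?_⟩
    funext t
    simp only [Fin.contractNth, Function.update_apply, Fin.ext_iff, LinearMap.id_apply] at *
    grind
  · refine ⟨k, (LinearMap.mul K A).flip (a k.succ), fun x => ?_⟩
    funext t
    simp only [Fin.contractNth, Function.update_apply, Fin.ext_iff, LinearMap.flip_apply,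
      LinearMap.mul_apply'] at *
    grind
  · by_cases hk : m = k.succ
    · refine ⟨k, LinearMap.mul K A (a k.castSucc), fun x => ?_⟩
      funext t
      simp only [Fin.contractNth, Function.update_apply, Fin.ext_iff, Fin.lt_def,
        LinearMap.mul_apply'] at *
      grind
    · refine ⟨⟨m - 1, by have := Fin.lt_def.1 h; omega⟩, LinearMap.id, fun x => ?_⟩
      funext t
      simp only [Fin.contractNth, Function.update_apply, Fin.ext_iff, LinearMap.id_apply] at *
      grind

/-- The map `(a₁, …, aᵢ₊₁) ↦ f(a₁, …, aₖaₖ₊₁, …, aᵢ₊₁)` (for `k` counted from `1`; in the code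
`k` is counted from `0`). -/
def contract (k : Fin i) (f : HCochain K A i) : HCochain K A (i + 1) :=
  MultilinearMap.mk' (fun a => f (Fin.contractNth k.castSucc (· * ·) a))
    (fun a m x y => by
      obtain ⟨m', L, h⟩ := contractNth_update (K := K) k a m
      simp only [h, map_add, MultilinearMap.map_update_add])
    (fun a m c x => by
      obtain ⟨m', L, h⟩ := contractNth_update (K := K) k a m
      simp only [h, map_smul, MultilinearMap.map_update_smul])

/-- The Hochschild differential
`(δf)(a₁, …, aᵢ₊₁) = a₁ f(a₂, …, aᵢ₊₁) + ∑ₖ (-1)ᵏ f(…, aₖaₖ₊₁, …) + (-1)ⁱ⁺¹ f(a₁, …, aᵢ) aᵢ₊₁`. -/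
def d (K A : Type u) [Field K] [Ring A] [Algebra K A] (i : ℕ) :
    HCochain K A i →ₗ[K] HCochain K A (i + 1) where
  toFun f := mulFirst f + ∑ k : Fin i, (-1 : K) ^ (k.1 + 1) • contract k f
    + (-1 : K) ^ (i + 1) • mulLast f
  map_add' f g := by
    ext a
    simp [mulFirst, mulLast, contract, mul_add, add_mul, Finset.sum_add_distrib]
    abel
  map_smul' c f := by
    ext a
    simp [mulFirst, mulLast, contract, Finset.smul_sum, smul_comm c]

/-- The Hochschild cocycles of degree `n`. -/
def cocycles (K A : Type u) [Field K] [Ring A] [Algebra K A] (n : ℕ) :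
    Submodule K (HCochain K A n) := LinearMap.ker (d K A n)

/-- The Hochschild coboundaries of degree `n`. -/
def coboundaries (K A : Type u) [Field K] [Ring A] [Algebra K A] :
    (n : ℕ) → Submodule K (HCochain K A n)
  | 0 => ⊥
  | n + 1 => LinearMap.range (d K A n)

end HCochain

/-- The Hochschild cohomology `HHⁿ(A) = HHⁿ(A, A)`. -/
abbrev HH (K A : Type u) [Field K] [Ring A] [Algebra K A] (n : ℕ) : Type u :=
  SubQuot K (HCochain K A n) (HCochain.cocycles K A n) (HCochain.coboundaries K A n)

/-! ### The quasi-Poisson complex -/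

namespace PoissonBracket

variable {K A : Type u} [Field K] [Ring A] [Algebra K A] (P : PoissonBracket K A)

/-- The Lie action of `x ∈ A` on `f ∈ Hom(A^{⊗ i}, A)`:
`(x · f)(a₁, …, aᵢ) = {x, f(a₁, …, aᵢ)} - ∑ₜ f(a₁, …, {x, aₜ}, …, aᵢ)`. -/
def cochainAct {i : ℕ} (x : A) (f : HCochain K A i) : HCochain K A i :=
  (P.br x).compMultilinearMap f -
    ∑ t : Fin i, f.compLinearMap (Function.update (fun _ => LinearMap.id) t (P.br x))

lemma cochainAct_apply {i : ℕ} (x : A) (f : HCochain K A i) (a : Fin i → A) :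
    P.cochainAct x f a = P.br x (f a) - ∑ t, f (Function.update a t (P.br x (a t))) := by
  simp only [cochainAct, sub_apply, LinearMap.compMultilinearMap_apply,
    sum_apply, MultilinearMap.compLinearMap_apply]
  congr 1
  refine Finset.sum_congr rfl fun t _ => congrArg f (funext fun s => ?_)
  by_cases h : s = t
  · subst h; simp
  · simp [h]

/-- The Lie action of `A` on `Hom(A^{⊗ i}, A)`, as a linear map `A → End(Hom(A^{⊗ i}, A))`. -/
def cochainRep (i : ℕ) : A →ₗ[K] Module.End K (HCochain K A i) :=
  LinearMap.mk₂ K P.cochainAct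
    (fun x y f => by
      ext a; simp [cochainAct_apply, Finset.sum_add_distrib]; abel)
    (fun c x f => by
      ext a; simp [cochainAct_apply, Finset.smul_sum, smul_sub])
    (fun x f g => by
      ext a; simp [cochainAct_apply, Finset.sum_add_distrib]; abel)
    (fun c x f => by
      ext a; simp [cochainAct_apply, Finset.smul_sum, smul_sub])

/-- `Hom(A^{⊗ i} ⊗ ⋀ʲ A, A)`: alternating maps in `j` variables with values in
`Hom(A^{⊗ i}, A)`. The value of `f` at `(a₁ ⊗ ⋯ ⊗ aᵢ) ⊗ (x₁ ∧ ⋯ ∧ xⱼ)` is `f x a`. -/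
abbrev _root_.BiCochain (K A : Type u) [Field K] [Ring A] [Algebra K A] (i j : ℕ) : Type u :=
  A [⋀^Fin j]→ₗ[K] HCochain K A i

/-- The vertical differential `σ_V`: the Hochschild differential in the variables `a`. -/
def sigmaV (K A : Type u) [Field K] [Ring A] [Algebra K A] (i j : ℕ) :
    BiCochain K A i j →ₗ[K] BiCochain K A (i + 1) j :=
  (HCochain.d K A i).compAlternatingMapₗ K

/-- First part of `σ_H`: `(x₁, …, xⱼ₊₁) ↦ ∑ₗ (-1)ˡ⁺¹ xₗ · f(x₁, …, x̂ₗ, …, xⱼ₊₁)`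
(for `l` counted from `1`). -/
def sigmaHAct (i j : ℕ) : BiCochain K A i j →ₗ[K] BiCochain K A i (j + 1) where
  toFun f := AlternatingMap.alternatizeUncurryFin
    { toFun := fun x => (P.cochainRep i x).compAlternatingMap f
      map_add' := fun x y => by rw [map_add]; rfl
      map_smul' := fun c x => by rw [map_smul]; rfl }
  map_add' f g := by
    ext v a
    simp [AlternatingMap.alternatizeUncurryFin_apply, Finset.sum_add_distrib]
  map_smul' c f := by
    ext v a
    simp [AlternatingMap.alternatizeUncurryFin_apply, Finset.smul_sum, smul_comm c]

lemma sigmaHAct_apply (i j : ℕ) (f : BiCochain K A i j) (x : Fin (j + 1) → A) :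
    P.sigmaHAct i j f x =
      ∑ l : Fin (j + 1), (-1 : ℤ) ^ (l : ℕ) • P.cochainAct (x l) (f (l.removeNth x)) := by
  simp [sigmaHAct, AlternatingMap.alternatizeUncurryFin_apply, cochainRep]

/-- The bilinear map `(x, y) ↦ f({x, y}, -, …, -)`. -/
def brInsert {i j : ℕ} (f : BiCochain K A i (j + 1)) : A →ₗ[K] A →ₗ[K] BiCochain K A i j :=
  P.br.compr₂ f.curryLeft

/-- The sum `∑_{p < q} (-1)^{p+q} f({x_p, x_q}, x₁, …, x̂_p, …, x̂_q, …, xⱼ₊₂)`.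
The pairs `p < q` in `Fin (j + 2)` are written as `p = r.castSucc`, `q = s.succ` with `r ≤ s` in
`Fin (j + 1)`; the exponent `p + q`, for `p` and `q` counted from `1` as well as from `0`, then
has the parity of `r + s + 1`. -/
def brSum {i j : ℕ} (f : BiCochain K A i (j + 1)) (x : Fin (j + 2) → A) : HCochain K A i :=
  ∑ r : Fin (j + 1), ∑ s ≥ r, (-1 : ℤ) ^ (r + s + 1 : ℕ) •
    f (Matrix.vecCons (P.br (x r.castSucc) (x s.succ)) (s.removeNth (r.castSucc.removeNth x)))

lemma br_skew (x y : A) : P.br y x = - P.br x y := by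
  have h := P.br_self (x + y)
  simp only [map_add, LinearMap.add_apply, P.br_self, zero_add, add_zero] at h
  exact eq_neg_of_add_eq_zero_left h

lemma neg_two_smul_brSum {i j : ℕ} (f : BiCochain K A i (j + 1)) (x : Fin (j + 2) → A) :
    (-2 : K) • P.brSum f x = AlternatingMap.alternatizeUncurryFin
      (AlternatingMap.alternatizeUncurryFinLM ∘ₗ P.brInsert f) x := by
  rw [AlternatingMap.alternatizeUncurryFin_alternatizeUncurryFinLM_comp_apply, brSum,
    Finset.smul_sum]
  refine Finset.sum_congr rfl fun r _ => ?_
  rw [Finset.smul_sum]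
  refine Finset.sum_congr rfl fun s _ => ?_
  simp only [brInsert, LinearMap.compr₂_apply, P.br_skew (x r.castSucc) (x s.succ), map_neg,
    AlternatingMap.neg_apply, AlternatingMap.curryLeft_apply_apply, pow_succ, sub_neg_eq_add]
  rw [← two_smul K, smul_comm ((-1 : ℤ) ^ _) (2 : K)]
  simp

lemma brSum_eq [CharZero K] {i j : ℕ} (f : BiCochain K A i (j + 1)) :
    P.brSum f = ((-2 : K)⁻¹ • AlternatingMap.alternatizeUncurryFin
      (AlternatingMap.alternatizeUncurryFinLM ∘ₗ P.brInsert f) : BiCochain K A i (j + 2)) := by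
  funext x
  rw [AlternatingMap.smul_apply, ← neg_two_smul_brSum, inv_smul_smul₀ (by norm_num)]

/-- Second part of `σ_H`:
`(x₁, …, xⱼ₊₂) ↦ ∑_{p < q} (-1)^{p+q} f({x_p, x_q}, x₁, …, x̂_p, …, x̂_q, …, xⱼ₊₂)`. -/
def sigmaHBr [CharZero K] (i j : ℕ) : BiCochain K A i (j + 1) →ₗ[K] BiCochain K A i (j + 2) where
  toFun f :=
    { MultilinearMap.mk' (P.brSum f)
        (fun x p y z => by rw [brSum_eq]; exact AlternatingMap.map_update_add _ _ _ _ _)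
        (fun x p c y => by rw [brSum_eq]; exact AlternatingMap.map_update_smul _ _ _ _ _) with
      map_eq_zero_of_eq' := fun x p q h hpq => by
        change P.brSum f x = 0
        rw [brSum_eq]
        exact AlternatingMap.map_eq_zero_of_eq _ _ h hpq }
  map_add' f g := by
    ext x a
    simp [brSum, Finset.sum_add_distrib]
  map_smul' c f := by
    ext x a
    simp [brSum, Finset.smul_sum, smul_comm c]

/-- The horizontal differential `σ_H`:
`(σ_H f)(x₁, …, xⱼ₊₁) = ∑ₗ (-1)ˡ⁺¹ xₗ · f(x₁, …, x̂ₗ, …, xⱼ₊₁)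
  + ∑_{p < q} (-1)^{p+q} f({x_p, x_q}, x₁, …, x̂_p, …, x̂_q, …, xⱼ₊₁)`,
the Chevalley–Eilenberg differential of the Lie algebra `A` with coefficients in
`Hom(A^{⊗ i}, A)`. -/
def sigmaH [CharZero K] (i : ℕ) : (j : ℕ) → BiCochain K A i j →ₗ[K] BiCochain K A i (j + 1)
  | 0 => P.sigmaHAct i 0
  | j + 1 => P.sigmaHAct i (j + 1) + P.sigmaHBr i j

/-- Families of cochains `f i j ∈ Hom(A^{⊗ i} ⊗ ⋀ʲ A, A)`, one for each `i, j ≥ 0`. -/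
abbrev _root_.BiFamily (K A : Type u) [Field K] [Ring A] [Algebra K A] : Type u :=
  (i j : ℕ) → BiCochain K A i j

/-- The `n`-cochains of the quasi-Poisson complex, `Hom(⨁_{i+j=n} A^{⊗ i} ⊗ ⋀ʲ A, A)`: the families
supported on the components with `i + j = n`. -/
def _root_.QCochain (K A : Type u) [Field K] [Ring A] [Algebra K A] (n : ℕ) :
    Submodule K (BiFamily K A) where
  carrier := {f | ∀ i j, i + j ≠ n → f i j = 0}
  zero_mem' _ _ _ := rfl
  add_mem' hf hg i j h := by simp [hf i j h, hg i j h]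
  smul_mem' c f hf i j h := by simp [hf i j h]

/-- The subspace `Ω_n^k` of those `n`-cochains that are supported on the components
`A^{⊗ i} ⊗ ⋀ʲ A` with `i + j = n` and `i ≤ k`. -/
def _root_.Omega (K A : Type u) [Field K] [Ring A] [Algebra K A] (n k : ℕ) :
    Submodule K (BiFamily K A) where
  carrier := {f | ∀ i j, ¬ (i + j = n ∧ i ≤ k) → f i j = 0}
  zero_mem' _ _ _ := rfl
  add_mem' hf hg i j h := by simp [hf i j h, hg i j h]
  smul_mem' c f hf i j h := by simp [hf i j h]

/-- The component of `σ f` in `Hom(A^{⊗ i} ⊗ ⋀ʲ A, A)`, where `σ = σ_V + (-1)ⁱ σ_H` on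
`Hom(A^{⊗ i} ⊗ ⋀ʲ A, A)`. -/
def sigmaComp [CharZero K] (f : BiFamily K A) : BiFamily K A
  | 0, 0 => 0
  | 0, j + 1 => P.sigmaH 0 j (f 0 j)
  | i + 1, 0 => sigmaV K A i 0 (f i 0)
  | i + 1, j + 1 =>
      sigmaV K A i (j + 1) (f i (j + 1)) + (-1 : K) ^ (i + 1) • P.sigmaH (i + 1) j (f (i + 1) j)

/-- The differential `σ` of the quasi-Poisson complex; its restriction to the `n`-cochains is
`σⁿ`. -/
def sigma [CharZero K] : BiFamily K A →ₗ[K] BiFamily K A where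
  toFun := P.sigmaComp
  map_add' f g := by
    funext i j
    cases i <;> cases j <;> simp [sigmaComp]
    abel
  map_smul' c f := by
    funext i j
    cases i <;> cases j <;> simp [sigmaComp, smul_comm c]

/-- `Ker σⁿ`. -/
def kerSigma [CharZero K] (n : ℕ) : Submodule K (BiFamily K A) :=
  QCochain K A n ⊓ LinearMap.ker P.sigma

/-- `Im σⁿ⁻¹`, which is `0` for `n = 0`. -/
def imSigma [CharZero K] : (n : ℕ) → Submodule K (BiFamily K A)
  | 0 => ⊥
  | n + 1 => (QCochain K A n).map P.sigma

/-- The cohomology `Hⁿ(QC(A, A)) = Ker σⁿ / Im σⁿ⁻¹` of the quasi-Poisson complex. -/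
abbrev QCCohomology [CharZero K] (n : ℕ) : Type u :=
  SubQuot K (BiFamily K A) (P.kerSigma n) (P.imSigma n)

/-- The quotient `(Ker σⁿ ∩ Ω_n^k) / (Im σⁿ⁻¹ ∩ Ω_n^k)`. -/
abbrev TruncQuot [CharZero K] (n k : ℕ) : Type u :=
  SubQuot K (BiFamily K A) (P.kerSigma n ⊓ Omega K A n k) (P.imSigma n ⊓ Omega K A n k)

/-- The map `(Ker σⁿ ∩ Ω_n^k) / (Im σⁿ⁻¹ ∩ Ω_n^k) → Ker σⁿ / Im σⁿ⁻¹` induced by the inclusion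
`Ker σⁿ ∩ Ω_n^k ⊆ Ker σⁿ`. -/
def truncMap [CharZero K] (n k : ℕ) : P.TruncQuot n k →ₗ[K] P.QCCohomology n :=
  SubQuot.map inf_le_left inf_le_left

end PoissonBracket

end

/-! The complex is the total complex of a double complex: Hochschild in the index i,
Chevalley–Eilenberg in the index j. The theorem joins two facts.

Truncation (`truncMap_bijective`). Over a field, primitives can be chosen linearly, so exactness of
the Hochschild complex above degree k passes to alternating maps with values in it
(`LinearMap.exists_compAlternatingMap_eq`). The component of a cocycle with the highest i is closed
for the Hochschild differential. While i > k it has a primitive, and subtracting the total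
differential of this primitive lowers the highest i (`exists_truncation`). This gives surjectivity.
Injectivity is formal, because the denominator is the intersection of the coboundaries with the
truncated cochains.

Comparison with Ext (`nonempty_HQ_equiv`). No projective resolution of A is built. The coefficients
vary instead: every Q(A)-module X has its own total complex, and its cohomology is identified with
Ext(A, X) by dimension shifting along X → J → J/X with J injective (`nonempty_ext_equiv`). In degree
zero both sides are the elements m of X with am = ma and x·m = 0 (`extZeroEquiv`). The induction
needs the total complex of an injective module to be exact in positive degrees
(`Z_le_B_of_injective`).

For that, X embeds into Hom(A, Hom(S(A), X)), and by injectivity it is a retract. With these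
coinduced coefficients the Hochschild direction is contracted by evaluation at 1, and what is left
is the Chevalley–Eilenberg complex of Hom(S(A), X). Here S(A) is given the module structure of the
Poincaré–Birkhoff–Witt theorem (`PBW.act_br`), so it plays the part of U(A). Filtered by polynomial
degree, the leading part of this complex is dual to the Koszul complex, with a homotopy of weight p
+ j + 1, invertible in characteristic zero. Successive corrections then produce a primitive, since
each monomial sees only finitely many of them (`PBW.exists_ceD_eq`). -/

noncomputable section

/-! ### Cartan calculus for the Chevalley–Eilenberg complex -/

namespace AlternatingMap

variable {K A N N' : Type*} [CommRing K] [AddCommGroup A] [Module K A] [AddCommGroup N] [Module K N]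
  [AddCommGroup N'] [Module K N']

/-- Contraction of an alternating map with a vector, as a linear map. -/
def contr (x : A) {n : ℕ} : A [⋀^Fin (n + 1)]→ₗ[K] N →ₗ[K] A [⋀^Fin n]→ₗ[K] N :=
  LinearMap.applyₗ x ∘ₗ curryLeftLinearMap

@[simp] lemma contr_apply (x : A) {n : ℕ} (ω : A [⋀^Fin (n + 1)]→ₗ[K] N) (v : Fin n → A) :
    contr x ω v = ω (Matrix.vecCons x v) := rfl

lemma contr_eq_curryLeft (x : A) {n : ℕ} (ω : A [⋀^Fin (n + 1)]→ₗ[K] N) :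
    contr x ω = ω.curryLeft x := rfl

/-- Contractions lie one degree lower, so this turns the identities of the Cartan calculus into
inductions on the degree and avoids sums over pairs of indices. -/
lemma ext_contr {n : ℕ} {ω η : A [⋀^Fin (n + 1)]→ₗ[K] N} (h : ∀ x, contr x ω = contr x η) :
    ω = η := by
  ext v
  have := DFunLike.congr_fun (h (v 0)) (Fin.tail v)
  simpa [contr_apply, Matrix.vecCons] using this

lemma contr_contr_self (x : A) {n : ℕ} (ω : A [⋀^Fin (n + 2)]→ₗ[K] N) :
    contr x (contr x ω) = 0 := curryLeft_same ω x

lemma contr_contr_comm (x y : A) {n : ℕ} (ω : A [⋀^Fin (n + 2)]→ₗ[K] N) :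
    contr x (contr y ω) = - contr y (contr x ω) := by
  have h := contr_contr_self (x + y) ω
  have hx : ∀ {m : ℕ} (η : A [⋀^Fin (m + 1)]→ₗ[K] N), contr (x + y) η = contr x η + contr y η :=
    fun η => map_add η.curryLeft x y
  rw [hx, hx, map_add, map_add, contr_contr_self, contr_contr_self, zero_add, add_zero] at h
  exact eq_neg_of_add_eq_zero_left h

/-- The first term of the alternating sum feeds x to f; all the others keep x as an argument of the
values of f and pick up a sign. -/
lemma contr_alternatizeUncurryFin (x : A) {n : ℕ} (f : A →ₗ[K] A [⋀^Fin (n + 1)]→ₗ[K] N) :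
    contr x (alternatizeUncurryFin f) = f x - alternatizeUncurryFin (contr x ∘ₗ f) := by
  ext v
  simp only [contr_apply, sub_apply, alternatizeUncurryFin_apply, Fin.sum_univ_succ (n := n + 1)]
  rw [sub_eq_add_neg, ← Finset.sum_neg_distrib]
  congr 1
  · simp
  · refine Finset.sum_congr rfl fun i _ => ?_
    have : i.succ.removeNth (Matrix.vecCons x v : Fin (n + 2) → A) =
        Matrix.vecCons x (i.removeNth v) := by
      funext t
      cases t using Fin.cases <;> simp [Fin.removeNth]
    simp [this, pow_succ]

lemma contr_alternatizeUncurryFin_zero (x : A) (f : A →ₗ[K] A [⋀^Fin 0]→ₗ[K] N) :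
    contr x (alternatizeUncurryFin f) = f x := by
  ext v
  simp only [contr_apply, alternatizeUncurryFin_apply]
  simp

lemma compAlternatingMap_alternatizeUncurryFin (φ : N →ₗ[K] N') {n : ℕ}
    (f : A →ₗ[K] A [⋀^Fin n]→ₗ[K] N) :
    φ.compAlternatingMap (alternatizeUncurryFin f) =
      alternatizeUncurryFin (φ.compAlternatingMapₗ K ∘ₗ f) := by
  ext v
  simp [alternatizeUncurryFin_apply]

lemma compAlternatingMap_contr (φ : N →ₗ[K] N') (x : A) {n : ℕ} (ω : A [⋀^Fin (n + 1)]→ₗ[K] N) :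
    φ.compAlternatingMap (contr x ω) = contr x (φ.compAlternatingMap ω) := rfl

end AlternatingMap

namespace PoissonBracket

open AlternatingMap

variable {K A : Type u} [Field K] [Ring A] [Algebra K A] (P : PoissonBracket K A)
  {N N' : Type*} [AddCommGroup N] [Module K N] [AddCommGroup N'] [Module K N']
  (ρ : A →ₗ[K] Module.End K N) (ρ' : A →ₗ[K] Module.End K N')

/-- The linear map `x ↦ x · ω`, for `x` acting on the values of the alternating map `ω` only. -/
def ceAct {j : ℕ} (ω : A [⋀^Fin j]→ₗ[K] N) : A →ₗ[K] A [⋀^Fin j]→ₗ[K] N where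
  toFun x := (ρ x).compAlternatingMap ω
  map_add' x y := by rw [map_add]; rfl
  map_smul' c x := by rw [map_smul]; rfl

lemma ceAct_apply {j : ℕ} (ω : A [⋀^Fin j]→ₗ[K] N) (x : A) :
    ceAct ρ ω x = (ρ x).compAlternatingMap ω := rfl

lemma ceAct_add {j : ℕ} (ω η : A [⋀^Fin j]→ₗ[K] N) :
    ceAct ρ (ω + η) = ceAct ρ ω + ceAct ρ η :=
  LinearMap.ext fun x => LinearMap.compAlternatingMap_add (ρ x) ω η

lemma ceAct_smul {j : ℕ} (c : K) (ω : A [⋀^Fin j]→ₗ[K] N) :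
    ceAct ρ (c • ω) = c • ceAct ρ ω :=
  LinearMap.ext fun x => LinearMap.compAlternatingMap_smul (ρ x) c ω

/-- The bilinear map `(x, y) ↦ ω({x, y}, -, …, -)`. -/
def contrBr {j : ℕ} (ω : A [⋀^Fin (j + 1)]→ₗ[K] N) : A →ₗ[K] A →ₗ[K] A [⋀^Fin j]→ₗ[K] N :=
  P.br.compr₂ ω.curryLeft

lemma contrBr_apply {j : ℕ} (ω : A [⋀^Fin (j + 1)]→ₗ[K] N) (x y : A) :
    P.contrBr ω x y = contr (P.br x y) ω := rfl

/-- The derivation part of the Lie derivative: the coadjoint action of `x` on the arguments. -/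
def lieArg : (j : ℕ) → A → A [⋀^Fin j]→ₗ[K] N →ₗ[K] A [⋀^Fin j]→ₗ[K] N
  | 0, _ => 0
  | j + 1, x =>
    { toFun := fun ω => alternatizeUncurryFin (P.contrBr ω x)
      map_add' := fun ω η => by rw [← alternatizeUncurryFin_add]; rfl
      map_smul' := fun c ω => by
        rw [RingHom.id_apply, ← alternatizeUncurryFin_smul]; rfl }

lemma lieArg_succ (j : ℕ) (x : A) (ω : A [⋀^Fin (j + 1)]→ₗ[K] N) :
    P.lieArg (j + 1) x ω = alternatizeUncurryFin (P.contrBr ω x) := rfl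

/-- The term that brackets x with the slot filled by y is the contraction with {x, y}; the remaining
terms only see the other slots. Since `lieArg` is zero in degree 0, the case j = 0 needs no separate
form. -/
lemma contr_lieArg (j : ℕ) (x y : A) (ω : A [⋀^Fin (j + 1)]→ₗ[K] N) :
    contr y (P.lieArg (j + 1) x ω) = contr (P.br x y) ω + P.lieArg j x (contr y ω) := by
  rw [lieArg_succ]
  cases j with
  | zero => rw [contr_alternatizeUncurryFin_zero]; simp [lieArg, contrBr_apply]
  | succ j =>
    rw [contr_alternatizeUncurryFin, sub_eq_add_neg, contrBr_apply, lieArg_succ]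
    congr 1
    rw [← neg_one_smul K, ← alternatizeUncurryFin_smul]
    congr 1
    refine LinearMap.ext fun z => ?_
    simp [contrBr_apply, contr_contr_comm y (P.br x z)]

/-- The Lie derivative on alternating maps with values in a representation. -/
def lieDer (j : ℕ) (x : A) : A [⋀^Fin j]→ₗ[K] N →ₗ[K] A [⋀^Fin j]→ₗ[K] N :=
  (ρ x).compAlternatingMapₗ K - P.lieArg j x

lemma lieDer_apply (j : ℕ) (x : A) (ω : A [⋀^Fin j]→ₗ[K] N) :
    P.lieDer ρ j x ω = (ρ x).compAlternatingMap ω - P.lieArg j x ω := rfl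

lemma contr_lieDer (j : ℕ) (x y : A) (ω : A [⋀^Fin (j + 1)]→ₗ[K] N) :
    contr y (P.lieDer ρ (j + 1) x ω) = P.lieDer ρ j x (contr y ω) - contr (P.br x y) ω := by
  rw [lieDer_apply, lieDer_apply, map_sub, contr_lieArg, compAlternatingMap_contr]
  abel

/-- Contraction with z lowers the degree; the leftover bracket terms cancel by the Jacobi identity
for x, y, z. -/
lemma lieDer_lieDer (hρ : ∀ x y, ρ (P.br x y) = ρ x * ρ y - ρ y * ρ x) (j : ℕ) (x y : A)
    (ω : A [⋀^Fin j]→ₗ[K] N) :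
    P.lieDer ρ j x (P.lieDer ρ j y ω) - P.lieDer ρ j y (P.lieDer ρ j x ω) =
      P.lieDer ρ j (P.br x y) ω := by
  induction j with
  | zero =>
    ext v
    simp [lieDer_apply, lieArg, hρ]
  | succ j ih =>
    refine ext_contr fun z => ?_
    have hz : ∀ a b : A, contr (a + b) ω = contr a ω + contr b ω :=
      fun a b => map_add ω.curryLeft a b
    rw [map_sub, contr_lieDer, contr_lieDer, contr_lieDer, contr_lieDer, contr_lieDer,
      contr_lieDer, contr_lieDer, ← ih, P.jacobi x y z, map_sub, map_sub, hz]
    abel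

/-- The Chevalley–Eilenberg differential with coefficients in a representation. -/
def ceD : (j : ℕ) → A [⋀^Fin j]→ₗ[K] N →ₗ[K] A [⋀^Fin (j + 1)]→ₗ[K] N
  | 0 =>
    { toFun := fun ω => alternatizeUncurryFin (ceAct ρ ω)
      map_add' := fun ω η => by rw [ceAct_add, alternatizeUncurryFin_add]
      map_smul' := fun c ω => by
        rw [RingHom.id_apply, ceAct_smul, alternatizeUncurryFin_smul] }
  | j + 1 =>
    { toFun := fun ω => alternatizeUncurryFin (ceAct ρ ω) +
        -- The double alternation meets each pair of arguments in both orders, with the sign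
        -- opposite to the classical one; hence the factor -1/2.
        (-2 : K)⁻¹ • alternatizeUncurryFin (alternatizeUncurryFinLM ∘ₗ P.contrBr ω)
      map_add' := fun ω η => by
        have h : alternatizeUncurryFinLM ∘ₗ P.contrBr (ω + η) =
            alternatizeUncurryFinLM ∘ₗ P.contrBr ω + alternatizeUncurryFinLM ∘ₗ P.contrBr η :=
          LinearMap.ext fun x => alternatizeUncurryFin_add (P.contrBr ω x) (P.contrBr η x)
        rw [ceAct_add, alternatizeUncurryFin_add, h, alternatizeUncurryFin_add, smul_add,
          add_add_add_comm]
      map_smul' := fun c ω => by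
        have h : alternatizeUncurryFinLM ∘ₗ P.contrBr (c • ω) =
            c • (alternatizeUncurryFinLM ∘ₗ P.contrBr ω) :=
          LinearMap.ext fun x => alternatizeUncurryFin_smul c (P.contrBr ω x)
        rw [RingHom.id_apply, ceAct_smul, alternatizeUncurryFin_smul, h,
          alternatizeUncurryFin_smul, smul_add, smul_comm c] }

lemma ceD_zero (ω : A [⋀^Fin 0]→ₗ[K] N) :
    P.ceD ρ 0 ω = alternatizeUncurryFin (ceAct ρ ω) := rfl

lemma ceD_succ (j : ℕ) (ω : A [⋀^Fin (j + 1)]→ₗ[K] N) :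
    P.ceD ρ (j + 1) ω = alternatizeUncurryFin (ceAct ρ ω) +
      (-2 : K)⁻¹ • alternatizeUncurryFin (alternatizeUncurryFinLM ∘ₗ P.contrBr ω) := rfl

lemma contr_ceAct_comp (j : ℕ) (x : A) (ω : A [⋀^Fin (j + 1)]→ₗ[K] N) :
    contr x ∘ₗ ceAct ρ ω = ceAct ρ (contr x ω) := rfl

lemma contr_ceD_zero (x : A) (ω : A [⋀^Fin 0]→ₗ[K] N) :
    contr x (P.ceD ρ 0 ω) = (ρ x).compAlternatingMap ω := by
  rw [ceD_zero, contr_alternatizeUncurryFin_zero, ceAct_apply]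

/-- Cartan's formula. -/
lemma contr_ceD_succ [CharZero K] (j : ℕ) (x : A) (ω : A [⋀^Fin (j + 1)]→ₗ[K] N) :
    contr x (P.ceD ρ (j + 1) ω) = P.lieDer ρ (j + 1) x ω - P.ceD ρ j (contr x ω) := by
  have key : contr x (alternatizeUncurryFin (alternatizeUncurryFinLM ∘ₗ P.contrBr ω)) =
      (2 : K) • P.lieArg (j + 1) x ω - alternatizeUncurryFin
        (contr x ∘ₗ alternatizeUncurryFinLM ∘ₗ P.contrBr ω + P.contrBr ω x) := by
    rw [contr_alternatizeUncurryFin, alternatizeUncurryFin_add, ← lieArg_succ, two_smul]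
    simp only [LinearMap.comp_apply, alternatizeUncurryFinLM_apply, ← lieArg_succ]
    abel
  -- Moving the contraction with x past the Lie derivative along y produces ω({y, x}, …), which
  -- cancels the extra term `contrBr ω x y`.
  have hc : ∀ y, contr x (alternatizeUncurryFin (P.contrBr ω y)) + P.contrBr ω x y =
      P.lieArg j y (contr x ω) := fun y => by
    rw [← lieArg_succ, contr_lieArg, contrBr_apply, P.br_skew x y, contr_eq_curryLeft,
      contr_eq_curryLeft, map_neg, contr_eq_curryLeft]
    abel
  rw [ceD_succ, map_add, map_smul, key, contr_alternatizeUncurryFin, contr_ceAct_comp, smul_sub,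
    smul_smul, ceAct_apply, lieDer_apply]
  have h2 : (-2 : K)⁻¹ * 2 = -1 := by rw [inv_neg, neg_mul, inv_mul_cancel₀ two_ne_zero]
  rw [h2, neg_one_smul]
  cases j with
  | zero =>
    have : contr x ∘ₗ alternatizeUncurryFinLM ∘ₗ P.contrBr ω + P.contrBr ω x = 0 :=
      LinearMap.ext fun y => hc y
    rw [this, ceD_zero]
    have h0 : alternatizeUncurryFin (0 : A →ₗ[K] A [⋀^Fin 0]→ₗ[K] N) = 0 :=
      map_zero alternatizeUncurryFinLM
    rw [h0, smul_zero]
    abel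
  | succ j =>
    have : contr x ∘ₗ alternatizeUncurryFinLM ∘ₗ P.contrBr ω + P.contrBr ω x =
        alternatizeUncurryFinLM ∘ₗ P.contrBr (contr x ω) :=
      LinearMap.ext fun y => hc y
    rw [this, ceD_succ]
    abel

/-- With i for contraction and L for the Lie derivative, i_y is applied to both sides and expanded
by i_y d = L_y - d i_y and i_y L_x = L_x i_y - i_{x,y}. The commutator formula for L and the case of
lower degree remain. -/
lemma lieDer_ceD [CharZero K] (hρ : ∀ x y, ρ (P.br x y) = ρ x * ρ y - ρ y * ρ x) (j : ℕ) (x : A)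
    (ω : A [⋀^Fin j]→ₗ[K] N) :
    P.lieDer ρ (j + 1) x (P.ceD ρ j ω) = P.ceD ρ j (P.lieDer ρ j x ω) := by
  induction j with
  | zero =>
    refine ext_contr fun y => ?_
    rw [contr_lieDer, contr_ceD_zero, contr_ceD_zero, contr_ceD_zero]
    ext v
    simp [lieDer_apply, lieArg, hρ]
  | succ j ih =>
    refine ext_contr fun y => ?_
    rw [contr_lieDer, contr_ceD_succ, contr_ceD_succ, contr_ceD_succ, contr_lieDer, map_sub,
      map_sub, ih, ← lieDer_lieDer P ρ hρ (j + 1) x y]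
    abel

/-- Cartan's formula gives i_y d d = L_y d - d i_y d = d L_y - d L_y + d d i_y, so the vanishing of
d d passes from one degree to the next. -/
lemma ceD_ceD [CharZero K] (hρ : ∀ x y, ρ (P.br x y) = ρ x * ρ y - ρ y * ρ x) (j : ℕ)
    (ω : A [⋀^Fin j]→ₗ[K] N) : P.ceD ρ (j + 1) (P.ceD ρ j ω) = 0 := by
  induction j with
  | zero =>
    refine ext_contr fun y => ?_
    rw [contr_ceD_succ, lieDer_ceD P ρ hρ, contr_ceD_zero, lieDer_apply]
    simp [lieArg]
  | succ j ih =>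
    refine ext_contr fun y => ?_
    rw [contr_ceD_succ, lieDer_ceD P ρ hρ, contr_ceD_succ, map_sub, ih]
    simp

/-- Used both for changes of coefficients and, with φ the Hochschild differential, to make the two
differentials of the double complex commute. -/
lemma compAlternatingMap_ceD (φ : N →ₗ[K] N') (hφ : ∀ x n, φ (ρ x n) = ρ' x (φ n)) (j : ℕ)
    (ω : A [⋀^Fin j]→ₗ[K] N) :
    φ.compAlternatingMap (P.ceD ρ j ω) = P.ceD ρ' j (φ.compAlternatingMap ω) := by
  have h : φ.compAlternatingMap (alternatizeUncurryFin (ceAct ρ ω)) =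
      alternatizeUncurryFin (ceAct ρ' (φ.compAlternatingMap ω)) := by
    rw [compAlternatingMap_alternatizeUncurryFin]
    congr 1
    refine LinearMap.ext fun x => AlternatingMap.ext fun v => ?_
    simp [ceAct, hφ]
  cases j with
  | zero => exact h
  | succ j =>
    have h' : φ.compAlternatingMapₗ K ∘ₗ (alternatizeUncurryFinLM ∘ₗ P.contrBr ω) =
        alternatizeUncurryFinLM ∘ₗ P.contrBr (φ.compAlternatingMap ω) :=
      LinearMap.ext fun x => compAlternatingMap_alternatizeUncurryFin φ (P.contrBr ω x)
    rw [ceD_succ, ceD_succ, ← h, LinearMap.compAlternatingMap_add,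
      LinearMap.compAlternatingMap_smul,
      compAlternatingMap_alternatizeUncurryFin (f := alternatizeUncurryFinLM ∘ₗ P.contrBr ω), h']

end PoissonBracket

/-! ### Representations and Hochschild cochains with coefficients -/

namespace PoissonBracket

variable {K A : Type u} [Field K] [Ring A] [Algebra K A]

/-- A vector space `M` with commuting (not necessarily unital) left and right actions of the
associative algebra `A` and a compatible action of the Lie algebra `A`. -/
structure Rep (P : PoissonBracket K A) (M : Type u) [AddCommGroup M] [Module K M] where
  /-- the left action -/
  l : A →ₗ[K] Module.End K M
  /-- the right action -/
  r : A →ₗ[K] Module.End K M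
  /-- the action of the Lie algebra -/
  ρ : A →ₗ[K] Module.End K M
  l_mul : ∀ a b m, l (a * b) m = l a (l b m)
  r_mul : ∀ a b m, r (a * b) m = r b (r a m)
  l_r : ∀ a b m, l a (r b m) = r b (l a m)
  ρ_br : ∀ x y m, ρ (P.br x y) m = ρ x (ρ y m) - ρ y (ρ x m)
  ρ_l : ∀ x a m, ρ x (l a m) = l (P.br x a) m + l a (ρ x m)
  ρ_r : ∀ x a m, ρ x (r a m) = r (P.br x a) m + r a (ρ x m)

namespace Rep

variable {P : PoissonBracket K A} {M M' : Type u} [AddCommGroup M] [Module K M]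
  [AddCommGroup M'] [Module K M'] (R : Rep P M) (R' : Rep P M')

lemma ρ_lie (x y : A) : R.ρ (P.br x y) = R.ρ x * R.ρ y - R.ρ y * R.ρ x :=
  LinearMap.ext fun m => R.ρ_br x y m

/-- Linear maps commuting with all actions. -/
structure IsHom (φ : M →ₗ[K] M') : Prop where
  l : ∀ a m, φ (R.l a m) = R'.l a (φ m)
  r : ∀ a m, φ (R.r a m) = R'.r a (φ m)
  ρ : ∀ a m, φ (R.ρ a m) = R'.ρ a (φ m)

/-- The representation `Hom(A, M)` for which `Hom(A^{⊗ (i + 1)}, M) = Hom(A^{⊗ i}, Hom(A, M))`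
identifies the Hochschild complexes. -/
def twist : Rep P (A →ₗ[K] M) where
  l := LinearMap.mk₂ K (fun a F => R.l a ∘ₗ F) (fun a b F => by ext; simp)
    (fun c a F => by ext; simp) (fun a F G => by ext; simp) (fun c a F => by ext; simp)
  -- The right action is (F·a)(b) = F(ab) - F(a)b. The unit does not act as the identity here, which
  -- is why a `Rep` is not required to be unital.
  r := LinearMap.mk₂ K (fun a F => F ∘ₗ LinearMap.mul K A a - R.r.flip (F a))
    (fun a b F => by ext; simp; abel)
    (fun c a F => by ext; simp [smul_sub]) (fun a F G => by ext; simp; abel)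
    (fun c a F => by ext; simp [smul_sub])
  ρ := LinearMap.mk₂ K (fun x F => R.ρ x ∘ₗ F - F ∘ₗ P.br x) (fun a b F => by ext; simp; abel)
    (fun c a F => by ext; simp [smul_sub]) (fun a F G => by ext; simp; abel)
    (fun c a F => by ext; simp [smul_sub])
  l_mul a b F := by ext; simp [R.l_mul]
  r_mul a b F := by ext; simp [R.r_mul, mul_assoc]
  l_r a b F := by ext; simp [R.l_r]
  ρ_br x y F := by ext z; simp [R.ρ_br, P.jacobi x y z]; abel
  ρ_l x y F := by ext z; simp [R.ρ_l]; abel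
  ρ_r x y F := by ext z; simp [R.ρ_r, P.leibniz]; abel

end Rep

/-- `Hom(A^{⊗ i}, M)`, as multilinear maps. -/
abbrev _root_.HCoch (K A M : Type u) [Field K] [Ring A] [Algebra K A] [AddCommGroup M] [Module K M]
    (i : ℕ) : Type u :=
  MultilinearMap K (fun _ : Fin i => A) M

namespace Rep

variable {P : PoissonBracket K A} {M M' : Type u} [AddCommGroup M] [Module K M]
  [AddCommGroup M'] [Module K M'] (R : Rep P M) (R' : Rep P M') {i : ℕ}

/-- The map `(a₁, …, aᵢ₊₁) ↦ a₁ f(a₂, …, aᵢ₊₁)`. -/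
def mulFirst (f : HCoch K A M i) : HCoch K A M (i + 1) :=
  MultilinearMap.mk' (fun a => R.l (a 0) (f (Fin.tail a)))
    (fun m i x y => by cases i using Fin.cases <;> simp [Ne.symm])
    (fun m i c x => by cases i using Fin.cases <;> simp [Ne.symm])

/-- The map `(a₁, …, aᵢ₊₁) ↦ f(a₁, …, aᵢ) aᵢ₊₁`. -/
def mulLast (f : HCoch K A M i) : HCoch K A M (i + 1) :=
  MultilinearMap.mk' (fun a => R.r (a (Fin.last i)) (f (Fin.init a)))
    (fun m i x y => by cases i using Fin.lastCases <;> simp [Ne.symm])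
    (fun m i c x => by cases i using Fin.lastCases <;> simp [Ne.symm])

/-- The map `(a₁, …, aᵢ₊₁) ↦ f(a₁, …, aₖaₖ₊₁, …, aᵢ₊₁)`, for `k` counted from `1`. -/
def _root_.HCoch.contract (k : Fin i) (f : HCoch K A M i) : HCoch K A M (i + 1) :=
  MultilinearMap.mk' (fun a => f (Fin.contractNth k.castSucc (· * ·) a))
    (fun a m x y => by
      obtain ⟨m', L, h⟩ := HCochain.contractNth_update (K := K) k a m
      simp only [h, map_add, MultilinearMap.map_update_add])
    (fun a m c x => by
      obtain ⟨m', L, h⟩ := HCochain.contractNth_update (K := K) k a m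
      simp only [h, map_smul, MultilinearMap.map_update_smul])

/-- The Hochschild differential with coefficients in `M`. -/
def hochD (i : ℕ) : HCoch K A M i →ₗ[K] HCoch K A M (i + 1) where
  toFun f := R.mulFirst f + ∑ k : Fin i, (-1 : K) ^ (k.1 + 1) • HCoch.contract k f
    + (-1 : K) ^ (i + 1) • R.mulLast f
  map_add' f g := by
    ext a
    simp [mulFirst, mulLast, HCoch.contract, Finset.sum_add_distrib]
    abel
  map_smul' c f := by
    ext a
    simp [mulFirst, mulLast, HCoch.contract, Finset.smul_sum, smul_comm c]

lemma hochD_apply (f : HCoch K A M i) (a : Fin (i + 1) → A) :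
    R.hochD i f a = R.l (a 0) (f (Fin.tail a)) +
      ∑ k : Fin i, (-1 : K) ^ (k.1 + 1) • f (Fin.contractNth k.castSucc (· * ·) a) +
      (-1 : K) ^ (i + 1) • R.r (a (Fin.last i)) (f (Fin.init a)) := by
  simp [hochD, mulFirst, mulLast, HCoch.contract]

/-- The Lie action on `Hom(A^{⊗ i}, M)`. -/
def cochAct (x : A) (f : HCoch K A M i) : HCoch K A M i :=
  (R.ρ x).compMultilinearMap f -
    ∑ t : Fin i, f.compLinearMap (Function.update (fun _ => LinearMap.id) t (P.br x))

lemma cochAct_apply (x : A) (f : HCoch K A M i) (a : Fin i → A) :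
    R.cochAct x f a = R.ρ x (f a) - ∑ t, f (Function.update a t (P.br x (a t))) := by
  simp only [cochAct, sub_apply, LinearMap.compMultilinearMap_apply,
    sum_apply, MultilinearMap.compLinearMap_apply]
  congr 1
  refine Finset.sum_congr rfl fun t _ => congrArg f (funext fun s => ?_)
  by_cases h : s = t
  · subst h; simp
  · simp [h]

/-- The Lie action on `Hom(A^{⊗ i}, M)`, as a linear map. -/
def cochRep (i : ℕ) : A →ₗ[K] Module.End K (HCoch K A M i) :=
  LinearMap.mk₂ K R.cochAct
    (fun x y f => by
      ext a; simp [cochAct_apply, Finset.sum_add_distrib]; abel)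
    (fun c x f => by
      ext a; simp [cochAct_apply, Finset.smul_sum, smul_sub])
    (fun x f g => by
      ext a; simp [cochAct_apply, Finset.sum_add_distrib]; abel)
    (fun c x f => by
      ext a; simp [cochAct_apply, Finset.smul_sum, smul_sub])

lemma cochRep_apply (x : A) (f : HCoch K A M i) (a : Fin i → A) :
    R.cochRep i x f a = R.ρ x (f a) - ∑ t, f (Function.update a t (P.br x (a t))) :=
  R.cochAct_apply x f a

lemma cochRep_zero (x : A) (f : HCoch K A M 0) (a : Fin 0 → A) :
    R.cochRep 0 x f a = R.ρ x (f a) := by simp [cochRep_apply]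

lemma _root_.HCoch.ext_curryRight {f g : HCoch K A M (i + 1)}
    (h : f.curryRight = g.curryRight) : f = g := by
  rw [← MultilinearMap.uncurry_curryRight f, h, MultilinearMap.uncurry_curryRight]

lemma contractNth_snoc_castSucc (k : Fin i) (a : Fin (i + 1) → A) (b : A) :
    Fin.contractNth k.castSucc.castSucc (· * ·) (Fin.snoc a b : Fin (i + 2) → A) =
      Fin.snoc (Fin.contractNth k.castSucc (· * ·) a) b := by
  funext t
  induction t using Fin.lastCases with
  | last =>
    have := k.isLt
    simp only [Fin.contractNth, Fin.snoc_last, Fin.val_last, Fin.val_castSucc, Fin.succ_last]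
    rw [if_neg (by omega), if_neg (by omega)]
  | cast t =>
    simp only [Fin.contractNth, Fin.snoc_castSucc, Fin.succ_castSucc, Fin.val_castSucc]

lemma contractNth_snoc_last (a : Fin (i + 1) → A) (b : A) :
    Fin.contractNth (Fin.last i).castSucc (· * ·) (Fin.snoc a b : Fin (i + 2) → A) =
      Fin.snoc (Fin.init a) (a (Fin.last i) * b) := by
  funext t
  induction t using Fin.lastCases with
  | last =>
    simp only [Fin.contractNth, Fin.snoc_last, Fin.val_last, Fin.val_castSucc, Fin.succ_last]
    rw [if_neg (by omega), if_pos trivial, Fin.snoc_castSucc]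
  | cast t =>
    simp only [Fin.contractNth, Fin.snoc_castSucc, Fin.val_castSucc, Fin.val_last]
    rw [if_pos t.isLt]
    rfl

omit [Ring A] in
lemma tail_snoc (a : Fin (i + 1) → A) (b : A) :
    Fin.tail (Fin.snoc a b : Fin (i + 2) → A) = (Fin.snoc (Fin.tail a) b : Fin (i + 1) → A) := by
  funext t
  induction t using Fin.lastCases with
  | last => simp [Fin.tail]
  | cast t => simp only [Fin.tail, Fin.succ_castSucc, Fin.snoc_castSucc]

lemma hochD_snoc (f : HCoch K A M (i + 1)) (a : Fin (i + 1) → A) (b : A) :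
    R.hochD (i + 1) f (Fin.snoc a b : Fin (i + 2) → A) =
      R.l (a 0) (f (Fin.snoc (Fin.tail a) b : Fin (i + 1) → A)) +
      ∑ k : Fin i, (-1 : K) ^ (k.1 + 1) •
        f (Fin.snoc (Fin.contractNth k.castSucc (· * ·) a) b : Fin (i + 1) → A) +
      (-1 : K) ^ (i + 1) • (f (Fin.snoc (Fin.init a) (a (Fin.last i) * b) : Fin (i + 1) → A) -
        R.r b (f a)) := by
  rw [hochD_apply, tail_snoc, Fin.sum_univ_castSucc, contractNth_snoc_last, Fin.init_snoc,
    Fin.snoc_last]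
  simp only [contractNth_snoc_castSucc]
  have h0 : (Fin.snoc a b : Fin (i + 2) → A) 0 = a 0 := by
    rw [← Fin.castSucc_zero, Fin.snoc_castSucc]
  rw [h0, pow_succ _ (i + 1)]
  simp [smul_sub]
  abel

/-- The last contraction and the last multiplication, f(…, ab) - f(…, a)b, together form the right
action of `twist`. Identities proved for all coefficients at once then follow by induction on the
number of arguments, starting from none. -/
lemma curryRight_hochD (f : HCoch K A M (i + 1)) :
    (R.hochD (i + 1) f).curryRight = R.twist.hochD i f.curryRight := by
  ext a b
  rw [MultilinearMap.curryRight_apply, hochD_snoc, hochD_apply]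
  simp [twist, LinearMap.sum_apply]

lemma curryRight_cochRep (x : A) (f : HCoch K A M (i + 1)) :
    (R.cochRep (i + 1) x f).curryRight = R.twist.cochRep i x f.curryRight := by
  ext a b
  rw [MultilinearMap.curryRight_apply, cochRep_apply, cochRep_apply, Fin.sum_univ_castSucc]
  simp only [Fin.update_snoc_last, Fin.snoc_last]
  simp [twist, LinearMap.sum_apply, ← Fin.snoc_update]
  abel

lemma hochD_hochD (f : HCoch K A M i) : R.hochD (i + 1) (R.hochD i f) = 0 := by
  induction i generalizing M with
  | zero =>
    obtain ⟨m, hm⟩ : ∃ m, ∀ b, f b = m :=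
      ⟨f Fin.elim0, fun b => congrArg f (Subsingleton.elim _ _)⟩
    ext a
    simp [hochD_apply, hm, Fin.contractNth, Fin.tail, Fin.init, R.l_mul, R.r_mul, R.l_r]
    abel
  | succ i ih =>
    refine HCoch.ext_curryRight ?_
    rw [curryRight_hochD, curryRight_hochD, ih]
    rfl

/-- Without arguments this says that the Lie algebra acts by derivations, `ρ_l` and `ρ_r`; currying
does the rest. -/
lemma hochD_cochRep (x : A) (f : HCoch K A M i) :
    R.hochD i (R.cochRep i x f) = R.cochRep (i + 1) x (R.hochD i f) := by
  induction i generalizing M with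
  | zero =>
    obtain ⟨m, hm⟩ : ∃ m, ∀ b, f b = m :=
      ⟨f Fin.elim0, fun b => congrArg f (Subsingleton.elim _ _)⟩
    ext a
    simp [hochD_apply, cochRep_apply, hm, R.ρ_l, R.ρ_r]
    abel
  | succ i ih =>
    refine HCoch.ext_curryRight ?_
    rw [curryRight_hochD, curryRight_cochRep, ih, curryRight_cochRep, curryRight_hochD]

lemma cochRep_lie (x y : A) :
    R.cochRep i (P.br x y) = R.cochRep i x * R.cochRep i y - R.cochRep i y * R.cochRep i x := by
  refine LinearMap.ext fun f => ?_
  simp only [LinearMap.sub_apply, Module.End.mul_apply]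
  induction i generalizing M with
  | zero =>
    ext a
    simp [cochRep_apply, R.ρ_br]
  | succ i ih =>
    refine HCoch.ext_curryRight ?_
    rw [curryRight_cochRep, ih, ← curryRight_cochRep, ← curryRight_cochRep, ← curryRight_cochRep,
      ← curryRight_cochRep]
    rfl

variable {R R'}

lemma IsHom.hochD {φ : M →ₗ[K] M'} (h : IsHom R R' φ) (f : HCoch K A M i) :
    φ.compMultilinearMap (R.hochD i f) = R'.hochD i (φ.compMultilinearMap f) := by
  ext a
  simp [hochD_apply, h.l, h.r]

lemma IsHom.cochRep {φ : M →ₗ[K] M'} (h : IsHom R R' φ) (x : A) (f : HCoch K A M i) :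
    φ.compMultilinearMap (R.cochRep i x f) = R'.cochRep i x (φ.compMultilinearMap f) := by
  ext a
  simp [cochRep_apply, h.ρ]

end Rep

end PoissonBracket

/-! ### Graded differential spaces -/

namespace GradedDiff

variable {K : Type u} [Field K]

section Basic

variable {V : Type u} [AddCommGroup V] [Module K V]
  (C : ℕ → Submodule K V) (σ : V →ₗ[K] V)

/-- The cocycles of degree `n`. -/
def cyc (n : ℕ) : Submodule K V := C n ⊓ LinearMap.ker σ

/-- The coboundaries of degree `n`. -/
def bdry : ℕ → Submodule K V
  | 0 => ⊥
  | n + 1 => (C n).map σ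

/-- The cohomology in degree `n`. -/
abbrev coh (n : ℕ) : Type u := SubQuot K V (cyc C σ n) (bdry C σ n)

variable {C σ}

lemma bdry_le_cyc (hσ : ∀ n, ∀ v ∈ C n, σ v ∈ C (n + 1)) (hσσ : ∀ v, σ (σ v) = 0) (n : ℕ) :
    bdry C σ n ≤ cyc C σ n := by
  cases n with
  | zero => exact bot_le
  | succ n =>
    rintro _ ⟨v, hv, rfl⟩
    exact ⟨hσ n v hv, hσσ v⟩

end Basic

section DimensionShift

variable {V V' V'' : Type u} [AddCommGroup V] [Module K V] [AddCommGroup V'] [Module K V']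
  [AddCommGroup V''] [Module K V'']
  {C : ℕ → Submodule K V} {C' : ℕ → Submodule K V'} {C'' : ℕ → Submodule K V''}
  {σ : V →ₗ[K] V} {σ' : V' →ₗ[K] V'} {σ'' : V'' →ₗ[K] V''}

/-- Dimension shifting for a short exact sequence of complexes that is split as a sequence of
graded vector spaces. -/
theorem exists_shift (f : V →ₗ[K] V') (g : V' →ₗ[K] V'') (s : V'' →ₗ[K] V') (t : V' →ₗ[K] V)
    (hf : ∀ n, ∀ v ∈ C n, f v ∈ C' n) (hg : ∀ n, ∀ v ∈ C' n, g v ∈ C'' n)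
    (hs : ∀ n, ∀ v ∈ C'' n, s v ∈ C' n) (ht : ∀ n, ∀ v ∈ C' n, t v ∈ C n)
    (hσ' : ∀ n, ∀ v ∈ C' n, σ' v ∈ C' (n + 1)) (hσσ' : ∀ v, σ' (σ' v) = 0)
    (hfσ : ∀ v, f (σ v) = σ' (f v)) (hgσ : ∀ v, g (σ' v) = σ'' (g v))
    (htf : ∀ v, t (f v) = v) (hgs : ∀ v, g (s v) = v) (hsum : ∀ v, f (t v) + s (g v) = v)
    (hgf : ∀ v, g (f v) = 0) (n : ℕ) (hI : cyc C' σ' (n + 1) ≤ bdry C' σ' (n + 1)) :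
    Nonempty (coh C σ (n + 1) ≃ₗ[K] SubQuot K V'' (cyc C'' σ'' n) ((cyc C' σ' n).map g)) := by
  have hft : ∀ v, f (t v) = v - s (g v) := fun v => eq_sub_of_add_eq (hsum v)
  have hgz : ∀ z ∈ cyc C'' σ'' n, g (σ' (s z)) = 0 := fun z hz => by
    rw [hgσ, hgs]; exact hz.2
  have hmem : ∀ z ∈ cyc C'' σ'' n, t (σ' (s z)) ∈ cyc C σ (n + 1) := fun z hz => by
    refine ⟨ht _ _ (hσ' _ _ (hs _ _ hz.1)), ?_⟩
    have h : f (σ (t (σ' (s z)))) = 0 := by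
      rw [hfσ, hft, hgz z hz, map_zero, sub_zero, hσσ']
    rw [SetLike.mem_coe, LinearMap.mem_ker, ← htf (σ (t (σ' (s z)))), h, map_zero]
  -- The connecting map of the snake lemma: lift by s, apply the differential, return along f, which
  -- t inverts on its image.
  let δ : cyc C'' σ'' n →ₗ[K] coh C σ (n + 1) :=
    Submodule.mkQ _ ∘ₗ (t ∘ₗ σ' ∘ₗ s).restrict hmem
  have hδ : Function.Surjective δ := by
    intro q
    obtain ⟨⟨z, hz⟩, rfl⟩ := Submodule.mkQ_surjective _ q
    -- Acyclicity of the middle complex enters here: the cocycle becomes a coboundary σ' c there,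
    -- and g c is the wanted preimage.
    obtain ⟨c, hc, hcz⟩ := hI (show f z ∈ cyc C' σ' (n + 1) from
      ⟨hf _ _ hz.1, by
        have : σ z = 0 := hz.2
        rw [SetLike.mem_coe, LinearMap.mem_ker, ← hfσ, this, map_zero]⟩)
    refine ⟨⟨g c, hg _ _ hc, ?_⟩, ?_⟩
    · rw [SetLike.mem_coe, LinearMap.mem_ker, ← hgσ, hcz, hgf]
    · refine (Submodule.Quotient.eq _).2 ?_
      refine ⟨-t c, neg_mem (ht _ _ hc), ?_⟩
      change σ (-t c) = t (σ' (s (g c))) - z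
      have : s (g c) = c - f (t c) := by rw [hft]; abel
      rw [this, map_sub, map_sub, hcz, htf, ← hfσ, htf, map_neg]
      abel
  have hker : LinearMap.ker δ = ((cyc C' σ' n).map g).submoduleOf (cyc C'' σ'' n) := by
    ext ⟨z, hz⟩
    rw [LinearMap.mem_ker]
    change Submodule.Quotient.mk _ = _ ↔ z ∈ (cyc C' σ' n).map g
    rw [Submodule.Quotient.mk_eq_zero]
    change t (σ' (s z)) ∈ bdry C σ (n + 1) ↔ _
    constructor
    · rintro ⟨m, hm, hmz⟩
      -- When the class of z dies, correcting the lift s z by f m gives a cocycle over z.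
      refine ⟨s z - f m, ⟨sub_mem (hs _ _ hz.1) (hf _ _ hm), ?_⟩, ?_⟩
      · rw [SetLike.mem_coe, LinearMap.mem_ker, map_sub, ← hfσ, hmz, hft, hgz z hz, map_zero, sub_zero, sub_self]
      · rw [map_sub, hgs, hgf, sub_zero]
    · rintro ⟨c, hc, rfl⟩
      refine ⟨-t c, neg_mem (ht _ _ hc.1), ?_⟩
      have : s (g c) = c - f (t c) := by rw [hft]; abel
      have hc2 : σ' c = 0 := hc.2
      rw [this, map_sub, map_sub, hc2, map_zero, ← hfσ, htf, map_neg, zero_sub]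
  exact ⟨(δ.quotKerEquivOfSurjective hδ).symm.trans (Submodule.quotEquivOfEq _ _ hker)⟩

/-- Cochains lift through s. So in positive degrees, given acyclicity there, the quotient in
`exists_shift` is ordinary cohomology. -/
lemma map_cyc_eq_bdry (g : V' →ₗ[K] V'') (s : V'' →ₗ[K] V')
    (hg : ∀ n, ∀ v ∈ C' n, g v ∈ C'' n) (hs : ∀ n, ∀ v ∈ C'' n, s v ∈ C' n)
    (hσ' : ∀ n, ∀ v ∈ C' n, σ' v ∈ C' (n + 1)) (hσσ' : ∀ v, σ' (σ' v) = 0)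
    (hgσ : ∀ v, g (σ' v) = σ'' (g v)) (hgs : ∀ v, g (s v) = v)
    (n : ℕ) (hI : cyc C' σ' (n + 1) ≤ bdry C' σ' (n + 1)) :
    (cyc C' σ' (n + 1)).map g = bdry C'' σ'' (n + 1) := by
  rw [le_antisymm hI (bdry_le_cyc hσ' hσσ' _)]
  ext z
  constructor
  · rintro ⟨_, ⟨c, hc, rfl⟩, rfl⟩
    exact ⟨g c, hg _ _ hc, (hgσ c).symm⟩
  · rintro ⟨c, hc, rfl⟩
    exact ⟨σ' (s c), ⟨s c, hs _ _ hc, rfl⟩, by rw [hgσ, hgs]⟩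

end DimensionShift

end GradedDiff

/-! ### Double complexes -/

namespace DoubleComplex

variable {K : Type u} [Field K] {X : ℕ → ℕ → Type u} [∀ i j, AddCommGroup (X i j)]
  [∀ i j, Module K (X i j)]
  (dV : ∀ i j, X i j →ₗ[K] X (i + 1) j) (dH : ∀ i j, X i j →ₗ[K] X i (j + 1))

/-- The components of the total differential `dV + (-1)ⁱ dH`. -/
def totComp (f : ∀ i j, X i j) : ∀ i j, X i j
  | 0, 0 => 0
  | 0, j + 1 => dH 0 j (f 0 j)
  | i + 1, 0 => dV i 0 (f i 0)
  | i + 1, j + 1 => dV i (j + 1) (f i (j + 1)) + (-1 : K) ^ (i + 1) • dH (i + 1) j (f (i + 1) j)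

/-- The total differential. -/
def tot : (∀ i j, X i j) →ₗ[K] (∀ i j, X i j) where
  toFun := totComp dV dH
  map_add' f g := by
    funext i j
    cases i <;> cases j <;> simp [totComp]
    abel
  map_smul' c f := by
    funext i j
    cases i <;> cases j <;> simp [totComp, smul_comm c]

lemma tot_zero_zero (f : ∀ i j, X i j) : tot dV dH f 0 0 = 0 := rfl
lemma tot_zero_succ (f : ∀ i j, X i j) (j : ℕ) : tot dV dH f 0 (j + 1) = dH 0 j (f 0 j) := rfl
lemma tot_succ_zero (f : ∀ i j, X i j) (i : ℕ) : tot dV dH f (i + 1) 0 = dV i 0 (f i 0) := rfl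
lemma tot_succ_succ (f : ∀ i j, X i j) (i j : ℕ) : tot dV dH f (i + 1) (j + 1) =
    dV i (j + 1) (f i (j + 1)) + (-1 : K) ^ (i + 1) • dH (i + 1) j (f (i + 1) j) := rfl

variable (K X) in
/-- The families supported on the components of total degree `n`. -/
def total (n : ℕ) : Submodule K (∀ i j, X i j) where
  carrier := {f | ∀ i j, i + j ≠ n → f i j = 0}
  zero_mem' _ _ _ := rfl
  add_mem' hf hg i j h := by simp [hf i j h, hg i j h]
  smul_mem' c f hf i j h := by simp [hf i j h]

lemma tot_mem_total (n : ℕ) (f : ∀ i j, X i j) (hf : f ∈ total K X n) :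
    tot dV dH f ∈ total K X (n + 1) := by
  intro i j hij
  rcases i with _ | i <;> rcases j with _ | j
  · rfl
  · rw [tot_zero_succ, hf _ _ (by omega), map_zero]
  · rw [tot_succ_zero, hf _ _ (by omega), map_zero]
  · rw [tot_succ_succ, hf _ _ (by omega), hf _ _ (by omega), map_zero, map_zero, smul_zero,
      add_zero]

variable {dV dH}

/-- The differentials commute, and the sign (-1)ⁱ makes the two mixed terms cancel. -/
lemma tot_tot (hVV : ∀ i j x, dV (i + 1) j (dV i j x) = 0)
    (hHH : ∀ i j x, dH i (j + 1) (dH i j x) = 0)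
    (hVH : ∀ i j x, dH (i + 1) j (dV i j x) = dV i (j + 1) (dH i j x)) (f : ∀ i j, X i j) :
    tot dV dH (tot dV dH f) = 0 := by
  funext i j
  rcases i with _ | _ | i <;> rcases j with _ | _ | j <;>
    simp [tot_zero_zero, tot_zero_succ, tot_succ_zero, tot_succ_succ, hVV, hHH, hVH, pow_succ]

/-- If the columns are exact above `k`, every cocycle of the total complex is cohomologous to one
supported on the components with `i ≤ k`. -/
lemma exists_truncation (hVV : ∀ i j x, dV (i + 1) j (dV i j x) = 0)
    (hHH : ∀ i j x, dH i (j + 1) (dH i j x) = 0)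
    (hVH : ∀ i j x, dH (i + 1) j (dV i j x) = dV i (j + 1) (dH i j x)) (k : ℕ)
    (hex : ∀ i j, k ≤ i → ∀ x, dV (i + 1) j x = 0 → ∃ y, dV i j y = x) (n : ℕ)
    (f : ∀ i j, X i j) (hf : f ∈ GradedDiff.cyc (total K X) (tot dV dH) n) :
    ∃ e ∈ GradedDiff.bdry (total K X) (tot dV dH) n, ∀ i j, k < i → (f - e) i j = 0 := by
  cases n with
  | zero => exact ⟨0, zero_mem _, fun i j h => by
      rw [sub_zero]; exact hf.1 i j (by omega)⟩
  | succ n =>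
  -- Induction on m, where k + m bounds the first index of a nonzero component. In total degree n +
  -- 1 the value m = n + 1 always works.
  suffices H : ∀ (m : ℕ) (f : ∀ i j, X i j),
      f ∈ GradedDiff.cyc (total K X) (tot dV dH) (n + 1) → (∀ i j, k + m < i → f i j = 0) →
      ∃ e ∈ GradedDiff.bdry (total K X) (tot dV dH) (n + 1), ∀ i j, k < i → (f - e) i j = 0 from
    H (n + 1) f hf fun i j h => hf.1 i j (by omega)
  intro m
  induction m with
  | zero => exact fun f _ h => ⟨0, zero_mem _, fun i j hi => by simpa using h i j (by omega)⟩
  | succ m ih =>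
    intro f hf h
    -- At first index k + m + 2 the cocycle equation has no horizontal contribution.
    have hz : ∀ j, dV (k + m + 1) j (f (k + m + 1) j) = 0 := fun j => by
      have h1 : tot dV dH f (k + m + 2) j = 0 := congrFun (congrFun hf.2 _) j
      cases j with
      | zero => exact h1
      | succ j =>
        rw [tot_succ_succ, h (k + m + 2) j (by omega), map_zero, smul_zero, add_zero] at h1
        exact h1
    -- Choosing 0 as the primitive of 0 keeps the correcting family in total degree n.
    have hy : ∀ j, ∃ y : X (k + m) j, dV (k + m) j y = f (k + m + 1) j ∧
        (f (k + m + 1) j = 0 → y = 0) := fun j => by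
      by_cases h0 : f (k + m + 1) j = 0
      · exact ⟨0, by rw [map_zero, h0], fun _ => rfl⟩
      · obtain ⟨y, hy⟩ := hex (k + m) j (by omega) _ (hz j)
        exact ⟨y, hy, fun h => absurd h h0⟩
    choose y hy hy0 using hy
    let g : ∀ i j, X i j := fun i j => if hi : k + m = i then hi ▸ y j else 0
    have hg : ∀ j, g (k + m) j = y j := fun j => by simp [g]
    have hg' : ∀ i j, k + m ≠ i → g i j = 0 := fun i j hi => by simp [g, hi]
    have hgn : g ∈ total K X n := fun i j hij => by
      by_cases hi : k + m = i
      · subst hi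
        rw [hg]
        exact hy0 _ (hf.1 _ _ (by omega))
      · exact hg' i j hi
    obtain ⟨e, he, hfe⟩ := ih (f - tot dV dH g)
      ⟨sub_mem hf.1 (tot_mem_total dV dH n g hgn), by
        rw [SetLike.mem_coe, LinearMap.mem_ker, map_sub, tot_tot hVV hHH hVH, sub_zero]; exact hf.2⟩ (by
        intro i j hi
        obtain ⟨i, rfl⟩ : ∃ i', i = i' + 1 := ⟨i - 1, by omega⟩
        have h2 : tot dV dH g (i + 1) j = dV i j (g i j) := by
          cases j with
          | zero => rfl
          | succ j => rw [tot_succ_succ, hg' (i + 1) j (by omega), map_zero, smul_zero, add_zero]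
        change f (i + 1) j - tot dV dH g (i + 1) j = 0
        rw [h2]
        by_cases hi' : k + m = i
        · subst hi'
          rw [hg, hy, sub_self]
        · rw [hg' i j hi', map_zero, h (i + 1) j (by omega), sub_zero])
    refine ⟨tot dV dH g + e, add_mem ⟨g, hgn, rfl⟩ he, fun i j hi => ?_⟩
    rw [← sub_sub]
    exact hfe i j hi

section Maps

variable {Y : ℕ → ℕ → Type u} [∀ i j, AddCommGroup (Y i j)] [∀ i j, Module K (Y i j)]
  {dV' : ∀ i j, Y i j →ₗ[K] Y (i + 1) j} {dH' : ∀ i j, Y i j →ₗ[K] Y i (j + 1)}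

/-- The map of families induced by a family of maps. -/
def mapFam (φ : ∀ i j, X i j →ₗ[K] Y i j) : (∀ i j, X i j) →ₗ[K] (∀ i j, Y i j) where
  toFun f i j := φ i j (f i j)
  map_add' f g := by funext i j; simp
  map_smul' c f := by funext i j; simp

lemma mapFam_apply (φ : ∀ i j, X i j →ₗ[K] Y i j) (f : ∀ i j, X i j) (i j : ℕ) :
    mapFam φ f i j = φ i j (f i j) := rfl

lemma mapFam_mem_total (φ : ∀ i j, X i j →ₗ[K] Y i j) (n : ℕ) (f : ∀ i j, X i j)
    (hf : f ∈ total K X n) : mapFam φ f ∈ total K Y n := fun i j h => by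
  rw [mapFam_apply, hf i j h, map_zero]

lemma mapFam_tot (φ : ∀ i j, X i j →ₗ[K] Y i j)
    (hV : ∀ i j x, φ (i + 1) j (dV i j x) = dV' i j (φ i j x))
    (hH : ∀ i j x, φ i (j + 1) (dH i j x) = dH' i j (φ i j x)) (f : ∀ i j, X i j) :
    mapFam φ (tot dV dH f) = tot dV' dH' (mapFam φ f) := by
  funext i j
  rcases i with _ | i <;> rcases j with _ | j <;>
    simp [mapFam_apply, tot_zero_zero, tot_zero_succ, tot_succ_zero, tot_succ_succ, hV, hH]

end Maps

end DoubleComplex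

/-! ### The Poincaré–Birkhoff–Witt representation -/

namespace PoissonBracket

namespace PBW

variable {K A : Type u} [Field K] [Ring A] [Algebra K A] (P : PoissonBracket K A)
  {I : Type u} [LinearOrder I] (b : Module.Basis I K A)

/-- The polynomials in the elements of a basis, as formal combinations of monomials. -/
abbrev Poly (K I : Type u) [Field K] : Type u := Multiset I →₀ K

/-- The monomial of a multiset. -/
abbrev mono (K : Type u) {I : Type u} [Field K] (J : Multiset I) : Poly K I := Finsupp.single J 1

/-- The polynomials of degree at most `n`. -/
def degLE (K I : Type u) [Field K] (n : ℕ) : Submodule K (Poly K I) :=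
  Finsupp.supported K K {J | J.card ≤ n}

omit [LinearOrder I] in
lemma degLE_induction {n : ℕ} {p : Poly K I → Prop} (h0 : p 0)
    (ha : ∀ s t, p s → p t → p (s + t)) (hc : ∀ (c : K) s, p s → p (c • s))
    (hm : ∀ J : Multiset I, J.card ≤ n → p (mono K J)) {s : Poly K I} (hs : s ∈ degLE K I n) :
    p s := by
  rw [degLE, Finsupp.supported_eq_span_single] at hs
  induction hs using Submodule.span_induction with
  | mem x hx => obtain ⟨J, hJ, rfl⟩ := hx; exact hm J hJ
  | zero => exact h0
  | add x y _ _ hx hy => exact ha _ _ hx hy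
  | smul c x _ hx => exact hc c x hx

omit [LinearOrder I] in
lemma basis_induction {p : A → Prop} (h0 : p 0) (ha : ∀ s t, p s → p t → p (s + t))
    (hc : ∀ (c : K) s, p s → p (c • s)) (hb : ∀ i, p (b i)) (x : A) : p x := by
  induction b.mem_span x using Submodule.span_induction with
  | mem x hx => obtain ⟨i, rfl⟩ := hx; exact hb i
  | zero => exact h0
  | add x y _ _ hx hy => exact ha _ _ hx hy
  | smul c x _ hx => exact hc c x hx

lemma exists_min_mem (J : Multiset I) (hJ : J ≠ 0) : ∃ j ∈ J, ∀ k ∈ J, j ≤ k := by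
  obtain ⟨k, hk⟩ := Multiset.exists_mem_of_ne_zero hJ
  obtain ⟨j, hj, hmin⟩ := J.toFinset.exists_min_image id ⟨k, Multiset.mem_toFinset.2 hk⟩
  exact ⟨j, Multiset.mem_toFinset.1 hj, fun l hl => hmin l (Multiset.mem_toFinset.2 hl)⟩

omit [LinearOrder I] in
lemma mono_mem_degLE {n : ℕ} {J : Multiset I} (h : J.card ≤ n) : mono K J ∈ degLE K I n :=
  Finsupp.single_mem_supported K 1 h

omit [LinearOrder I] in
lemma degLE_mono {m n : ℕ} (h : m ≤ n) : degLE K I m ≤ degLE K I n :=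
  Finsupp.supported_mono fun _ hJ => le_trans hJ h

/-- The bilinear map with prescribed values on a basis element and a monomial. -/
def ofValues (F : I → Multiset I → Poly K I) : A →ₗ[K] Poly K I →ₗ[K] Poly K I :=
  b.constr K fun i => Finsupp.linearCombination K (F i)

omit [LinearOrder I] in
lemma ofValues_basis_mono (F : I → Multiset I → Poly K I) (i : I) (J : Multiset I) :
    ofValues b F (b i) (mono K J) = F i J := by
  simp [ofValues]

open Classical in
/-- Approximations of the action of a basis element on a monomial, correct up to degree `n`. -/
def approx : ℕ → I → Multiset I → Poly K I
  | 0, i, J => mono K (i ::ₘ J)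
  | n + 1, i, J =>
    if J.card ≤ n then approx n i J else
    -- With j the least element of J = jJ' and j < i, the rule is i·(j·J') = j·(i·J') + {i, j}·J'.
    -- The leading monomial iJ' of i·J' contributes iJ, because j lies below all of it; only the
    -- lower terms of i·J' are acted on recursively by j.
    if h : ∃ j ∈ J, j < i ∧ ∀ k ∈ J, j ≤ k then
      mono K (i ::ₘ J) + ofValues b (approx n) (b h.choose)
        (ofValues b (approx n) (b i) (mono K (J.erase h.choose)) -
          mono K (i ::ₘ J.erase h.choose)) +
        ofValues b (approx n) (P.br (b i) (b h.choose)) (mono K (J.erase h.choose))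
    else mono K (i ::ₘ J)

/-- The action of `A` on polynomials. -/
def act : A →ₗ[K] Module.End K (Poly K I) := ofValues b fun i J => approx P b J.card i J

lemma act_basis_mono (i : I) (J : Multiset I) :
    act P b (b i) (mono K J) = approx P b J.card i J := ofValues_basis_mono b _ i J

lemma approx_of_card_le (n : ℕ) (i : I) (J : Multiset I) (h : J.card ≤ n) :
    approx P b n i J = approx P b J.card i J := by
  induction n with
  | zero => rw [Nat.le_zero.1 h]
  | succ n ih =>
    rcases Nat.lt_or_ge n J.card with hn | hn
    · rw [show J.card = n + 1 by omega]
    · rw [← ih hn, approx, if_pos hn]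

lemma ofValues_approx (n : ℕ) (x : A) {s : Poly K I} (hs : s ∈ degLE K I n) :
    ofValues b (approx P b n) x s = act P b x s := by
  refine degLE_induction (p := fun s => ofValues b (approx P b n) x s = act P b x s)
    (by rw [map_zero, map_zero]) (fun s t h1 h2 => by rw [map_add, map_add, h1, h2])
    (fun c s h => by rw [map_smul, map_smul, h]) (fun J hJ => ?_) hs
  · refine LinearMap.congr_fun (f := (ofValues b (approx P b n)).flip (mono K J))
      (g := LinearMap.flip (act P b) (mono K J)) (b.ext fun i => ?_) x
    rw [LinearMap.flip_apply, LinearMap.flip_apply, act_basis_mono, ofValues_basis_mono,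
      approx_of_card_le P b n i J hJ]

lemma act_basis_mono_of_le (i : I) (J : Multiset I) (h : ∀ k ∈ J, i ≤ k) :
    act P b (b i) (mono K J) = mono K (i ::ₘ J) := by
  rw [act_basis_mono]
  cases hJ : J.card with
  | zero => rfl
  | succ n =>
    rw [approx, if_neg (by omega), dif_neg]
    rintro ⟨j, hj, hji, -⟩
    exact absurd (h j hj) (not_le.2 hji)

/-- An element is determined up to lower terms by its action. -/
lemma act_sub_mem_aux (n : ℕ) : ∀ (i : I) (J : Multiset I), J.card = n →
    act P b (b i) (mono K J) - mono K (i ::ₘ J) ∈ degLE K I n ∧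
    ∀ j, j < i → (∀ k ∈ J, j ≤ k) → ∀ J', J = j ::ₘ J' →
      act P b (b i) (mono K J) = mono K (i ::ₘ J) +
        act P b (b j) (act P b (b i) (mono K J') - mono K (i ::ₘ J')) +
        act P b (P.br (b i) (b j)) (mono K J') := by
  induction n using Nat.strong_induction_on with
  | _ n ih =>
  intro i J hJ
  by_cases h : ∃ j ∈ J, j < i ∧ ∀ k ∈ J, j ≤ k
  swap
  · refine ⟨?_, fun j hji hj J' hJ' => absurd ⟨j, hJ' ▸ Multiset.mem_cons_self j J', hji, hj⟩ h⟩
    have hi : ∀ k ∈ J, i ≤ k := by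
      by_contra hcon
      push Not at hcon
      obtain ⟨k, hk, hki⟩ := hcon
      obtain ⟨j, hj, hmin⟩ := exists_min_mem J (by rintro rfl; simp at hk)
      exact h ⟨j, hj, lt_of_le_of_lt (hmin k hk) hki, hmin⟩
    rw [act_basis_mono_of_le P b i J hi, sub_self]
    exact zero_mem _
  have hpos : 0 < J.card := Multiset.card_pos_iff_exists_mem.2 ⟨_, h.choose_spec.1⟩
  obtain ⟨n, rfl⟩ : ∃ m, n = m + 1 := ⟨n - 1, by omega⟩
  have hcard : (J.erase h.choose).card = n := by
    rw [Multiset.card_erase_of_mem h.choose_spec.1, hJ]; rfl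
  have hlow : act P b (b i) (mono K (J.erase h.choose)) - mono K (i ::ₘ J.erase h.choose) ∈
      degLE K I n := (ih n (by omega) i _ hcard).1
  -- Acting raises the degree by at most one; up to degree n the induction hypothesis already gives
  -- this.
  have hstep : ∀ (x : A) (s : Poly K I), s ∈ degLE K I n → act P b x s ∈ degLE K I (n + 1) := by
    intro x s hs
    refine degLE_induction (p := fun s => act P b x s ∈ degLE K I (n + 1))
      (by rw [map_zero]; exact zero_mem _) (fun s t h1 h2 => by rw [map_add]; exact add_mem h1 h2)
      (fun c s h => by rw [map_smul]; exact Submodule.smul_mem _ _ h) (fun L hL => ?_) hs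
    · induction x using basis_induction b with
      | h0 => rw [map_zero]; exact zero_mem _
      | ha x y hx hy => rw [map_add]; exact add_mem hx hy
      | hc c x hx => rw [map_smul]; exact Submodule.smul_mem _ _ hx
      | hb k =>
        rw [← sub_add_cancel (act P b (b k) (mono K L)) (mono K (k ::ₘ L))]
        exact add_mem (degLE_mono (by omega) (ih L.card (by omega) k L rfl).1)
          (mono_mem_degLE (by rw [Multiset.card_cons]; omega))
  have hrec : act P b (b i) (mono K J) = mono K (i ::ₘ J) +
      act P b (b h.choose) (act P b (b i) (mono K (J.erase h.choose)) -
        mono K (i ::ₘ J.erase h.choose)) +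
      act P b (P.br (b i) (b h.choose)) (mono K (J.erase h.choose)) := by
    rw [act_basis_mono, hJ, approx, if_neg (by omega), dif_pos h,
      ofValues_approx P b n (b i) (mono_mem_degLE hcard.le), ofValues_approx P b n _ hlow,
      ofValues_approx P b n (P.br (b i) (b h.choose)) (mono_mem_degLE hcard.le)]
  refine ⟨?_, fun j hji hj J' hJ' => ?_⟩
  · rw [hrec, add_assoc, add_sub_cancel_left]
    exact add_mem (hstep _ _ hlow) (hstep _ _ (mono_mem_degLE hcard.le))
  -- The recursion takes some least element of J; least elements are unique.
  · have hj' : h.choose = j := le_antisymm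
      (h.choose_spec.2.2 j (hJ' ▸ Multiset.mem_cons_self j J')) (hj _ h.choose_spec.1)
    have he : J.erase h.choose = J' := by rw [hj', hJ', Multiset.erase_cons_head]
    rw [hrec, he, hj']

lemma act_basis_mono_sub_mem (i : I) (J : Multiset I) :
    act P b (b i) (mono K J) - mono K (i ::ₘ J) ∈ degLE K I J.card :=
  (act_sub_mem_aux P b J.card i J rfl).1

/-- The action of brackets on polynomials of bounded degree. -/
lemma act_comm_of_mono {n : ℕ}
    (h : ∀ J : Multiset I, J.card ≤ n → ∀ i j, act P b (b i) (act P b (b j) (mono K J)) -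
      act P b (b j) (act P b (b i) (mono K J)) = act P b (P.br (b i) (b j)) (mono K J))
    (x y : A) {s : Poly K I} (hs : s ∈ degLE K I n) :
    act P b x (act P b y s) - act P b y (act P b x s) = act P b (P.br x y) s := by
  refine degLE_induction
    (p := fun s => act P b x (act P b y s) - act P b y (act P b x s) = act P b (P.br x y) s)
    (by simp) (fun s t h1 h2 => by simp only [map_add, ← h1, ← h2]; abel)
    (fun c s h => by simp only [map_smul, ← h, smul_sub]) (fun J hJ => ?_) hs
  · induction x using basis_induction b with
    | h0 => simp
    | ha x x' hx hx' => simp only [map_add, LinearMap.add_apply, ← hx, ← hx']; abel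
    | hc c x hx => simp only [map_smul, LinearMap.smul_apply, ← hx, smul_sub]
    | hb i =>
      induction y using basis_induction b with
      | h0 => simp
      | ha x x' hx hx' => simp only [map_add, LinearMap.add_apply, ← hx, ← hx']; abel
      | hc c x hx => simp only [map_smul, LinearMap.smul_apply, ← hx, smul_sub]
      | hb j => exact h J hJ i j

/-- The consistency check of the Poincaré–Birkhoff–Witt theorem. If the smaller of two distinct i, j
lies below all of J, the identity is the recursion that defines the action. Otherwise the least k in
J lies below both; with the monomial of J written as k·J', the Jacobi identity for the basis
elements of i, j, k reduces the claim to shorter monomials. -/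
lemma act_comm_mono (n : ℕ) : ∀ J : Multiset I, J.card ≤ n → ∀ i j,
    act P b (b i) (act P b (b j) (mono K J)) - act P b (b j) (act P b (b i) (mono K J)) =
      act P b (P.br (b i) (b j)) (mono K J) := by
  have base : ∀ (J : Multiset I) (i j : I), j < i → (∀ k ∈ J, j ≤ k) →
      act P b (b i) (act P b (b j) (mono K J)) - act P b (b j) (act P b (b i) (mono K J)) =
      act P b (P.br (b i) (b j)) (mono K J) := fun J i j hji hj => by
    have hj' : ∀ k ∈ j ::ₘ J, j ≤ k := fun k hk => by
      rcases Multiset.mem_cons.1 hk with rfl | hk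
      · exact le_rfl
      · exact hj k hk
    have hj'' : ∀ k ∈ i ::ₘ J, j ≤ k := fun k hk => by
      rcases Multiset.mem_cons.1 hk with rfl | hk
      · exact hji.le
      · exact hj k hk
    rw [act_basis_mono_of_le P b j J hj,
      (act_sub_mem_aux P b _ i (j ::ₘ J) rfl).2 j hji hj' J rfl, map_sub,
      act_basis_mono_of_le P b j _ hj'', Multiset.cons_swap i j]
    abel
  have skew : ∀ (J : Multiset I) (i j : I), i < j → (∀ k ∈ J, i ≤ k) →
      act P b (b i) (act P b (b j) (mono K J)) - act P b (b j) (act P b (b i) (mono K J)) =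
      act P b (P.br (b i) (b j)) (mono K J) := fun J i j hij hi => by
    rw [P.br_skew (b j) (b i), map_neg, LinearMap.neg_apply, ← base J j i hij hi]
    abel
  induction n using Nat.strong_induction_on with
  | _ n ih =>
  intro J hJ i j
  have mid : ∀ k ∈ J, (∀ l ∈ J, k ≤ l) → k < i → k < j →
      act P b (b i) (act P b (b j) (mono K J)) - act P b (b j) (act P b (b i) (mono K J)) =
      act P b (P.br (b i) (b j)) (mono K J) := by
    intro k hk hmin hki hkj
    obtain ⟨J', rfl⟩ := Multiset.exists_cons_of_mem hk
    have hJ' : J'.card < n := by rw [Multiset.card_cons] at hJ; omega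
    have hkJ' : ∀ l ∈ J', k ≤ l := fun l hl => hmin l (Multiset.mem_cons_of_mem hl)
    have hlow := fun x y {s} (hs : s ∈ degLE K I J'.card) =>
      act_comm_of_mono P b (ih J'.card hJ') x y hs
    -- The degree of j·J' is one too large for the induction hypothesis. Its leading monomial is
    -- covered by `base`, since k lies below it, and its lower terms by the hypothesis.
    have hsplit : ∀ i j, k < i → k < j →
        act P b (b i) (act P b (b k) (act P b (b j) (mono K J'))) -
          act P b (b k) (act P b (b i) (act P b (b j) (mono K J'))) =
        act P b (P.br (b i) (b k)) (act P b (b j) (mono K J')) := fun i j hki hkj => by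
      rw [← sub_add_cancel (act P b (b j) (mono K J')) (mono K (j ::ₘ J'))]
      have h1 := base (j ::ₘ J') i k hki fun l hl => by
        rcases Multiset.mem_cons.1 hl with rfl | hl
        · exact hkj.le
        · exact hkJ' l hl
      have h2 := hlow (b i) (b k) (act_basis_mono_sub_mem P b j J')
      simp only [map_add, ← h1, ← h2]
      abel
    have hz := mono_mem_degLE (K := K) (le_refl J'.card)
    rw [← act_basis_mono_of_le P b k J' hkJ']
    have e1 := hlow (b j) (b k) hz
    have e2 := hlow (b i) (b k) hz
    have e3 := hlow (b i) (P.br (b j) (b k)) hz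
    have e4 := hlow (b j) (P.br (b i) (b k)) hz
    have e5 := hlow (P.br (b i) (b j)) (b k) hz
    have e6 := hlow (b i) (b j) hz
    have e7 := hsplit i j hki hkj
    have e8 := hsplit j i hkj hki
    rw [sub_eq_iff_eq_add] at e1 e2 e3 e4 e5 e7 e8
    rw [e1, e2, e5, ← e6, map_add, map_add, e3, e4, e7, e8, P.jacobi (b i) (b j) (b k),
      map_sub, map_add, LinearMap.add_apply]
    abel
  have hmin : ∀ k, ¬ (∀ l ∈ J, k ≤ l) → ∃ m ∈ J, (∀ l ∈ J, m ≤ l) ∧ m < k := by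
    intro k hk
    push Not at hk
    obtain ⟨l, hl, hlk⟩ := hk
    obtain ⟨m, hm, hmin⟩ := exists_min_mem J (by rintro rfl; simp at hl)
    exact ⟨m, hm, hmin, (hmin l hl).trans_lt hlk⟩
  rcases lt_trichotomy i j with hij | rfl | hij
  · by_cases hi : ∀ k ∈ J, i ≤ k
    · exact skew J i j hij hi
    · obtain ⟨m, hm, hml, hmi⟩ := hmin i hi
      exact mid m hm hml hmi (hmi.trans hij)
  · rw [sub_self, P.br_self, map_zero, LinearMap.zero_apply]
  · by_cases hj : ∀ k ∈ J, j ≤ k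
    · exact base J i j hij hj
    · obtain ⟨m, hm, hml, hmj⟩ := hmin j hj
      exact mid m hm hml (hmj.trans hij) hmj

theorem act_br (x y : A) (s : Poly K I) :
    act P b (P.br x y) s = act P b x (act P b y s) - act P b y (act P b x s) := by
  induction s using Finsupp.induction_linear with
  | zero => simp
  | add s t hs ht => simp only [map_add, hs, ht]; abel
  | single J c =>
    refine (act_comm_of_mono P b (act_comm_mono P b J.card) x y ?_).symm
    exact Finsupp.single_mem_supported K c (le_refl J.card)

omit [LinearOrder I] in
lemma ofValues_apply_zero {F : I → Multiset I → Poly K I} (hF : ∀ i J, F i J 0 = 0) (x : A)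
    (s : Poly K I) : ofValues b F x s 0 = 0 := by
  induction x using basis_induction b with
  | h0 => simp
  | ha x y hx hy => simp [hx, hy]
  | hc c x hx => simp [hx]
  | hb i =>
    induction s using Finsupp.induction_linear with
    | zero => simp
    | add s t hs ht => rw [map_add, Finsupp.add_apply, hs, ht, add_zero]
    | single J c => simp [ofValues, hF]

/-- The value at 0 is the coefficient of the empty monomial, which no branch of the recursion
produces. This augmentation kills every x·s, and that makes `toCoindPoly` equivariant. -/
lemma act_apply_zero (x : A) (s : Poly K I) : act P b x s 0 = 0 := by
  have hc : ∀ (i : I) J, mono K (i ::ₘ J) 0 = 0 := fun i J => by simp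
  have h : ∀ n i J, approx P b n i J 0 = 0 := by
    intro n
    induction n with
    | zero => exact hc
    | succ n ih =>
      intro i J
      rw [approx]
      split_ifs
      · exact ih i J
      · rw [Finsupp.add_apply, Finsupp.add_apply, hc, ofValues_apply_zero b ih,
          ofValues_apply_zero b ih, add_zero, add_zero]
      · exact hc i J
  exact ofValues_apply_zero b (fun i J => h _ i J) x s

end PBW

end PoissonBracket

/-! ### Acyclicity of coinduced modules -/

namespace PoissonBracket

open AlternatingMap

lemma _root_.AlternatingMap.finset_sum_apply {K A N ι α : Type*} [CommRing K] [AddCommGroup A]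
    [Module K A] [AddCommGroup N] [Module K N] (s : Finset α) (f : α → A [⋀^ι]→ₗ[K] N)
    (x : ι → A) : (∑ p ∈ s, f p) x = ∑ p ∈ s, f p x := by
  classical
  induction s using Finset.induction_on with
  | empty => simp
  | insert a s ha ih => rw [Finset.sum_insert ha, Finset.sum_insert ha, ← ih]; rfl

namespace PBW

variable {K A : Type u} [Field K] [Ring A] [Algebra K A] (P : PoissonBracket K A)
  {I : Type u} [LinearOrder I] (b : Module.Basis I K A)
  {M : Type u} [AddCommGroup M] [Module K M] (τ : A →ₗ[K] Module.End K M)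

lemma act_mem_degLE (x : A) {n : ℕ} {s : Poly K I} (hs : s ∈ degLE K I n) :
    act P b x s ∈ degLE K I (n + 1) := by
  refine degLE_induction (p := fun s => act P b x s ∈ degLE K I (n + 1))
    (by rw [_root_.map_zero]; exact zero_mem _) (fun s t h1 h2 => by rw [map_add]; exact add_mem h1 h2)
    (fun c s h => by rw [map_smul]; exact Submodule.smul_mem _ _ h) (fun L hL => ?_) hs
  induction x using basis_induction b with
  | h0 => rw [_root_.map_zero]; exact zero_mem _
  | ha x y hx hy => rw [map_add]; exact add_mem hx hy
  | hc c x hx => rw [map_smul]; exact Submodule.smul_mem _ _ hx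
  | hb k =>
    rw [← sub_add_cancel (act P b (b k) (mono K L)) (mono K (k ::ₘ L))]
    exact add_mem (degLE_mono (by omega) (act_basis_mono_sub_mem P b k L))
      (mono_mem_degLE (by rw [Multiset.card_cons]; omega))

/-- The action of the Lie algebra `A` on `Hom(S(A), M)`. -/
def coind : A →ₗ[K] Module.End K (Poly K I →ₗ[K] M) :=
  LinearMap.mk₂ K (fun x F => τ x ∘ₗ F - F ∘ₗ act P b x) (fun a b F => by ext; simp; abel)
    (fun c a F => by ext; simp [smul_sub]) (fun a F G => by ext; simp; abel)
    (fun c a F => by ext; simp [smul_sub])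

lemma coind_apply (x : A) (F : Poly K I →ₗ[K] M) (s : Poly K I) :
    coind P b τ x F s = τ x (F s) - F (act P b x s) := rfl

lemma coind_br (hτ : ∀ x y, τ (P.br x y) = τ x * τ y - τ y * τ x) (x y : A) :
    coind P b τ (P.br x y) = coind P b τ x * coind P b τ y - coind P b τ y * coind P b τ x := by
  refine LinearMap.ext fun F => LinearMap.ext fun s => ?_
  simp only [coind_apply, LinearMap.sub_apply, Module.End.mul_apply, hτ, act_br, map_sub]
  abel

/-! ### Filtration by polynomial degree and the Koszul homotopy -/

variable {j : ℕ}

/-- The alternating map with given coefficients. -/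
def ofCoeff (G : Multiset I → A [⋀^Fin j]→ₗ[K] M) : A [⋀^Fin j]→ₗ[K] (Poly K I →ₗ[K] M) :=
  (Finsupp.llift M K K (Multiset I)).toLinearMap.compAlternatingMap (AlternatingMap.pi G)

omit [LinearOrder I] in
lemma ofCoeff_mono (G : Multiset I → A [⋀^Fin j]→ₗ[K] M) (x : Fin j → A) (J : Multiset I) :
    ofCoeff G x (mono K J) = G J x := by
  simp [ofCoeff]

/-- Vanishing of all coefficients of degree less than `p`. -/
def Vanish (p : ℕ) (ω : A [⋀^Fin j]→ₗ[K] (Poly K I →ₗ[K] M)) : Prop :=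
  ∀ x (J : Multiset I), J.card < p → ω x (mono K J) = 0

variable {ω : A [⋀^Fin j]→ₗ[K] (Poly K I →ₗ[K] M)}

omit [LinearOrder I] in
lemma Vanish.apply {p n : ℕ} (h : Vanish p ω) (hn : n < p) (x : Fin j → A) {s : Poly K I}
    (hs : s ∈ degLE K I n) : ω x s = 0 :=
  degLE_induction (p := fun s => ω x s = 0) (_root_.map_zero _)
    (fun s t h1 h2 => by rw [map_add, h1, h2, add_zero])
    (fun c s h => by rw [map_smul, h, smul_zero]) (fun J hJ => h x J (hJ.trans_lt hn)) hs

/-- The terms with τ or with a bracket evaluate ω at s itself; only those with argument x_l·s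
survive. On leading coefficients this is the dual of the Koszul differential. -/
lemma ceD_apply_of_eq_zero (s : Poly K I) (h : ∀ y, ω y s = 0) (x : Fin (j + 1) → A) :
    P.ceD (coind P b τ) j ω x s =
      - ∑ l : Fin (j + 1), (-1 : ℤ) ^ (l : ℕ) • ω (l.removeNth x) (act P b (x l) s) := by
  have h1 : alternatizeUncurryFin (ceAct (coind P b τ) ω) x s =
      - ∑ l : Fin (j + 1), (-1 : ℤ) ^ (l : ℕ) • ω (l.removeNth x) (act P b (x l) s) := by
    simp [alternatizeUncurryFin_apply, ceAct_apply, coind_apply, h, LinearMap.sum_apply]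
  cases j with
  | zero => exact h1
  | succ j =>
    rw [ceD_succ, AlternatingMap.add_apply, LinearMap.add_apply, h1]
    simp [alternatizeUncurryFin_apply, contrBr, h, LinearMap.sum_apply]

lemma Vanish.ceD {p : ℕ} (h : Vanish (p + 1) ω) : Vanish p (P.ceD (coind P b τ) j ω) := by
  intro x J hJ
  rw [ceD_apply_of_eq_zero P b τ _ (fun y => h y J (by omega))]
  simp [h.apply (Nat.succ_lt_succ hJ) _ (act_mem_degLE P b _ (mono_mem_degLE le_rfl))]

/-- The Koszul homotopy. -/
def koszul (ω : A [⋀^Fin (j + 1)]→ₗ[K] (Poly K I →ₗ[K] M)) :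
    A [⋀^Fin j]→ₗ[K] (Poly K I →ₗ[K] M) :=
  ofCoeff fun J => - (J.map fun i =>
    (LinearMap.applyₗ (mono K (J.erase i))).compAlternatingMap (contr (b i) ω)).sum

lemma koszul_mono (ω : A [⋀^Fin (j + 1)]→ₗ[K] (Poly K I →ₗ[K] M)) (x : Fin j → A)
    (J : Multiset I) : koszul b ω x (mono K J) =
      - (J.map fun i => ω (Matrix.vecCons (b i) x) (mono K (J.erase i))).sum := by
  have h : ∀ s : Multiset (A [⋀^Fin j]→ₗ[K] M), s.sum x = (s.map fun f => f x).sum := fun s => by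
    induction s using Multiset.induction_on with
    | empty => simp
    | cons a s ih => simp [ih]
  rw [koszul, ofCoeff_mono, AlternatingMap.neg_apply, h, Multiset.map_map]
  rfl

lemma Vanish.koszul {p : ℕ} {ω : A [⋀^Fin (j + 1)]→ₗ[K] (Poly K I →ₗ[K] M)} (h : Vanish p ω) :
    Vanish (p + 1) (koszul b ω) := by
  intro x J hJ
  rw [koszul_mono, neg_eq_zero]
  refine Multiset.sum_eq_zero fun m hm => ?_
  obtain ⟨i, hi, rfl⟩ := Multiset.mem_map.1 hm
  refine h _ _ ?_
  have := Multiset.card_erase_lt_of_mem hi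
  omega

/-- The Koszul homotopy on a product of a vector with a monomial, for leading coefficients. -/
lemma koszul_act {p : ℕ} {ω : A [⋀^Fin (j + 1)]→ₗ[K] (Poly K I →ₗ[K] M)} (h : Vanish p ω)
    (x : A) (y : Fin j → A) (J : Multiset I) (hJ : J.card = p) :
    koszul b ω y (act P b x (mono K J)) = - (ω (Matrix.vecCons x y) (mono K J) +
      (J.map fun i => ω (Matrix.vecCons (b i) y) (act P b x (mono K (J.erase i)))).sum) := by
  have hk := h.koszul b
  have hadd : ∀ x x' : A, ω (Matrix.vecCons (x + x') y) =
      ω (Matrix.vecCons x y) + ω (Matrix.vecCons x' y) := fun x x' => ω.map_vecCons_add y x x'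
  have hsmul : ∀ (c : K) (x : A), ω (Matrix.vecCons (c • x) y) =
      c • ω (Matrix.vecCons x y) := fun c x => ω.map_vecCons_smul y c x
  induction x using basis_induction b with
  | h0 =>
    have := hsmul 0 0
    rw [zero_smul, zero_smul] at this
    simp [this]
  | ha x x' hx hx' =>
    simp only [map_add, LinearMap.add_apply, hadd, hx, hx', Multiset.sum_map_add]
    abel
  | hc c x hx =>
    simp only [map_smul, LinearMap.smul_apply, hsmul, hx, Multiset.smul_sum, Multiset.map_map,
      smul_neg, smul_add, Function.comp_def]
  | hb k =>
    -- Up to lower terms, which the vanishing kills, acting by `b k` multiplies by k. Removing one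
    -- factor of kJ removes either k itself or a factor of J.
    rw [← sub_add_cancel (act P b (b k) (mono K J)) (mono K (k ::ₘ J)), map_add,
      hk.apply (by omega : J.card < p + 1) _ (act_basis_mono_sub_mem P b k J), zero_add,
      koszul_mono, Multiset.map_cons, Multiset.sum_cons, Multiset.erase_cons_head]
    congr 3
    refine Multiset.map_congr rfl fun i hi => ?_
    have hlt := Multiset.card_erase_lt_of_mem hi
    rw [← sub_add_cancel (act P b (b k) (mono K (J.erase i))) (mono K (k ::ₘ J.erase i)), map_add,
      h.apply (by omega : (J.erase i).card < p) _ (act_basis_mono_sub_mem P b k _), zero_add]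
    congr 2
    exact Multiset.erase_cons_tail_of_mem hi

variable [CharZero K]

/-- The leading coefficients of the Koszul homotopy of a cocycle. -/
lemma ceD_koszul {p : ℕ} {ω : A [⋀^Fin (j + 1)]→ₗ[K] (Poly K I →ₗ[K] M)} (h : Vanish p ω)
    (hω : P.ceD (coind P b τ) (j + 1) ω = 0) (x : Fin (j + 1) → A) (J : Multiset I)
    (hJ : J.card = p) :
    P.ceD (coind P b τ) j (koszul b ω) x (mono K J) = ((p + j + 1 : ℕ) : K) • ω x (mono K J) := by
  -- Cartan's formula for the cocycle ω, contracted with `b i`, reads d(i_b ω) = L_b ω. At `J.erase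
  -- i`, where ω vanishes, the left side is minus this sum and the right side is -ω(x)(b·(J.erase
  -- i)), with leading monomial J.
  have hi : ∀ i ∈ J, ∑ l : Fin (j + 1), (-1 : ℤ) ^ (l : ℕ) •
      ω (Matrix.vecCons (b i) (l.removeNth x)) (act P b (x l) (mono K (J.erase i))) =
        ω x (mono K J) := by
    intro i hi
    have hlt := Multiset.card_erase_lt_of_mem hi
    have h0 : ∀ y, ω y (mono K (J.erase i)) = 0 := fun y => h y _ (by omega)
    have h1 := ceD_apply_of_eq_zero P b τ (ω := contr (b i) ω) (mono K (J.erase i))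
      (fun y => h0 _) x
    simp only [contr_apply] at h1
    have h2 := P.contr_ceD_succ (coind P b τ) j (b i) ω
    rw [hω, _root_.map_zero, eq_comm, sub_eq_zero] at h2
    rw [← h2] at h1
    have h3 : P.lieArg (j + 1) (b i) ω x (mono K (J.erase i)) = 0 := by
      simp [lieArg_succ, alternatizeUncurryFin_apply, contrBr_apply, LinearMap.sum_apply, h0]
    rw [lieDer_apply, AlternatingMap.sub_apply, LinearMap.sub_apply, h3, sub_zero,
      LinearMap.compAlternatingMap_apply, coind_apply, h0, _root_.map_zero, zero_sub, neg_inj] at h1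
    rw [← h1, ← sub_add_cancel (act P b (b i) (mono K (J.erase i)))
      (mono K (i ::ₘ J.erase i)), map_add,
      h.apply (by omega : (J.erase i).card < p) _ (act_basis_mono_sub_mem P b i _), zero_add,
      Multiset.cons_erase hi]
  rw [ceD_apply_of_eq_zero P b τ _ (fun y => h.koszul b y J (by omega))]
  simp only [koszul_act P b h _ _ J hJ, smul_neg, Finset.sum_neg_distrib, neg_neg, smul_add,
    Finset.sum_add_distrib]
  -- The Euler identity: the j + 1 arguments of ω contribute here, the p factors of J in `e2`.
  have e1 : ∑ l : Fin (j + 1), (-1 : ℤ) ^ (l : ℕ) •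
      ω (Matrix.vecCons (x l) (l.removeNth x)) (mono K J) = (j + 1) • ω x (mono K J) := by
    have h1 := congrArg (fun f : A [⋀^Fin (j + 1)]→ₗ[K] (Poly K I →ₗ[K] M) => f x (mono K J))
      (alternatizeUncurryFin_curryLeft ω)
    rw [alternatizeUncurryFin_apply, LinearMap.sum_apply] at h1
    exact h1
  have e2 : ∑ l : Fin (j + 1), (-1 : ℤ) ^ (l : ℕ) • (J.map fun i =>
      ω (Matrix.vecCons (b i) (l.removeNth x)) (act P b (x l) (mono K (J.erase i)))).sum =
      p • ω x (mono K J) := by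
    simp only [Multiset.smul_sum, Multiset.map_map, Function.comp_def]
    rw [← hJ, ← Multiset.sum_replicate, ← Multiset.map_const',
      ← Multiset.map_congr rfl hi]
    exact (Multiset.sum_map_sum_map _ _)
  rw [e1, e2, ← add_smul, Nat.cast_smul_eq_nsmul]
  congr 1
  ring

/-- Successive corrections of a cocycle. -/
def corr (ω : A [⋀^Fin (j + 1)]→ₗ[K] (Poly K I →ₗ[K] M)) :
    ℕ → A [⋀^Fin (j + 1)]→ₗ[K] (Poly K I →ₗ[K] M)
  | 0 => ω
  | p + 1 => corr ω p -
      P.ceD (coind P b τ) j (((p + j + 1 : ℕ) : K)⁻¹ • koszul b (corr ω p))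

variable (hτ : ∀ x y, τ (P.br x y) = τ x * τ y - τ y * τ x)
include hτ

lemma corr_spec (ω : A [⋀^Fin (j + 1)]→ₗ[K] (Poly K I →ₗ[K] M))
    (hω : P.ceD (coind P b τ) (j + 1) ω = 0) (p : ℕ) :
    P.ceD (coind P b τ) (j + 1) (corr P b τ ω p) = 0 ∧ Vanish p (corr P b τ ω p) := by
  induction p with
  | zero => exact ⟨hω, fun x J h => absurd h (Nat.not_lt_zero _)⟩
  | succ p ih =>
    refine ⟨?_, fun x J hJ => ?_⟩
    · rw [corr, map_sub, ih.1, ceD_ceD P _ (coind_br P b τ hτ), sub_zero]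
    · rw [corr, AlternatingMap.sub_apply, LinearMap.sub_apply, map_smul,
        AlternatingMap.smul_apply, LinearMap.smul_apply]
      rcases Nat.lt_or_ge J.card p with h | h
      · rw [ih.2 x J h, (ih.2.koszul b).ceD P b τ x J h, smul_zero, sub_zero]
      · rw [ceD_koszul P b τ ih.2 ih.1 x J (by omega), smul_smul,
          inv_mul_cancel₀ (Nat.cast_ne_zero.2 (by omega)), one_smul, sub_self]

/-- The Chevalley–Eilenberg cohomology of `Hom(S(A), M)` vanishes in positive degrees. -/
theorem exists_ceD_eq (ω : A [⋀^Fin (j + 1)]→ₗ[K] (Poly K I →ₗ[K] M))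
    (hω : P.ceD (coind P b τ) (j + 1) ω = 0) : ∃ η, P.ceD (coind P b τ) j η = ω := by
  let η : ℕ → A [⋀^Fin j]→ₗ[K] (Poly K I →ₗ[K] M) := fun p =>
    ((p + j + 1 : ℕ) : K)⁻¹ • koszul b (corr P b τ ω p)
  have hη : ∀ p, Vanish (p + 1) (η p) := fun p x J hJ => by
    rw [AlternatingMap.smul_apply, LinearMap.smul_apply,
      (corr_spec P b τ hτ ω hω p).2.koszul b x J hJ, smul_zero]
  have hsum : ∀ q, ∑ p ∈ Finset.range q, P.ceD (coind P b τ) j (η p) = ω - corr P b τ ω q := by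
    intro q
    induction q with
    | zero => simp [corr]
    | succ q ih => rw [Finset.sum_range_succ, ih, corr]; abel
  -- The infinite sum of all `η p`; on a monomial J only the terms with p less than the degree of J
  -- are nonzero.
  let ζ : A [⋀^Fin j]→ₗ[K] (Poly K I →ₗ[K] M) := ofCoeff fun J =>
    ∑ p ∈ Finset.range J.card, (LinearMap.applyₗ (mono K J)).compAlternatingMap (η p)
  have hζ : ∀ x J, ζ x (mono K J) = ∑ p ∈ Finset.range J.card, η p x (mono K J) := fun x J => by
    rw [ofCoeff_mono, finset_sum_apply]
    rfl
  have hv : ∀ q, Vanish (q + 1) (ζ - ∑ p ∈ Finset.range q, η p) := fun q x J hJ => by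
    rw [AlternatingMap.sub_apply, LinearMap.sub_apply, hζ, finset_sum_apply,
      LinearMap.sum_apply, sub_eq_zero]
    refine Finset.sum_subset (Finset.range_mono (by omega)) fun p _ hp => hη p x J ?_
    rw [Finset.mem_range] at hp
    omega
  refine ⟨ζ, AlternatingMap.ext fun x => Finsupp.lhom_ext' fun J => LinearMap.ext_ring ?_⟩
  -- The differential looks one degree further, so J.card + 1 terms are enough to compare
  -- differentials on J.
  have h1 := (hv (J.card + 1)).ceD P b τ x J (Nat.lt_succ_self _)
  have h2 := (corr_spec P b τ hτ ω hω (J.card + 1)).2 x J (Nat.lt_succ_self _)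
  rw [map_sub, map_sum, hsum, AlternatingMap.sub_apply, LinearMap.sub_apply,
    AlternatingMap.sub_apply, LinearMap.sub_apply, h2, sub_zero, sub_eq_zero] at h1
  exact h1

end PBW

end PoissonBracket

/-! ### The quasi-Poisson complex with coefficients -/

/-- Composition of multilinear maps with a linear map, as a linear map. -/
def HCoch.map {K A M M' : Type u} [Field K] [Ring A] [Algebra K A] [AddCommGroup M] [Module K M]
    [AddCommGroup M'] [Module K M'] (φ : M →ₗ[K] M') (i : ℕ) :
    HCoch K A M i →ₗ[K] HCoch K A M' i where
  toFun f := φ.compMultilinearMap f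
  map_add' f g := by ext; simp
  map_smul' c f := by ext; simp

/-- Over a field, d has a linear section on its range, and it extends to V. Composing ω with the
extension chooses primitives linearly, so the result is still alternating. -/
lemma LinearMap.exists_compAlternatingMap_eq {K A U V W : Type*} [Field K] [AddCommGroup A]
    [Module K A] [AddCommGroup U] [Module K U] [AddCommGroup V] [Module K V] [AddCommGroup W]
    [Module K W] {ι : Type*} (d : U →ₗ[K] V) (d' : V →ₗ[K] W)
    (h : ∀ v, d' v = 0 → ∃ u, d u = v) (ω : A [⋀^ι]→ₗ[K] V)
    (hω : d'.compAlternatingMap ω = 0) : ∃ η : A [⋀^ι]→ₗ[K] U, d.compAlternatingMap η = ω := by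
  obtain ⟨s, hs⟩ := d.rangeRestrict.exists_rightInverse_of_surjective d.range_rangeRestrict
  obtain ⟨p, hp⟩ := s.exists_extend
  refine ⟨p.compAlternatingMap ω, AlternatingMap.ext fun x => ?_⟩
  have hx : ω x ∈ LinearMap.range d := h _ (DFunLike.congr_fun hω x)
  have h1 : p (ω x) = s ⟨ω x, hx⟩ := LinearMap.congr_fun hp ⟨ω x, hx⟩
  have h2 : d.rangeRestrict (s ⟨ω x, hx⟩) = ⟨ω x, hx⟩ := LinearMap.congr_fun hs _
  change d (p (ω x)) = ω x
  rw [h1]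
  exact congrArg Subtype.val h2

namespace PoissonBracket

open DoubleComplex GradedDiff

variable {K A : Type u} [Field K] [Ring A] [Algebra K A]

/-- `Hom(A^{⊗ i} ⊗ ⋀ʲ A, M)`. -/
abbrev BiCoch (K A M : Type u) [Field K] [Ring A] [Algebra K A] [AddCommGroup M] [Module K M]
    (i j : ℕ) : Type u :=
  A [⋀^Fin j]→ₗ[K] HCoch K A M i

namespace Rep

variable {P : PoissonBracket K A} {M M' N : Type u} [AddCommGroup M] [Module K M]
  [AddCommGroup M'] [Module K M'] [AddCommGroup N] [Module K N] (R : Rep P M) (R' : Rep P M')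
  (T : Rep P N)

/-- The Hochschild differential on `Hom(A^{⊗ i} ⊗ ⋀ʲ A, M)`. -/
def dV (i j : ℕ) : BiCoch K A M i j →ₗ[K] BiCoch K A M (i + 1) j :=
  (R.hochD i).compAlternatingMapₗ K

/-- The Chevalley–Eilenberg differential on `Hom(A^{⊗ i} ⊗ ⋀ʲ A, M)`. -/
def dH (i j : ℕ) : BiCoch K A M i j →ₗ[K] BiCoch K A M i (j + 1) :=
  P.ceD (R.cochRep i) j

lemma dV_dV (i j : ℕ) (x : BiCoch K A M i j) : R.dV (i + 1) j (R.dV i j x) = 0 :=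
  AlternatingMap.ext fun _ => R.hochD_hochD _

lemma exists_dV (i j : ℕ) (h : ∀ f, R.hochD (i + 1) f = 0 → ∃ g, R.hochD i g = f)
    (x : BiCoch K A M (i + 1) j) (hx : R.dV (i + 1) j x = 0) : ∃ y, R.dV i j y = x :=
  LinearMap.exists_compAlternatingMap_eq (A := A) (R.hochD i) (R.hochD (i + 1)) h x hx

lemma dH_dH [CharZero K] (i j : ℕ) (x : BiCoch K A M i j) : R.dH i (j + 1) (R.dH i j x) = 0 :=
  P.ceD_ceD _ (fun _ _ => R.cochRep_lie _ _) j x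

lemma dH_dV (i j : ℕ) (x : BiCoch K A M i j) :
    R.dH (i + 1) j (R.dV i j x) = R.dV i (j + 1) (R.dH i j x) :=
  (P.compAlternatingMap_ceD (R.cochRep i) (R.cochRep (i + 1)) (R.hochD i)
    (fun y f => R.hochD_cochRep y f) j x).symm

/-- The families of cochains with coefficients in `M`. -/
abbrev _root_.BiFam (K A M : Type u) [Field K] [Ring A] [Algebra K A] [AddCommGroup M]
    [Module K M] : Type u := (i j : ℕ) → BiCoch K A M i j

/-- The total differential. -/
def diff : BiFam K A M →ₗ[K] BiFam K A M := tot R.dV R.dH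

lemma diff_diff [CharZero K] (f : BiFam K A M) : R.diff (R.diff f) = 0 :=
  tot_tot R.dV_dV R.dH_dH R.dH_dV f

/-- The cocycles with coefficients in `M`. -/
abbrev Z (n : ℕ) : Submodule K (BiFam K A M) := cyc (total K (BiCoch K A M)) R.diff n

/-- The coboundaries with coefficients in `M`. -/
abbrev B (n : ℕ) : Submodule K (BiFam K A M) := bdry (total K (BiCoch K A M)) R.diff n

/-- The map on cochains induced by a linear map of coefficients. -/
def mapCoch (φ : M →ₗ[K] M') : BiFam K A M →ₗ[K] BiFam K A M' :=
  mapFam fun i _ => (HCoch.map φ i).compAlternatingMapₗ K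

lemma mapCoch_apply (φ : M →ₗ[K] M') (f : BiFam K A M) (i j : ℕ) (x : Fin j → A)
    (a : Fin i → A) : mapCoch φ f i j x a = φ (f i j x a) := rfl

lemma ext_fam {f g : BiFam K A M} (h : ∀ i j x a, f i j x a = g i j x a) : f = g :=
  funext fun i => funext fun j => AlternatingMap.ext fun x => MultilinearMap.ext fun a => h i j x a

variable {R R'}

lemma IsHom.diff {φ : M →ₗ[K] M'} (h : IsHom R R' φ) (f : BiFam K A M) :
    mapCoch φ (R.diff f) = R'.diff (mapCoch φ f) :=
  mapFam_tot _ (fun _ _ _ => AlternatingMap.ext fun _ => h.hochD _)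
    (fun i j x => P.compAlternatingMap_ceD (R.cochRep i) (R'.cochRep i) (HCoch.map φ i)
      (fun y f => h.cochRep y f) j x) f

/-- Vanishing of cohomology passes to retracts. -/
lemma Z_le_B_of_retract {φ : M →ₗ[K] M'} {ψ : M' →ₗ[K] M} (hφ : IsHom R R' φ)
    (hψ : IsHom R' R ψ) (h : ∀ m, ψ (φ m) = m) (n : ℕ) (hn : R'.Z (n + 1) ≤ R'.B (n + 1)) :
    R.Z (n + 1) ≤ R.B (n + 1) := by
  intro f hf
  obtain ⟨g, hg, hgf⟩ := hn (show mapCoch φ f ∈ R'.Z (n + 1) from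
    ⟨mapFam_mem_total _ _ _ hf.1, by
      have h0 : R.diff f = 0 := hf.2
      rw [SetLike.mem_coe, LinearMap.mem_ker, ← hφ.diff, h0, map_zero]⟩)
  refine ⟨mapCoch ψ g, mapFam_mem_total _ _ _ hg, ?_⟩
  rw [← hψ.diff, hgf]
  exact ext_fam fun i j x a => h _

variable (R R')

/-! ### Coinduced representations -/

/-- The representation `Hom(S(A), M)`. -/
def coindPoly {I : Type u} [LinearOrder I] (b : Module.Basis I K A) :
    Rep P (PBW.Poly K I →ₗ[K] M) where
  l := LinearMap.mk₂ K (fun a F => R.l a ∘ₗ F) (fun a b F => by ext; simp)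
    (fun c a F => by ext; simp) (fun a F G => by ext; simp) (fun c a F => by ext; simp)
  r := LinearMap.mk₂ K (fun a F => R.r a ∘ₗ F) (fun a b F => by ext; simp)
    (fun c a F => by ext; simp) (fun a F G => by ext; simp) (fun c a F => by ext; simp)
  ρ := PBW.coind P b R.ρ
  l_mul a b F := by ext; simp [R.l_mul]
  r_mul a b F := by ext; simp [R.r_mul]
  l_r a b F := by ext; simp [R.l_r]
  ρ_br x y F := by rw [PBW.coind_br P b R.ρ R.ρ_lie]; rfl
  ρ_l x a F := LinearMap.ext fun s => by
    simp only [LinearMap.mk₂_apply, PBW.coind_apply, LinearMap.comp_apply, LinearMap.add_apply,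
      R.ρ_l, map_sub]
    abel
  ρ_r x a F := LinearMap.ext fun s => by
    simp only [LinearMap.mk₂_apply, PBW.coind_apply, LinearMap.comp_apply, LinearMap.add_apply,
      R.ρ_r, map_sub]
    abel

/-- The embedding of a representation `M` into `Hom(S(A), M)`. -/
def toCoindPoly (I : Type u) : M →ₗ[K] PBW.Poly K I →ₗ[K] M :=
  LinearMap.mk₂ K (fun m s => s 0 • m) (fun a b F => by simp)
    (fun c a F => by simp [smul_comm c]) (fun a F G => by simp [add_smul])
    (fun c a F => by simp [mul_smul])

lemma toCoindPoly_apply (I : Type u) (m : M) (s : PBW.Poly K I) :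
    toCoindPoly (K := K) I m s = s 0 • m := rfl

lemma isHom_toCoindPoly {I : Type u} [LinearOrder I] (b : Module.Basis I K A) :
    IsHom R (R.coindPoly b) (toCoindPoly I) where
  l a m := LinearMap.ext fun s => by simp [toCoindPoly_apply, coindPoly]
  r a m := LinearMap.ext fun s => by simp [toCoindPoly_apply, coindPoly]
  ρ a m := LinearMap.ext fun s => by
    simp [toCoindPoly_apply, coindPoly, PBW.coind_apply, PBW.act_apply_zero]

/-- The representation `Hom(A, N)` coinduced from a left module structure. -/
def coindA : Rep P (A →ₗ[K] N) where
  l := LinearMap.mk₂ K (fun a F => T.l a ∘ₗ F) (fun a b F => by ext; simp)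
    (fun c a F => by ext; simp) (fun a F G => by ext; simp) (fun c a F => by ext; simp)
  r := LinearMap.mk₂ K (fun a F => F ∘ₗ LinearMap.mul K A a) (fun a b F => by ext; simp)
    (fun c a F => by ext; simp) (fun a F G => by ext; simp) (fun c a F => by ext; simp)
  ρ := LinearMap.mk₂ K (fun x F => T.ρ x ∘ₗ F - F ∘ₗ P.br x) (fun a b F => by ext; simp; abel)
    (fun c a F => by ext; simp [smul_sub]) (fun a F G => by ext; simp; abel)
    (fun c a F => by ext; simp [smul_sub])
  l_mul a b F := by ext; simp [T.l_mul]
  r_mul a b F := by ext; simp [mul_assoc]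
  l_r a b F := by ext; simp
  ρ_br x y F := by ext z; simp [T.ρ_br, P.jacobi x y z]; abel
  ρ_l x y F := by ext z; simp [T.ρ_l]; abel
  ρ_r x y F := by ext z; simp [P.leibniz]; abel

/-- The embedding of a representation `N` into `Hom(A, N)`. -/
def toCoindA : N →ₗ[K] A →ₗ[K] N := T.r.flip

lemma isHom_toCoindA : IsHom T T.coindA T.toCoindA where
  l a m := LinearMap.ext fun s => by simp [toCoindA, coindA, T.l_r]
  r a m := LinearMap.ext fun s => by simp [toCoindA, coindA, T.r_mul]
  ρ a m := LinearMap.ext fun s => by simp [toCoindA, coindA, T.ρ_r]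

/-- The Hochschild complex with coefficients in `Hom(A, N)` is exact in positive degrees. -/
lemma exists_hochD_coindA (i : ℕ) (f : HCoch K A (A →ₗ[K] N) (i + 1))
    (hf : T.coindA.hochD (i + 1) f = 0) : ∃ g, T.coindA.hochD i g = f := by
  let S : (A →ₗ[K] A →ₗ[K] N) →ₗ[K] A →ₗ[K] N := LinearMap.applyₗ (1 : A) ∘ₗ LinearMap.lflip.toLinearMap
  have hS : ∀ G b, S G b = G b 1 := fun G b => rfl
  -- The contracting homotopy: g(a)(b) = ± f(a, b)(1).
  refine ⟨(-1 : K) ^ (i + 1) • S.compMultilinearMap f.curryRight, ?_⟩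
  ext a b
  -- In the cocycle identity at 1, the right action by b turns evaluation at 1 into evaluation at b,
  -- so the last term recovers f(a)(b).
  have h : T.coindA.hochD (i + 1) f (Fin.snoc a b : Fin (i + 2) → A) 1 = 0 := by rw [hf]; rfl
  have hr : ∀ F : A →ₗ[K] N, T.coindA.r b F 1 = F b := fun F => by simp [coindA]
  have hl : ∀ a (F : A →ₗ[K] N) b, T.coindA.l a F b = T.l a (F b) := fun a F b => rfl
  have hr' : ∀ a (F : A →ₗ[K] N) b, T.coindA.r a F b = F (a * b) := fun a F b => rfl
  rw [hochD_snoc] at h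
  simp only [LinearMap.add_apply, LinearMap.sub_apply, LinearMap.smul_apply, LinearMap.sum_apply,
    hl, hr, smul_sub] at h
  rw [map_smul, smul_apply, LinearMap.smul_apply, hochD_apply]
  simp only [LinearMap.add_apply, LinearMap.smul_apply, LinearMap.sum_apply, hl, hr',
    LinearMap.compMultilinearMap_apply, hS,
    MultilinearMap.curryRight_apply]
  rw [← sub_eq_zero]
  have h1 : ((-1 : K) ^ (i + 1)) * (-1) ^ (i + 1) = 1 := by
    rw [← mul_pow]; simp
  have h2 := congrArg (fun z => (-1 : K) ^ (i + 1) • z) h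
  simp only [smul_zero] at h2
  rw [← h2]
  simp only [smul_add, smul_sub, smul_smul, h1, one_smul]
  abel

variable [CharZero K]

/-- The total complex with coefficients in a coinduced representation is exact in positive
degrees. -/
theorem Z_le_B_coind {I : Type u} [LinearOrder I] (b : Module.Basis I K A) (n : ℕ) :
    (R.coindPoly b).coindA.Z (n + 1) ≤ (R.coindPoly b).coindA.B (n + 1) := by
  set T := R.coindPoly b with hT
  intro f hf
  -- Hochschild exactness allows truncation at k = 0: only the component with i = 0 survives.
  obtain ⟨e, he, hfe⟩ := exists_truncation T.coindA.dV_dV T.coindA.dH_dH T.coindA.dH_dV 0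
    (fun i j _ x hx => T.coindA.exists_dV i j (T.exists_hochD_coindA i) x hx)
    (n + 1) f hf
  have hB := bdry_le_cyc (C := total K (BiCoch K A (A →ₗ[K] PBW.Poly K I →ₗ[K] M)))
    (tot_mem_total T.coindA.dV T.coindA.dH) T.coindA.diff_diff (n + 1)
  obtain ⟨g, hg⟩ : ∃ g, f - e = g := ⟨_, rfl⟩
  have hgZ : g ∈ T.coindA.Z (n + 1) := hg ▸ sub_mem hf (hB he)
  rw [hg] at hfe
  suffices hgB : g ∈ T.coindA.B (n + 1) by
    rw [← sub_add_cancel f e, hg]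
    exact add_mem hgB he
  clear_value T
  -- A Hochschild 0-cocycle m satisfies m(a) = a·m(1), so θ' recovers it from its value θ m at 1.
  -- Both maps are equivariant and carry the remaining problem to Hom(S(A), M).
  let θ : HCoch K A (A →ₗ[K] PBW.Poly K I →ₗ[K] M) 0 →ₗ[K] PBW.Poly K I →ₗ[K] M :=
    { toFun := fun m => m Fin.elim0 1
      map_add' := fun _ _ => rfl
      map_smul' := fun _ _ => rfl }
  let θ' : (PBW.Poly K I →ₗ[K] M) →ₗ[K] HCoch K A (A →ₗ[K] PBW.Poly K I →ₗ[K] M) 0 :=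
    { toFun := fun ν => MultilinearMap.constOfIsEmpty K (fun _ : Fin 0 => A) (T.l.flip ν)
      map_add' := fun ν ν' => by ext; simp
      map_smul' := fun c ν => by ext; simp }
  have hθ'a : ∀ ν a, θ' ν a = T.l.flip ν := fun ν a => rfl
  have hbr : ∀ x, P.br x 1 = 0 := fun x => by simpa using P.leibniz x 1 1
  have hθ : ∀ x m, θ (T.coindA.cochRep 0 x m) = T.ρ x (θ m) := fun x m => by
    change T.coindA.cochRep 0 x m Fin.elim0 1 = T.ρ x (m Fin.elim0 1)
    rw [cochRep_zero]
    simp [coindA, hbr]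
  have hθ' : ∀ x ν, θ' (T.ρ x ν) = T.coindA.cochRep 0 x (θ' ν) := fun x ν => by
    refine MultilinearMap.ext fun a => LinearMap.ext fun y => ?_
    rw [cochRep_zero, hθ'a, hθ'a]
    simp [coindA, T.ρ_l]
  have hdθ' : ∀ ν, T.coindA.hochD 0 (θ' ν) = 0 := fun ν => by
    refine MultilinearMap.ext fun a => LinearMap.ext fun y => ?_
    simp [hochD_apply, hθ'a, coindA, T.l_mul]
  have hinv : ∀ m, T.coindA.hochD 0 m = 0 → θ' (θ m) = m := fun m hm => by
    refine MultilinearMap.ext fun a => LinearMap.ext fun y => ?_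
    have h := LinearMap.congr_fun (DFunLike.congr_fun hm fun _ => y) 1
    obtain rfl : a = Fin.elim0 := Subsingleton.elim _ _
    obtain ⟨m', hm'⟩ : ∃ m', ∀ b, m b = m' := ⟨m Fin.elim0, fun b => congrArg m
      (Subsingleton.elim _ _)⟩
    simp [hochD_apply, hm', coindA, ← sub_eq_add_neg, sub_eq_zero] at h
    rw [hθ'a]
    change T.l y (m Fin.elim0 1) = _
    rw [hm']
    exact h
  have hgk : ∀ i j, 0 < i → g i j = 0 := hfe
  have hdH : P.ceD (A := A) (N := HCoch K A (A →ₗ[K] PBW.Poly K I →ₗ[K] M) 0)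
      (T.coindA.cochRep 0) (n + 1) (g 0 (n + 1)) = 0 := by
    have h : T.coindA.diff g 0 (n + 2) = 0 := congrFun (congrFun hgZ.2 0) (n + 2)
    exact h
  have hdV : ∀ x, T.coindA.hochD 0 (g 0 (n + 1) x) = 0 := fun x => by
    have h : T.coindA.diff g 1 (n + 1) = 0 := congrFun (congrFun hgZ.2 1) (n + 1)
    rw [diff, tot_succ_succ, hgk (0 + 1) n (by omega), map_zero, smul_zero, add_zero] at h
    exact DFunLike.congr_fun h x
  obtain ⟨η, hη⟩ := PBW.exists_ceD_eq P b R.ρ R.ρ_lie (θ.compAlternatingMap (g 0 (n + 1))) (by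
    have := P.compAlternatingMap_ceD (A := A) (N := HCoch K A (A →ₗ[K] PBW.Poly K I →ₗ[K] M) 0)
      (N' := PBW.Poly K I →ₗ[K] M) (T.coindA.cochRep 0) T.ρ θ hθ (n + 1) (g 0 (n + 1))
    rw [hdH, hT] at this
    change P.ceD (R.coindPoly b).ρ (n + 1) _ = 0
    rw [← this]
    exact AlternatingMap.ext fun x => map_zero θ)
  have hθ'η : P.ceD (A := A) (N := HCoch K A (A →ₗ[K] PBW.Poly K I →ₗ[K] M) 0)
      (T.coindA.cochRep 0) n (θ'.compAlternatingMap η) = g 0 (n + 1) := by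
    rw [← P.compAlternatingMap_ceD (A := A) (N := PBW.Poly K I →ₗ[K] M)
      (N' := HCoch K A (A →ₗ[K] PBW.Poly K I →ₗ[K] M) 0) T.ρ _ θ' hθ', hT]
    rw [show P.ceD (R.coindPoly b).ρ n η = _ from hη]
    exact AlternatingMap.ext fun x => hinv _ (hdV x)
  let c : BiFam K A (A →ₗ[K] PBW.Poly K I →ₗ[K] M) := fun i j => match i with
    | 0 => if h : n = j then h ▸ θ'.compAlternatingMap η else 0
    | _ + 1 => 0
  have hc0 : c 0 n = θ'.compAlternatingMap η := by simp [c]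
  have hc1 : ∀ j, n ≠ j → c 0 j = 0 := fun j hj => by simp [c, hj]
  have hc2 : ∀ i j, c (i + 1) j = 0 := fun i j => rfl
  have hcV : ∀ i j, T.coindA.dV i j (c i j) = 0 := fun i j => by
    cases i with
    | succ i => rw [hc2, map_zero]
    | zero =>
      by_cases hj : n = j
      · subst hj
        rw [hc0]
        exact AlternatingMap.ext fun x => hdθ' _
      · rw [hc1 j hj, map_zero]
  refine ⟨c, fun i j hij => ?_, ?_⟩
  · cases i with
    | succ i => rfl
    | zero => exact hc1 j (by omega)
  · funext i j
    rcases i with _ | i <;> rcases j with _ | j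
    · rw [diff, tot_zero_zero, hgZ.1 0 0 (by omega)]
    · rw [diff, tot_zero_succ]
      by_cases hj : n = j
      · subst hj
        rw [hc0]
        exact hθ'η
      · rw [hc1 j hj, map_zero, hgZ.1 0 (j + 1) (by omega)]
    · rw [diff, tot_succ_zero, hcV, hgk _ _ (by omega)]
    · rw [diff, tot_succ_succ, hcV, hc2, map_zero, smul_zero, add_zero, hgk _ _ (by omega)]

end Rep

end PoissonBracket

/-! ### Modules over the quasi-Poisson enveloping algebra -/

namespace PoissonBracket

variable {K A : Type u} [Field K] [Ring A] [Algebra K A] (P : PoissonBracket K A)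

lemma smash_add_left (b c : A ⊗[K] Aᵐᵒᵖ) (u : P.U) :
    P.smash (b + c) u = P.smash b u + P.smash c u := TensorProduct.add_tmul _ _ _

lemma smash_one_mul (b c : A ⊗[K] Aᵐᵒᵖ) (u : P.U) :
    P.smash b 1 * P.smash c u = P.smash (b * c) u := by
  change P.mulQ _ _ = _
  rw [mulQ_smash, map_one, mul_one, envMul_smash]

lemma one_smash_mul (u v : P.U) : P.smash 1 u * P.smash 1 v = P.smash 1 (u * v) := by
  change P.mulQ _ _ = _
  rw [mulQ_smash, map_one, one_mul, diagMul_one]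

lemma one_smash_toU_mul (x : A) (c : A ⊗[K] Aᵐᵒᵖ) (u : P.U) :
    P.smash 1 (P.toU x) * P.smash c u =
      P.smash (P.envAct (P.toU x) c) u + P.smash c (P.toU x * u) := by
  change P.mulQ _ _ = _
  rw [mulQ_smash, map_one, one_mul, diagMul_toU_smash]

lemma smash_one_mul_one_smash (b : A ⊗[K] Aᵐᵒᵖ) (u : P.U) :
    P.smash b 1 * P.smash 1 u = P.smash b u := by rw [smash_one_mul, mul_one]

/-- The element of `Q(A)` acting as left multiplication by `a`. -/
def qL : A →ₗ[K] P.Q where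
  toFun a := P.smash (a ⊗ₜ 1) 1
  map_add' a b := by rw [TensorProduct.add_tmul, smash_add_left]
  map_smul' c a := by
    rw [RingHom.id_apply, ← TensorProduct.smul_tmul']; exact TensorProduct.smul_tmul' _ _ _ |>.symm

/-- The element of `Q(A)` acting as right multiplication by `a`. -/
def qR : A →ₗ[K] P.Q where
  toFun a := P.smash (1 ⊗ₜ MulOpposite.op a) 1
  map_add' a b := by rw [MulOpposite.op_add, TensorProduct.tmul_add, smash_add_left]
  map_smul' c a := by
    rw [RingHom.id_apply, MulOpposite.op_smul, TensorProduct.tmul_smul]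
    exact TensorProduct.smul_tmul' _ _ _ |>.symm

/-- The element of `Q(A)` acting as the bracket with `x`. -/
def qU : A →ₗ[K] P.Q where
  toFun x := P.smash 1 (P.toU x)
  map_add' a b := by rw [map_add, smash_add]
  map_smul' c a := by rw [map_smul, smash_smul]; rfl

lemma qL_apply (a : A) : P.qL a = P.smash (a ⊗ₜ 1) 1 := rfl
lemma qR_apply (a : A) : P.qR a = P.smash (1 ⊗ₜ MulOpposite.op a) 1 := rfl
lemma qU_apply (a : A) : P.qU a = P.smash 1 (P.toU a) := rfl

lemma qL_mul (a b : A) : P.qL (a * b) = P.qL a * P.qL b := by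
  rw [qL_apply, qL_apply, qL_apply, smash_one_mul, Algebra.TensorProduct.tmul_mul_tmul, one_mul]

lemma qR_mul (a b : A) : P.qR (a * b) = P.qR b * P.qR a := by
  rw [qR_apply, qR_apply, qR_apply, smash_one_mul, Algebra.TensorProduct.tmul_mul_tmul, one_mul,
    MulOpposite.op_mul]

lemma qL_mul_qR (a b : A) : P.qL a * P.qR b = P.smash (a ⊗ₜ MulOpposite.op b) 1 := by
  rw [qL_apply, qR_apply, smash_one_mul, Algebra.TensorProduct.tmul_mul_tmul, one_mul, mul_one]

lemma qL_qR_comm (a b : A) : P.qL a * P.qR b = P.qR b * P.qL a := by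
  rw [qL_mul_qR, qL_apply, qR_apply, smash_one_mul, Algebra.TensorProduct.tmul_mul_tmul, one_mul,
    mul_one]

lemma qU_br (x y : A) : P.qU (P.br x y) = P.qU x * P.qU y - P.qU y * P.qU x := by
  rw [qU_apply, qU_apply, qU_apply, one_smash_mul, one_smash_mul, toU_br]
  exact TensorProduct.tmul_sub _ _ _

lemma br_one (x : A) : P.br x 1 = 0 := by simpa using P.leibniz x 1 1

lemma qU_qL (x a : A) : P.qU x * P.qL a = P.qL (P.br x a) + P.qL a * P.qU x := by
  rw [qU_apply, qL_apply, qL_apply, one_smash_toU_mul, smash_one_mul_one_smash, envAct_toU,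
    MulOpposite.unop_one, br_one, MulOpposite.op_zero, TensorProduct.tmul_zero, add_zero, mul_one]

lemma qU_qR (x a : A) : P.qU x * P.qR a = P.qR (P.br x a) + P.qR a * P.qU x := by
  rw [qU_apply, qR_apply, qR_apply, one_smash_toU_mul, smash_one_mul_one_smash, envAct_toU,
    MulOpposite.unop_op, br_one, TensorProduct.zero_tmul, zero_add, mul_one]

/-- `Q(A)` is generated by the elements `qL a`, `qR a` and `qU a`. -/
lemma Q_gen_induction {p : P.Q → Prop} (h1 : p 1) (hsmul : ∀ (c : K) x, p x → p (c • x))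
    (hadd : ∀ x y, p x → p y → p (x + y)) (hmul : ∀ x y, p x → p y → p (x * y))
    (hL : ∀ a, p (P.qL a)) (hR : ∀ a, p (P.qR a)) (hU : ∀ a, p (P.qU a)) (q : P.Q) : p q := by
  have h0 : p 0 := by simpa using hsmul 0 1 h1
  have hb : ∀ b, p (P.smash b 1) := fun b => by
    induction b with
    | zero => rw [zero_smash]; exact h0
    | add b c hb hc => rw [smash_add_left]; exact hadd _ _ hb hc
    | tmul a b =>
      have := hmul _ _ (hL a) (hR b.unop)
      rwa [qL_mul_qR, MulOpposite.op_unop] at this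
  have hu : ∀ u, p (P.smash 1 u) := fun u => by
    induction u using P.U_induction with
    | h1 c => rw [Algebra.algebraMap_eq_smul_one, smash_smul]; exact hsmul c _ h1
    | hx x => exact hU x
    | hadd u v hu hv => rw [smash_add]; exact hadd _ _ hu hv
    | hmul u v hu hv => rw [← one_smash_mul]; exact hmul _ _ hu hv
  induction q using P.Q_induction with
  | h0 => exact h0
  | ht b u => rw [← smash_one_mul_one_smash]; exact hmul _ _ (hb b) (hu u)
  | ha x y hx hy => exact hadd x y hx hy

variable {P}

namespace Rep

variable {M M' : Type u} [AddCommGroup M] [Module K M] [AddCommGroup M'] [Module K M']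

section Modules

variable [Module P.Q M] [Module P.Q M'] (R : Rep P M) (R' : Rep P M')

/-- The representation `R` is the one underlying the `Q(A)`-module structure. -/
structure Underlies : Prop where
  l : ∀ a m, R.l a m = P.qL a • m
  r : ∀ a m, R.r a m = P.qR a • m
  ρ : ∀ a m, R.ρ a m = P.qU a • m

variable {R R'}

lemma Underlies.l_one (h : R.Underlies) (m : M) : R.l 1 m = m := by
  rw [h.l]; exact one_smul P.Q m

lemma Underlies.r_one (h : R.Underlies) (m : M) : R.r 1 m = m := by
  rw [h.r]; exact one_smul P.Q m

lemma Underlies.isHom (h : R.Underlies) (h' : R'.Underlies) {φ : M →ₗ[K] M'}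
    (hφ : ∀ (q : P.Q) m, φ (q • m) = q • φ m) : IsHom R R' φ where
  l a m := by rw [h.l, h'.l, hφ]
  r a m := by rw [h.r, h'.r, hφ]
  ρ a m := by rw [h.ρ, h'.ρ, hφ]

/-- The three kinds of operators in a representation generate Q(A) over K. -/
lemma IsHom.map_smul_Q [IsScalarTower K P.Q M] [IsScalarTower K P.Q M'] (h : R.Underlies)
    (h' : R'.Underlies) {φ : M →ₗ[K] M'} (hφ : IsHom R R' φ) (q : P.Q) (m : M) :
    φ (q • m) = q • φ m := by
  induction q using P.Q_gen_induction generalizing m with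
  | h1 => rw [one_smul, one_smul]
  | hsmul c x hx => rw [smul_assoc, smul_assoc, map_smul, hx]
  | hadd x y hx hy => rw [add_smul, add_smul, map_add, hx, hy]
  | hmul x y hx hy => rw [mul_smul, mul_smul, hx, hy]
  | hL a => rw [← h.l, ← h'.l, hφ.l]
  | hR a => rw [← h.r, ← h'.r, hφ.r]
  | hU a => rw [← h.ρ, ← h'.ρ, hφ.ρ]

variable (P M) in
/-- The representation underlying a `Q(A)`-module. -/
def ofModule [IsScalarTower K P.Q M] : Rep P M where
  l := (Algebra.lsmul K K M).toLinearMap ∘ₗ P.qL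
  r := (Algebra.lsmul K K M).toLinearMap ∘ₗ P.qR
  ρ := (Algebra.lsmul K K M).toLinearMap ∘ₗ P.qU
  l_mul a b m := by simp [qL_mul]
  r_mul a b m := by simp [qR_mul]
  l_r a b m := by simp [← mul_smul, qL_qR_comm]
  ρ_br x y m := by simp [qU_br]
  ρ_l x y m := by simp [← mul_smul, qU_qL, add_smul]
  ρ_r x y m := by simp [← mul_smul, qU_qR, add_smul]

variable (P M) in
lemma ofModule_underlies [IsScalarTower K P.Q M] : (ofModule P M).Underlies where
  l _ _ := rfl
  r _ _ := rfl
  ρ _ _ := rfl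

end Modules

/-- The actions of the associative algebra are unital. -/
structure IsUnital (R : Rep P M) : Prop where
  l : R.l 1 = 1
  r : R.r 1 = 1

/-! ### From unital representations to modules over Q(A) -/

variable {R : Rep P M} (hR : R.IsUnital)

/-- The action of `Aᵉ` on a unital representation. -/
def envHom : A ⊗[K] Aᵐᵒᵖ →ₐ[K] Module.End K M :=
  Algebra.TensorProduct.lift
    (AlgHom.ofLinearMap R.l hR.l fun a b => LinearMap.ext fun m => R.l_mul a b m)
    (AlgHom.ofLinearMap (R.r ∘ₗ (MulOpposite.opLinearEquiv K).symm.toLinearMap) hR.r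
      fun a b => LinearMap.ext fun m => R.r_mul b.unop a.unop m)
    fun a b => LinearMap.ext fun m => R.l_r a b.unop m

lemma envHom_tmul (a : A) (b : Aᵐᵒᵖ) : envHom hR (a ⊗ₜ b) = R.l a * R.r b.unop := by
  exact Algebra.TensorProduct.lift_tmul _ _ _ _ _

variable (R) in
/-- The action of `U(A)` on a representation. -/
def uHom : P.U →ₐ[K] Module.End K M := P.liftU R.ρ R.ρ_lie

lemma uHom_toU (x : A) : R.uHom (P.toU x) = R.ρ x := P.liftU_toU _ _ x

/-- The action of `Q(A)` on a unital representation, as a linear map. -/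
def qLin : P.Q →ₗ[K] Module.End K M :=
  TensorProduct.lift ((LinearMap.mul K (Module.End K M)).compl₁₂ (envHom hR).toLinearMap
    R.uHom.toLinearMap)

lemma qLin_smash (b : A ⊗[K] Aᵐᵒᵖ) (u : P.U) :
    qLin hR (P.smash b u) = envHom hR b * R.uHom u := rfl

/-- The defining relation of the smash product, a consequence of `ρ_l` and `ρ_r`; multiplicativity
of `qLin` rests on it. -/
lemma ρ_mul_envHom (x : A) (c : A ⊗[K] Aᵐᵒᵖ) :
    R.ρ x * envHom hR c = envHom hR (P.envAct (P.toU x) c) + envHom hR c * R.ρ x := by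
  induction c with
  | zero => simp
  | add b b' hb hb' => simp only [map_add, mul_add, add_mul, hb, hb']; abel
  | tmul a b =>
    ext m
    simp only [envAct_toU, map_add, Module.End.mul_apply, LinearMap.add_apply, envHom_tmul,
      R.ρ_l, R.ρ_r, MulOpposite.unop_op]
    abel

lemma uHom_mul_qLin (u : P.U) (z : P.Q) :
    R.uHom u * qLin hR z = qLin hR (P.diagMul u z) := by
  induction u using P.U_induction generalizing z with
  | h1 c => simp [Algebra.algebraMap_eq_smul_one]
  | hadd u v hu hv => simp only [map_add, add_mul, LinearMap.add_apply, hu, hv]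
  | hmul u v hu hv => simp only [map_mul, mul_assoc, hu, hv, Module.End.mul_apply]
  | hx x =>
    induction z using P.Q_induction with
    | h0 => simp
    | ha y z hy hz => rw [map_add, mul_add, hy, hz, map_add, map_add]
    | ht b v =>
      rw [diagMul_toU_smash, map_add, qLin_smash, qLin_smash, qLin_smash, ← mul_assoc,
        uHom_toU, ρ_mul_envHom, map_mul, uHom_toU, add_mul, mul_assoc]

lemma qLin_mul (x y : P.Q) : qLin hR (x * y) = qLin hR x * qLin hR y := by
  change qLin hR (P.mulQ x y) = _
  induction x using P.Q_induction with
  | h0 => simp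
  | ha x z hx hz => rw [map_add, map_add, add_mul, ← hx, ← hz, LinearMap.add_apply, map_add]
  | ht b u =>
    rw [mulQ_smash, qLin_smash, mul_assoc, uHom_mul_qLin, Module.End.mul_apply]
    generalize P.diagMul u y = z
    induction z using P.Q_induction with
    | h0 => simp
    | ha x z hx hz => simp only [map_add, mul_add, hx, hz]
    | ht c v => rw [envMul_smash, qLin_smash, qLin_smash, map_mul, mul_assoc]

/-- A unital representation as a representation of the algebra `Q(A)`. -/
def toAlgHom : P.Q →ₐ[K] Module.End K M :=
  AlgHom.ofLinearMap (qLin hR)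
    (by change qLin hR (P.smash 1 1) = 1; rw [qLin_smash, map_one, map_one, mul_one])
    (qLin_mul hR)

/-- The `Q(A)`-module structure of a unital representation. -/
abbrev toModule : Module P.Q M := Module.compHom M (toAlgHom hR).toRingHom

lemma toModule_isScalarTower :
    letI := toModule hR
    IsScalarTower K P.Q M :=
  letI := toModule hR
  ⟨fun c q m => by
    change toAlgHom hR (c • q) m = c • toAlgHom hR q m
    rw [map_smul, LinearMap.smul_apply]⟩

lemma toModule_underlies :
    letI := toModule hR
    R.Underlies :=
  letI := toModule hR
  { l := fun a m => by
      change _ = qLin hR (P.smash _ _) m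
      rw [qLin_smash, map_one, mul_one, envHom_tmul]
      simp [hR.r]
    r := fun a m => by
      change _ = qLin hR (P.smash _ _) m
      rw [qLin_smash, map_one, mul_one, envHom_tmul]
      simp [hR.l]
    ρ := fun a m => by
      change _ = qLin hR (P.smash _ _) m
      rw [qLin_smash, map_one, one_mul, uHom_toU] }

lemma IsUnital.coindPoly (h : R.IsUnital) {I : Type u} [LinearOrder I] (b : Module.Basis I K A) :
    (R.coindPoly b).IsUnital where
  l := LinearMap.ext fun F => LinearMap.ext fun s => by
    change R.l 1 (F s) = F s
    rw [h.l]; rfl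
  r := LinearMap.ext fun F => LinearMap.ext fun s => by
    change R.r 1 (F s) = F s
    rw [h.r]; rfl

lemma IsUnital.coindA (h : R.IsUnital) : R.coindA.IsUnital where
  l := LinearMap.ext fun F => LinearMap.ext fun s => by
    change R.l 1 (F s) = F s
    rw [h.l]; rfl
  r := LinearMap.ext fun F => LinearMap.ext fun s => by
    change F (1 * s) = F s
    rw [one_mul]

lemma Underlies.isUnital [Module P.Q M] (h : R.Underlies) : R.IsUnital where
  l := LinearMap.ext h.l_one
  r := LinearMap.ext h.r_one

end Rep

end PoissonBracket

/-! ### Comparison of the total complex with `Ext` over the quasi-Poisson enveloping algebra -/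

lemma LinearMap.exists_splitting {K U V W : Type*} [Field K] [AddCommGroup U] [Module K U]
    [AddCommGroup V] [Module K V] [AddCommGroup W] [Module K W] (f : U →ₗ[K] V) (g : V →ₗ[K] W)
    (hf : Function.Injective f) (hg : Function.Surjective g) (hfg : Function.Exact f g) :
    ∃ (s : W →ₗ[K] V) (t : V →ₗ[K] U),
      (∀ u, t (f u) = u) ∧ (∀ w, g (s w) = w) ∧ ∀ v, f (t v) + s (g v) = v := by
  obtain ⟨t, ht⟩ := f.exists_leftInverse_of_injective (LinearMap.ker_eq_bot.2 hf)
  obtain ⟨s, hs⟩ := g.exists_rightInverse_of_surjective (LinearMap.range_eq_top.2 hg)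
  have ht' : ∀ u, t (f u) = u := LinearMap.congr_fun ht
  have hs' : ∀ w, g (s w) = w := LinearMap.congr_fun hs
  -- An arbitrary section s need not have image in the kernel of t; subtracting f t s arranges this.
  refine ⟨s - f ∘ₗ t ∘ₗ s, t, ht', fun w => ?_, fun v => ?_⟩
  · have : g (f (t (s w))) = 0 := hfg.apply_apply_eq_zero _
    simp [hs', this]
  · obtain ⟨u, hu⟩ := (hfg (v - s (g v))).1 (by rw [map_sub, hs', sub_self])
    have hv : v = f u + s (g v) := by rw [hu, sub_add_cancel]
    have htv : t v = u + t (s (g v)) := by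
      conv_lhs => rw [hv, map_add, ht']
    simp only [LinearMap.sub_apply, LinearMap.comp_apply]
    rw [htv, map_add, add_add_sub_cancel, ← hv]

namespace PoissonBracket

open DoubleComplex GradedDiff CategoryTheory Abelian

variable {K A : Type u} [Field K] [Ring A] [Algebra K A] (P : PoissonBracket K A)

instance : IsScalarTower K P.Q A :=
  ⟨fun c q m => by
    change P.reg (c • q) m = c • P.reg q m
    rw [map_smul, LinearMap.smul_apply]⟩

lemma qL_smul (a b : A) : P.qL a • b = a * b := by
  change P.regLin (P.smash (a ⊗ₜ MulOpposite.op 1) 1) b = _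
  rw [regLin_smash_tmul, map_one, mul_one, Module.End.one_apply]

lemma qR_smul (a b : A) : P.qR a • b = b * a := by
  change P.regLin (P.smash (1 ⊗ₜ MulOpposite.op a) 1) b = _
  rw [regLin_smash_tmul, map_one, one_mul, Module.End.one_apply]

lemma qU_smul (a b : A) : P.qU a • b = P.br a b := by
  change P.regLin (P.smash (1 ⊗ₜ MulOpposite.op 1) (P.toU a)) b = _
  rw [regLin_smash_tmul, adU_toU, one_mul, mul_one]

variable {P}

namespace Rep

lemma IsHom.comp {M M' M'' : Type u} [AddCommGroup M] [Module K M] [AddCommGroup M'] [Module K M']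
    [AddCommGroup M''] [Module K M''] {R : Rep P M} {R' : Rep P M'} {R'' : Rep P M''}
    {φ : M →ₗ[K] M'} {ψ : M' →ₗ[K] M''} (hφ : IsHom R R' φ) (hψ : IsHom R' R'' ψ) :
    IsHom R R'' (ψ ∘ₗ φ) where
  l a m := by rw [LinearMap.comp_apply, hφ.l, hψ.l]; rfl
  r a m := by rw [LinearMap.comp_apply, hφ.r, hψ.r]; rfl
  ρ a m := by rw [LinearMap.comp_apply, hφ.ρ, hψ.ρ]; rfl

/-! ### Vanishing for injective modules -/

section Injective

variable {X Y : Type u} [AddCommGroup X] [Module K X] [AddCommGroup Y] [Module K Y]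
  [Module P.Q X] [IsScalarTower K P.Q X]

/-- Injectivity splits φ over Q(A), so X is a retract of Y. -/
lemma Z_le_B_of_injective_hom [Injective (ModuleCat.of P.Q X)] {R : Rep P X} {T : Rep P Y}
    (hR : R.Underlies) (hT : T.IsUnital) {φ : X →ₗ[K] Y} (hφ : IsHom R T φ)
    (hφi : Function.Injective φ) (n : ℕ) (hn : T.Z (n + 1) ≤ T.B (n + 1)) :
    R.Z (n + 1) ≤ R.B (n + 1) := by
  let := toModule hT
  have := toModule_isScalarTower hT
  have hT' : T.Underlies := toModule_underlies hT
  let φQ : X →ₗ[P.Q] Y := { φ with map_smul' := fun q m => hφ.map_smul_Q hR hT' q m }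
  have : Mono (ModuleCat.ofHom φQ) := (ModuleCat.mono_iff_injective _).2 hφi
  let ψQ : Y →ₗ[P.Q] X :=
    (Injective.factorThru (𝟙 (ModuleCat.of P.Q X)) (ModuleCat.ofHom φQ)).hom
  have hψQ : ∀ m, ψQ (φ m) = m := fun m =>
    LinearMap.congr_fun (congrArg ModuleCat.Hom.hom
      (Injective.comp_factorThru (𝟙 (ModuleCat.of P.Q X)) (ModuleCat.ofHom φQ))) m
  exact Z_le_B_of_retract hφ (hT'.isHom hR (φ := ψQ.restrictScalars K) fun q m => map_smul ψQ q m)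
    hψQ n hn

/-- The embedding is into Hom(A, Hom(S(A), X)); unitality makes it injective, because evaluation at
1 and at the empty monomial returns the element. -/
lemma Z_le_B_of_injective [CharZero K] [Injective (ModuleCat.of P.Q X)] (n : ℕ) :
    (ofModule P X).Z (n + 1) ≤ (ofModule P X).B (n + 1) := by
  have hR := ofModule_underlies P X
  let b := Module.Basis.ofVectorSpace K A
  classical
  let : LinearOrder (Module.Basis.ofVectorSpaceIndex K A) := linearOrderOfSTO WellOrderingRel
  refine Z_le_B_of_injective_hom hR (hR.isUnital.coindPoly b).coindA
    (φ := ((ofModule P X).coindPoly b).toCoindA ∘ₗ toCoindPoly _)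
    (((ofModule P X).isHom_toCoindPoly b).comp ((ofModule P X).coindPoly b).isHom_toCoindA)
    (fun m m' h => ?_) n (Z_le_B_coind _ b n)
  have h1 := LinearMap.congr_fun (LinearMap.congr_fun h 1) (PBW.mono K 0)
  have h2 : ∀ m : X, ((ofModule P X).coindPoly b).toCoindA (toCoindPoly _ m) 1 (PBW.mono K 0) = m :=
    fun m => by
      change ((ofModule P X).coindPoly b).r 1 (toCoindPoly _ m) _ = m
      rw [(hR.isUnital.coindPoly b).r, Module.End.one_apply, toCoindPoly_apply]
      simp [PBW.mono]
  rwa [LinearMap.comp_apply, LinearMap.comp_apply, h2, h2] at h1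

end Injective

/-! ### Cocycles of degree zero -/

section DegreeZero

variable {M M' : Type u} [AddCommGroup M] [Module K M] [AddCommGroup M'] [Module K M']
  (R : Rep P M)

/-- The `0`-cochain given by an element. -/
def constFam : M →ₗ[K] BiFam K A M where
  toFun m
    | 0, 0 => AlternatingMap.constOfIsEmpty K A (Fin 0) (MultilinearMap.constOfIsEmpty K _ m)
    | 0, _ + 1 => 0
    | _ + 1, _ => 0
  map_add' m m' := by
    funext i j
    rcases i with _ | i <;> rcases j with _ | j <;> first | rfl | exact (add_zero _).symm
  map_smul' c m := by
    funext i j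
    rcases i with _ | i <;> rcases j with _ | j <;> first | rfl | exact (smul_zero c).symm

lemma mapCoch_constFam (φ : M →ₗ[K] M') (m : M) :
    mapCoch φ (constFam (A := A) m) = constFam (φ m) := by
  refine ext_fam fun i j x a => ?_
  rw [mapCoch_apply]
  rcases i with _ | i <;> rcases j with _ | j <;> first | rfl | exact map_zero φ

lemma constFam_injective : Function.Injective (constFam (K := K) (A := A) (M := M)) :=
  fun _ _ h => congrArg (fun f : BiFam K A M => f 0 0 Fin.elim0 Fin.elim0) h

lemma exists_constFam_eq (f : BiFam K A M) (hf : f ∈ total K (BiCoch K A M) 0) :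
    ∃ m, constFam m = f := by
  refine ⟨f 0 0 Fin.elim0 Fin.elim0, funext fun i => funext fun j => ?_⟩
  rcases i with _ | i
  · rcases j with _ | j
    · refine AlternatingMap.ext fun x => MultilinearMap.ext fun a => ?_
      rw [Subsingleton.elim x Fin.elim0, Subsingleton.elim a Fin.elim0]
      rfl
    · exact (hf 0 (j + 1) (by omega)).symm
  · exact (hf (i + 1) j (by omega)).symm

lemma constFam_mem_total (m : M) : constFam (A := A) m ∈ total K (BiCoch K A M) 0 := by
  intro i j hij
  rcases i with _ | i <;> rcases j with _ | j <;> first | rfl | exact absurd rfl hij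

/-- The differential of a constant has two components: the commutator with a and the Lie action of
x. -/
lemma constFam_mem_Z (m : M) :
    constFam m ∈ R.Z 0 ↔ (∀ a, R.l a m = R.r a m) ∧ ∀ x, R.ρ x m = 0 := by
  have hV : ∀ x a, R.dV 0 0 (constFam m 0 0) x a = R.l (a 0) m - R.r (a 0) m := fun x a => by
    change R.hochD 0 (MultilinearMap.constOfIsEmpty K _ m) a = _
    simp [hochD_apply, sub_eq_add_neg]
  have hH : ∀ x a, R.dH 0 0 (constFam m 0 0) x a = R.ρ (x 0) m := fun x a => by
    change AlternatingMap.alternatizeUncurryFin (ceAct (A := A) (N := HCoch K A M 0)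
      (R.cochRep 0) (constFam m 0 0)) x a = _
    rw [AlternatingMap.alternatizeUncurryFin_apply, Fin.sum_univ_one]
    change ((-1 : ℤ) ^ 0 • R.cochRep 0 (x 0) (MultilinearMap.constOfIsEmpty K _ m)) a = _
    rw [pow_zero, one_smul, cochRep_zero]
    rfl
  constructor
  · rintro ⟨-, h⟩
    have h : R.diff (constFam m) = 0 := h
    refine ⟨fun a => sub_eq_zero.1 ?_, fun x => ?_⟩
    · rw [← hV Fin.elim0 fun _ => a]
      exact DFunLike.congr_fun (DFunLike.congr_fun (congrFun (congrFun h 1) 0) _) _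
    · rw [← hH (fun _ => x) Fin.elim0]
      exact DFunLike.congr_fun (DFunLike.congr_fun (congrFun (congrFun h 0) 1) _) _
  · rintro ⟨h1, h2⟩
    refine ⟨constFam_mem_total m, ext_fam fun i j x a => ?_⟩
    have h0 : R.diff (constFam m) ∈ total K (BiCoch K A M) 1 :=
      tot_mem_total _ _ _ _ (constFam_mem_total m)
    by_cases hij : i + j = 1
    · obtain ⟨rfl, rfl⟩ | ⟨rfl, rfl⟩ : (i = 1 ∧ j = 0) ∨ (i = 0 ∧ j = 1) := by omega
      · exact (hV x a).trans (sub_eq_zero.2 (h1 _))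
      · exact (hH x a).trans (h2 _)
    · rw [h0 i j hij]
      rfl

variable (P M) in
/-- The `0`-cocycle given by a morphism of `Q(A)`-modules. -/
def homToZ [Module P.Q M] [IsScalarTower K P.Q M] :
    (ModuleCat.of P.Q A ⟶ ModuleCat.of P.Q M) →+ (ofModule P M).Z 0 where
  toFun f := ⟨constFam (f.hom (1 : A)), ((ofModule P M).constFam_mem_Z _).2
    ⟨fun a => by
      change P.qL a • f.hom (1 : A) = P.qR a • f.hom (1 : A)
      rw [← map_smul, ← map_smul]
      congr 1
      exact (P.qL_smul a 1).trans ((mul_one a).trans ((one_mul a).symm.trans (P.qR_smul a 1).symm)),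
    fun x => by
      change P.qU x • f.hom (1 : A) = 0
      rw [← map_smul]
      exact (congrArg f.hom ((P.qU_smul x 1).trans (P.br_one x))).trans (map_zero f.hom)⟩⟩
  map_zero' := Subtype.ext (map_zero constFam)
  map_add' f g := Subtype.ext (map_add constFam _ _)

lemma homToZ_apply [Module P.Q M] [IsScalarTower K P.Q M]
    (f : ModuleCat.of P.Q A ⟶ ModuleCat.of P.Q M) :
    (homToZ P M f : BiFam K A M) = constFam (f.hom (1 : A)) := rfl

/-- As a Q(A)-module A is generated by 1, so a morphism is determined by the image m of 1.
Conversely, the cocycle conditions on m are what makes a ↦ am respect right multiplications and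
brackets. -/
lemma homToZ_bijective [Module P.Q M] [IsScalarTower K P.Q M] :
    Function.Bijective (homToZ P M) := by
  constructor
  · intro f g h
    have h1 : f.hom (1 : A) = g.hom (1 : A) := constFam_injective (congrArg Subtype.val h)
    refine ModuleCat.hom_ext (LinearMap.ext fun a : A => ?_)
    have h2 : ∀ f : ModuleCat.of P.Q A ⟶ ModuleCat.of P.Q M, f.hom a = P.qL a • f.hom (1 : A) :=
      fun f => by
        rw [← map_smul]
        exact congrArg f.hom ((mul_one a).symm.trans (P.qL_smul a 1).symm)
    rw [h2 f, h2 g, h1]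
  · rintro ⟨f, hf⟩
    obtain ⟨m, rfl⟩ := exists_constFam_eq f hf.1
    obtain ⟨h1, h2⟩ := ((ofModule P M).constFam_mem_Z m).1 hf
    have hφ : IsHom (ofModule P A) (ofModule P M) ((ofModule P M).l.flip m) :=
      { l := fun a b => by
          rw [ofModule_underlies P A |>.l, qL_smul]
          exact (ofModule P M).l_mul a b m
        r := fun a b => by
          rw [ofModule_underlies P A |>.r, qR_smul, LinearMap.flip_apply, LinearMap.flip_apply,
            ← (ofModule P M).l_r, ← h1]
          exact (ofModule P M).l_mul b a m
        ρ := fun x a => by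
          rw [ofModule_underlies P A |>.ρ, qU_smul, LinearMap.flip_apply, LinearMap.flip_apply,
            (ofModule P M).ρ_l, h2, map_zero, add_zero] }
    refine ⟨ModuleCat.ofHom { (ofModule P M).l.flip m with
      map_smul' := fun q a => hφ.map_smul_Q (ofModule_underlies P A) (ofModule_underlies P M) q a },
      Subtype.ext (congrArg constFam ?_)⟩
    exact (ofModule_underlies P M).l_one m

variable (P M) in
/-- The `0`-cocycles with coefficients in `M` are the morphisms of `Q(A)`-modules `A → M`. -/
def extZeroEquiv [Module P.Q M] [IsScalarTower K P.Q M] :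
    Ext.{u} (ModuleCat.of P.Q A) (ModuleCat.of P.Q M) 0 ≃ₗ[K] (ofModule P M).Z 0 :=
  LinearEquiv.ofBijective
    { toFun := fun e => homToZ P M (Ext.linearEquiv₀ (R := K) e)
      map_add' := fun e e' => by rw [map_add, map_add]
      map_smul' := fun c e => by
        refine (congrArg (homToZ P M)
          (LinearEquiv.map_smul (Ext.linearEquiv₀ (R := K)) c e)).trans (Subtype.ext ?_)
        -- Scalars act on morphisms through `algebraMap K P.Q`; the scalar tower identifies this
        -- with the given K-structure.
        have h : ∀ m : M, constFam (A := A) (algebraMap K P.Q c • m) = c • constFam m := fun m => by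
          rw [algebraMap_smul, map_smul]
        exact h _ }
    (homToZ_bijective.comp (Ext.linearEquiv₀ (R := K)).bijective)

lemma extZeroEquiv_mk₀ [Module P.Q M] [IsScalarTower K P.Q M]
    (f : ModuleCat.of P.Q A ⟶ ModuleCat.of P.Q M) :
    (extZeroEquiv P M (Ext.mk₀ f) : BiFam K A M) = constFam (f.hom (1 : A)) := by
  change (homToZ P M (Ext.linearEquiv₀ (R := K) (Ext.mk₀ f)) : BiFam K A M) = _
  rw [← Ext.linearEquiv₀_symm_apply (R := K), LinearEquiv.apply_symm_apply, homToZ_apply]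

end DegreeZero

end Rep

end PoissonBracket

/-! ### `Ext` over `Q(A)` is the cohomology of the total complex -/

open CategoryTheory Abelian in
/-- Dimension shifting for `Ext` along an embedding into an injective object. -/
theorem CategoryTheory.Abelian.Ext.exists_shift {K : Type*} [CommRing K] {C : Type*} [Category C]
    [Abelian C] [Linear K C] [HasExt.{u} C] {S : ShortComplex C} (hS : S.ShortExact)
    [Injective S.X₂] (X : C) (n : ℕ) :
    Nonempty ((Ext.{u} X S.X₃ n ⧸ LinearMap.range
      ((Ext.mk₀ S.g).postcompOfLinear K X (add_zero n))) ≃ₗ[K] Ext.{u} X S.X₁ (n + 1)) := by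
  let δ : Ext.{u} X S.X₃ n →ₗ[K] Ext.{u} X S.X₁ (n + 1) :=
    hS.extClass.postcompOfLinear K X rfl
  have hδ : Function.Surjective δ := fun x =>
    Ext.covariant_sequence_exact₁ X hS x (Ext.eq_zero_of_injective _) rfl
  refine ⟨(Submodule.quotEquivOfEq _ _ (Submodule.ext fun x => ⟨?_, fun hx => ?_⟩)).trans
    (δ.quotKerEquivOfSurjective hδ)⟩
  · rintro ⟨y, rfl⟩
    change (y.comp (Ext.mk₀ S.g) (add_zero n)).comp hS.extClass rfl = 0
    rw [Ext.comp_assoc_of_second_deg_zero, ShortComplex.ShortExact.comp_extClass, Ext.comp_zero]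
  · exact Ext.covariant_sequence_exact₃ X hS x rfl hx

namespace PoissonBracket

open DoubleComplex GradedDiff CategoryTheory Abelian

namespace Rep

variable {K A : Type u} [Field K] [Ring A] [Algebra K A] {P : PoissonBracket K A}

/-! ### Dimension shifting in the coefficients -/

section Shift

variable {X Y W : Type u} [AddCommGroup X] [Module K X] [Module P.Q X] [IsScalarTower K P.Q X]
  [AddCommGroup Y] [Module K Y] [Module P.Q Y] [IsScalarTower K P.Q Y]
  [AddCommGroup W] [Module K W] [Module P.Q W] [IsScalarTower K P.Q W]

lemma diff_mapCoch (f : X →ₗ[P.Q] Y) (v : BiFam K A X) :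
    mapCoch (f.restrictScalars K) ((ofModule P X).diff v) =
      (ofModule P Y).diff (mapCoch (f.restrictScalars K) v) :=
  ((ofModule_underlies P X).isHom (ofModule_underlies P Y) fun q m => map_smul f q m).diff v

lemma mapCoch_mem_total {M M' : Type u} [AddCommGroup M] [Module K M] [AddCommGroup M']
    [Module K M'] (φ : M →ₗ[K] M') (n : ℕ) (v : BiFam K A M)
    (hv : v ∈ total K (BiCoch K A M) n) : mapCoch φ v ∈ total K (BiCoch K A M') n :=
  mapFam_mem_total _ _ _ hv

variable [CharZero K] (f : X →ₗ[P.Q] Y) (g : Y →ₗ[P.Q] W)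
  (hf : Function.Injective f) (hg : Function.Surjective g) (hfg : Function.Exact f g)
  [Injective (ModuleCat.of P.Q Y)]

include hf hg hfg in
-- A K-linear splitting of the coefficients splits the complexes degreewise, and injectivity of Y
-- makes the middle complex acyclic.
lemma coh_shift (n : ℕ) :
    Nonempty (coh (total K (BiCoch K A X)) (ofModule P X).diff (n + 1) ≃ₗ[K]
      SubQuot K (BiFam K A W) ((ofModule P W).Z n)
        (((ofModule P Y).Z n).map (mapCoch (g.restrictScalars K)))) := by
  obtain ⟨s, t, htf, hgs, hsum⟩ :=
    LinearMap.exists_splitting (f.restrictScalars K) (g.restrictScalars K) hf hg hfg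
  exact exists_shift (mapCoch (f.restrictScalars K)) (mapCoch (g.restrictScalars K)) (mapCoch s)
    (mapCoch t) (mapCoch_mem_total _) (mapCoch_mem_total _) (mapCoch_mem_total _)
    (mapCoch_mem_total _) (tot_mem_total _ _) (ofModule P Y).diff_diff (diff_mapCoch f)
    (diff_mapCoch g) (fun v => ext_fam fun i j x a => htf _)
    (fun v => ext_fam fun i j x a => hgs _) (fun v => ext_fam fun i j x a => hsum _)
    (fun v => ext_fam fun i j x a => hfg.apply_apply_eq_zero _) n (Z_le_B_of_injective n)

include hg in
lemma map_Z_eq_B (n : ℕ) :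
    ((ofModule P Y).Z (n + 1)).map (mapCoch (g.restrictScalars K)) = (ofModule P W).B (n + 1) := by
  obtain ⟨s, hs⟩ := (g.restrictScalars K).exists_rightInverse_of_surjective
    (LinearMap.range_eq_top.2 hg)
  exact map_cyc_eq_bdry (mapCoch (g.restrictScalars K)) (mapCoch s) (mapCoch_mem_total _)
    (mapCoch_mem_total _) (tot_mem_total _ _) (ofModule P Y).diff_diff (diff_mapCoch g)
    (fun v => ext_fam fun i j x a => LinearMap.congr_fun hs _) n (Z_le_B_of_injective n)

include hf hg hfg in
-- Both theories pass from X to W by dividing out the image of Y. For n = 0 the images match under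
-- `extZeroEquiv`. For n > 0 the Ext of Y is zero, while the cocycles of Y map onto the coboundaries
-- of W.
lemma nonempty_ext_equiv_succ (n : ℕ)
    (ih : Nonempty (Ext.{u} (ModuleCat.of P.Q A) (ModuleCat.of P.Q W) n ≃ₗ[K]
      coh (total K (BiCoch K A W)) (ofModule P W).diff n)) :
    Nonempty (Ext.{u} (ModuleCat.of P.Q A) (ModuleCat.of P.Q X) (n + 1) ≃ₗ[K]
      coh (total K (BiCoch K A X)) (ofModule P X).diff (n + 1)) := by
  let S : ShortComplex (ModuleCat.{u} P.Q) :=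
    ShortComplex.mk (ModuleCat.ofHom f) (ModuleCat.ofHom g)
      (ModuleCat.hom_ext (LinearMap.ext fun x => hfg.apply_apply_eq_zero x))
  have hS : S.ShortExact := ModuleCat.shortComplex_shortExact S hfg hf hg
  have : Injective S.X₂ := ‹Injective (ModuleCat.of P.Q Y)›
  obtain ⟨e⟩ := coh_shift f g hf hg hfg n
  obtain ⟨e'⟩ := Ext.exists_shift (K := K) hS (ModuleCat.of P.Q A) n
  suffices h : Nonempty ((Ext.{u} (ModuleCat.of P.Q A) (ModuleCat.of P.Q W) n ⧸ LinearMap.range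
      ((Ext.mk₀ S.g).postcompOfLinear K (ModuleCat.of P.Q A) (add_zero n))) ≃ₗ[K]
      SubQuot K (BiFam K A W) ((ofModule P W).Z n)
        (((ofModule P Y).Z n).map (mapCoch (g.restrictScalars K)))) by
    obtain ⟨e''⟩ := h
    exact ⟨(e'.symm.trans e'').trans e.symm⟩
  cases n with
  | zero =>
    refine ⟨Submodule.Quotient.equiv _ _ (extZeroEquiv P W) (Submodule.ext fun z => ⟨?_, ?_⟩)⟩
    · rintro ⟨_, ⟨y, rfl⟩, rfl⟩
      obtain ⟨h, rfl⟩ := Ext.addEquiv₀.symm.surjective y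
      refine ⟨extZeroEquiv P Y (Ext.mk₀ h), Subtype.property _, ?_⟩
      rw [extZeroEquiv_mk₀, mapCoch_constFam]
      change _ = (extZeroEquiv P W ((Ext.mk₀ h).comp (Ext.mk₀ S.g) (add_zero 0)) : BiFam K A W)
      rw [Ext.mk₀_comp_mk₀, extZeroEquiv_mk₀]
      rfl
    · rintro ⟨y, hy, hyz⟩
      obtain ⟨x, hx⟩ := (extZeroEquiv P Y).surjective ⟨y, hy⟩
      obtain ⟨h, rfl⟩ := Ext.addEquiv₀.symm.surjective x
      refine ⟨_, ⟨Ext.mk₀ h, rfl⟩, Subtype.ext ?_⟩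
      change (extZeroEquiv P W ((Ext.mk₀ h).comp (Ext.mk₀ S.g) (add_zero 0)) : BiFam K A W) = z
      obtain rfl : (extZeroEquiv P Y (Ext.mk₀ h) : BiFam K A Y) = y := congrArg Subtype.val hx
      rw [Ext.mk₀_comp_mk₀, extZeroEquiv_mk₀, ← show _ = (z : BiFam K A W) from hyz,
        extZeroEquiv_mk₀, mapCoch_constFam]
      rfl
  | succ n =>
    obtain ⟨e₀⟩ := ih
    have h0 : LinearMap.range ((Ext.mk₀ S.g).postcompOfLinear K (ModuleCat.of P.Q A)
        (add_zero (n + 1))) = ⊥ := by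
      refine LinearMap.range_eq_bot.2 (LinearMap.ext fun x => ?_)
      rw [Ext.eq_zero_of_injective x, map_zero, map_zero]
    exact ⟨((Submodule.quotEquivOfEqBot _ h0).trans e₀).trans (Submodule.quotEquivOfEq _ _
      (congrArg (Submodule.submoduleOf · _) (map_Z_eq_B g hg n).symm))⟩

end Shift

/-- The groups `Extⁿ(A, X)` are the cohomology of the total complex with coefficients in `X`. -/
theorem nonempty_ext_equiv [CharZero K] (n : ℕ) (X : Type u) [AddCommGroup X] [Module K X]
    [Module P.Q X] [IsScalarTower K P.Q X] :
    Nonempty (Ext.{u} (ModuleCat.of P.Q A) (ModuleCat.of P.Q X) n ≃ₗ[K]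
      coh (total K (BiCoch K A X)) (ofModule P X).diff n) := by
  induction n generalizing X with
  | zero =>
    refine ⟨(extZeroEquiv P X).trans (Submodule.quotEquivOfEqBot _ ?_).symm⟩
    exact Submodule.comap_bot _ |>.trans (Submodule.ker_subtype _)
  | succ n ih =>
    let J := Injective.under (ModuleCat.of P.Q X)
    -- The injective module comes with a Q(A)-action only; K acts by restriction.
    let : Module K J := Module.compHom J (algebraMap K P.Q)
    have : IsScalarTower K P.Q J := IsScalarTower.of_algebraMap_smul fun _ _ => rfl
    have : Injective (ModuleCat.of P.Q J) := inferInstanceAs (Injective J)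
    let f : X →ₗ[P.Q] J := (Injective.ι (ModuleCat.of P.Q X)).hom
    have hf : Function.Injective f := (ModuleCat.mono_iff_injective _).1
      (inferInstanceAs (Mono (Injective.ι (ModuleCat.of P.Q X))))
    exact nonempty_ext_equiv_succ f (LinearMap.range f).mkQ hf (Submodule.mkQ_surjective _)
      f.exact_map_mkQ_range n (ih _)

end Rep

end PoissonBracket

/-! ### The quasi-Poisson complex of `A` -/

namespace SubQuot

variable {K V : Type u} [Field K] [AddCommGroup V] [Module K V] (Z B O : Submodule K V)

lemma map_inf_injective : Function.Injective
    (SubQuot.map inf_le_left inf_le_left : SubQuot K V (Z ⊓ O) (B ⊓ O) →ₗ[K] SubQuot K V Z B) := by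
  rw [← LinearMap.ker_eq_bot, LinearMap.ker_eq_bot']
  intro q hq
  obtain ⟨⟨z, hz⟩, rfl⟩ := Submodule.mkQ_surjective _ q
  have h : (⟨z, hz.1⟩ : Z) ∈ B.submoduleOf Z := (Submodule.Quotient.mk_eq_zero _).1 hq
  exact (Submodule.Quotient.mk_eq_zero _).2 ⟨h, hz.2⟩

lemma map_inf_surjective (h : ∀ z ∈ Z, ∃ e ∈ B, e ∈ Z ∧ z - e ∈ O) : Function.Surjective
    (SubQuot.map inf_le_left inf_le_left : SubQuot K V (Z ⊓ O) (B ⊓ O) →ₗ[K] SubQuot K V Z B) := by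
  intro q
  obtain ⟨⟨z, hz⟩, rfl⟩ := Submodule.mkQ_surjective _ q
  obtain ⟨e, heB, heZ, he⟩ := h z hz
  refine ⟨Submodule.Quotient.mk ⟨z - e, sub_mem hz heZ, he⟩, (Submodule.Quotient.eq _).2 ?_⟩
  change z - e - z ∈ B
  rw [sub_sub_cancel_left]
  exact neg_mem heB

end SubQuot

namespace PoissonBracket

open DoubleComplex GradedDiff PoissonBracket.Rep

variable {K A : Type u} [Field K] [Ring A] [Algebra K A] (P : PoissonBracket K A)

lemma hochD_ofModule (i : ℕ) : (ofModule P A).hochD i = HCochain.d K A i := by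
  refine LinearMap.ext fun f => MultilinearMap.ext fun a => ?_
  rw [hochD_apply, (ofModule_underlies P A).l, (ofModule_underlies P A).r, qL_smul, qR_smul]
  simp [HCochain.d, HCochain.mulFirst, HCochain.mulLast, HCochain.contract]

lemma cochRep_ofModule (i : ℕ) : (ofModule P A).cochRep i = P.cochainRep i := by
  refine LinearMap.ext fun x => LinearMap.ext fun f => MultilinearMap.ext fun a => ?_
  rw [cochRep_apply, (ofModule_underlies P A).ρ, qU_smul]
  exact (P.cochainAct_apply x f a).symm

lemma dV_ofModule (i j : ℕ) : (ofModule P A).dV i j = sigmaV K A i j := by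
  rw [dV, hochD_ofModule]
  rfl

lemma exists_d_eq (i : ℕ) (h : Subsingleton (HH K A (i + 1))) (f : HCochain K A (i + 1))
    (hf : HCochain.d K A (i + 1) f = 0) : ∃ g, HCochain.d K A i g = f :=
  (Submodule.Quotient.mk_eq_zero _).1 (h.elim (Submodule.Quotient.mk (⟨f, hf⟩ :
    HCochain.cocycles K A (i + 1))) 0)

variable [CharZero K]

lemma dH_ofModule (i j : ℕ) : (ofModule P A).dH i j = P.sigmaH i j := by
  rw [dH, cochRep_ofModule]
  refine LinearMap.ext fun f => ?_
  cases j with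
  | zero => rfl
  | succ j =>
    -- By `brSum_eq` the sum over p < q is -1/2 of the double alternation in `ceD`.
    refine congrArg (P.sigmaHAct i (j + 1) f + ·) (AlternatingMap.ext fun x => ?_)
    exact (congrFun (P.brSum_eq f) x).symm

lemma diff_ofModule : (ofModule P A).diff = P.sigma := by
  refine LinearMap.ext fun f => funext fun i => funext fun j => ?_
  rcases i with _ | i <;> rcases j with _ | j
  · rfl
  · rw [diff, tot_zero_succ, dH_ofModule]
    rfl
  · rw [diff, tot_succ_zero, dV_ofModule]
    rfl
  · rw [diff, tot_succ_succ, dH_ofModule, dV_ofModule]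
    rfl

lemma Z_ofModule (n : ℕ) : (ofModule P A).Z n = P.kerSigma n := by
  rw [Z, diff_ofModule]
  rfl

lemma B_ofModule (n : ℕ) : (ofModule P A).B n = P.imSigma n := by
  rw [B, diff_ofModule]
  cases n <;> rfl

/-- The quasi-Poisson cohomology is the cohomology of the quasi-Poisson complex. -/
theorem nonempty_HQ_equiv (n : ℕ) : Nonempty (P.HQ n ≃ₗ[K] P.QCCohomology n) := by
  have h : Nonempty (P.HQ n ≃ₗ[K] SubQuot K (BiFamily K A) ((ofModule P A).Z n)
    ((ofModule P A).B n)) := nonempty_ext_equiv n A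
  rwa [Z_ofModule, B_ofModule] at h

lemma truncMap_bijective (k : ℕ) (hHH : ∀ n : ℕ, k < n → Subsingleton (HH K A n)) (n : ℕ) :
    Function.Bijective (P.truncMap n k) := by
  refine ⟨SubQuot.map_inf_injective _ _ _, SubQuot.map_inf_surjective _ _ _ fun z hz => ?_⟩
  obtain ⟨e, he, hk⟩ := exists_truncation (ofModule P A).dV_dV (ofModule P A).dH_dH
    (ofModule P A).dH_dV k
    (fun i j hi => (ofModule P A).exists_dV i j (by
      rw [hochD_ofModule, hochD_ofModule]
      exact exists_d_eq i (hHH (i + 1) (by omega)))) n z (by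
      rw [← P.Z_ofModule n] at hz
      exact hz)
  have heB : e ∈ P.imSigma n := by rw [← B_ofModule]; exact he
  have heZ : e ∈ P.kerSigma n := by
    rw [← Z_ofModule]
    exact bdry_le_cyc (tot_mem_total _ _) (ofModule P A).diff_diff n he
  refine ⟨e, heB, heZ, fun i j hij => ?_⟩
  by_cases h : i + j = n
  · exact hk i j (not_le.1 fun hi => hij ⟨h, hi⟩)
  · exact (congrArg₂ (· - ·) (hz.1 i j h) (heZ.1 i j h)).trans
      (sub_zero (0 : BiCochain K A i j))

end PoissonBracket

theorem mainTheorem9 {K A : Type u} [Field K] [CharZero K] [Ring A] [Algebra K A]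
    (P : PoissonBracket K A) (k : ℕ) (hk : 0 < k)
    (hHH : ∀ n : ℕ, k < n → Subsingleton (HH K A n)) (n : ℕ) :
    Nonempty (P.HQ n ≃ₗ[K] P.TruncQuot n k) ∧ Function.Bijective (P.truncMap n k) := by
  have h : Function.Bijective (P.truncMap n k) :=
    P.truncMap_bijective k hHH n
  obtain ⟨e⟩ := P.nonempty_HQ_equiv n
  exact ⟨⟨e.trans (LinearEquiv.ofBijective _ h).symm⟩, h⟩
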